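/- **Setting.** Let $f:\mathbb R^d\to\mathbb R^d$, $B:\mathbb R^d\to\mathbb R^{d\times m}$, $\ell:\mathbb R^d\to[0,\infty)$ be locally Lipschitz, $f(0)=0$, $\ell(0)=0$, $\beta>0$. Let $$V(y_0)=\inf\int_0^\infty\Big(\ell(y)+\tfrac\beta2|u|^2\Big)dt,\qquad y'=f(y)+B(y)u,\quad y(0)=y_0,\quad u\in L^2((0,\infty);\mathbb R^m),$$ be the value function, where the infimum runs over the controls that have a global solution $y$; assume that $V$ is finite and continuous on $\mathbb R^d$. For a function $v$ put $u_v=-\frac1\beta B^\top\nabla v$ (for $v=V$ this is defined a.e. where $V$ is locally Lipschitz). For a feedback $u$ let $y(\cdot;y_0,u)$ be the solution of $y'=f(y)+B(y)u(y)$, $y(0)=y_0$, and $\mathcal V_{u,T}(y_0)=\int_0^T\big(\ell(y(t;y_0,u))+\frac\beta2|u(y(t;y_0,u))|^2\big)dt$. We say that $(u,\omega,T)$ *stays in* $D$ if $u$ is locally Lipschitz on $D$, $\omega$ is open, $\overline\omega$ is a compact subset of $D$, $T>0$, and for every $y_0\in\omega$ the solution $y(\cdot;y_0,u)$ exists on $[0,T]$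 with values in $D$. **Hypotheses.** Let $\Omega\subset\mathbb R^d$ be open, convex and bounded, $\omega$ open with $\overline\omega\subset\Omega$, $\delta>0$, $w\in C^1(\Omega)$, and $$\omega_\delta=\{y\in\Omega:\ w(y)<\sup_\omega w+\delta\},\qquad \overline\omega\subset\omega_\delta,\quad \overline{\omega_\delta}\subset\Omega .$$ Assume the Lyapunov condition (with $g=0$) in the viscosity sense: for every $\bar y\in\omega_\delta$ and every $h\in C^1(\Omega)$ such that $V-h$ has a local minimum at $\bar y$, $$\nabla w(\bar y)^\top\big(f(\bar y)+B(\bar y)u_h(\bar y)\big)\le 0 .$$ Let $V$ be semi-concave in $\Omega$ with constant $C>0$, i.e. $V-\frac C2|\cdot|^2$ is concave on $\Omega$. Let $\rho\ge0$ be smooth, supported in the closed unit ball, $\int\rho=1$, $\rho_\varepsilon=\varepsilon^{-d}\rho(\cdot/\varepsilon)$, $V_\varepsilon=\rho_\varepsilon*V$, $u_\varepsilon=u_{V_\varepsilon}$, and $p\in[1,\infty)$. For $\varepsilon>0$ put $$\sigma^1_\varepsilon=\sup_{x\in\omega_\delta,\,y\in B(x,\varepsilon)}\big|\nabla w(x)^\top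 f(x)-\nabla w(y)^\top f(y)\big|,\qquad \sigma^2_\varepsilon=\sup_{x\in\omega_\delta,\,y\in B(x,\varepsilon)}\big|B(x)^\top\nabla w(x)-B(y)^\top\nabla w(y)\big| .$$ For a vector- or matrix-valued $F$ on a set $S$ put $\|F\|_{\infty,S}=\sup_{x\in S}\max_{i,j}|F_{ij}(x)|$ and $\|F\|_{Lip(S)}=\sup_{x\neq y\in S}\max_{i,j}\frac{|F_{ij}(x)-F_{ij}(y)|}{|x-y|}+\|F\|_{\infty,S}$, and let $$K=\frac1\beta\Big(mdC\|B\|^2_{\infty,\omega_\delta}+md^2\|B\|^2_{Lip(\omega_\delta)}\|\nabla V\|_{L^\infty(\omega_\delta)}\Big)+d\|f\|_{Lip(\overline\Omega)} .$$ Let $\kappa:(0,1)\to(0,\infty)$ satisfy $$\lim_{s\to0^+}\kappa(s)=\infty,\qquad \lim_{s\to0^+}\kappa(s)^{\frac{p-1}p}\big(e^{K\kappa(s)}-1\big)^{\frac1p}s^2=0,$$ and, with the conventions $\kappa(0)=\infty$ and $\delta\cdot 0^{-1}=\infty$, let $$\tau_\varepsilon=\min\Big\{\delta\Big(\sigma^1_\varepsilon+\frac{\sigma^2_\varepsilon}\beta\|B^\top\nabla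 V\|_{L^\infty(\omega_\delta)}\Big)^{-1},\ \kappa\big(\|u_\varepsilon-u_V\|_{L^{2p}(\omega_\delta)}\big)\Big\}\in(0,\infty]$$ (for $\varepsilon$ small the argument of $\kappa$ lies in $[0,1)$). **Conclusion.** 1. There is $\varepsilon_0>0$ such that for all $\varepsilon\in(0,\varepsilon_0)$ and all finite $T\in(0,\tau_\varepsilon]$ (in particular $T=\tau_\varepsilon$ when finite) the triplet $(u_\varepsilon,\omega,T)$ stays in $\Omega$, and $\mathcal V_{u_\varepsilon,T}+V\circ y(T;\cdot,u_\varepsilon)-V\in L^p(\omega)$. 2. For every $\theta\in(0,1)$ there is $\varepsilon_1>0$ such that for all $\varepsilon\in(0,\varepsilon_1)$ and all finite $T\in(0,\theta\tau_\varepsilon]$ the triplet $(u_\varepsilon,\omega,T)$ stays in $\omega_\delta$. 3. $\lim_{\varepsilon\to0^+}\tau_\varepsilon=\infty$, and $$\lim_{\varepsilon\to0^+}\big\|\mathcal V_{u_\varepsilon,\tau_\varepsilon}+V\circ y(\tau_\varepsilon;\cdot,u_\varepsilon)-V\big\|_{L^p(\omega)}=0,$$ the last limit being taken along those $\varepsilon$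 for which $\tau_\varepsilon<\infty$. -/

import Mathlib

open Set Filter Topology MeasureTheory
open scoped ENNReal

noncomputable section

namespace FeedbackHJB

/-- Euclidean space `ℝⁿ`. -/
abbrev E (n : ℕ) : Type := EuclideanSpace ℝ (Fin n)

/-- Data of the infinite horizon problem: minimise `∫₀^∞ ℓ(y) + (β/2)|u|² dt` subject to
`y' = f(y) + B(y) u`, `y(0) = y₀`, together with the standing assumptions on the data. -/
structure ControlProblem (d m : ℕ) where
  f : E d → E d
  B : E d → (E m →L[ℝ] E d)
  ℓ : E d → ℝ
  β : ℝ
  f_lip : LocallyLipschitz f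
  B_lip : LocallyLipschitz B
  ℓ_lip : LocallyLipschitz ℓ
  f_zero : f 0 = 0
  ℓ_zero : ℓ 0 = 0
  ℓ_nonneg : ∀ y, 0 ≤ ℓ y
  β_pos : 0 < β

/-- `Bᵀ(y) p`. -/
def ControlProblem.Bt {d m : ℕ} (P : ControlProblem d m) (y p : E d) : E m :=
  ContinuousLinearMap.adjoint (P.B y) p

/-- `u ∈ L²((0,∞);ℝᵐ)` and `y` is a (global, absolutely continuous) solution of
`y' = f(y) + B(y) u`, `y(0) = y₀`. -/
structure IsControlledPair {d m : ℕ} (P : ControlProblem d m) (y₀ : E d)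
    (u : ℝ → E m) (y : ℝ → E d) : Prop where
  memLp : MemLp u 2 (volume.restrict (Ioi (0 : ℝ)))
  cont : ContinuousOn y (Ici (0 : ℝ))
  eq : ∀ t : ℝ, 0 ≤ t → y t = y₀ + ∫ s in (0 : ℝ)..t, (P.f (y s) + P.B (y s) (u s))

/-- The cost `J`, with values in `[0,∞]`. -/
def ControlProblem.cost {d m : ℕ} (P : ControlProblem d m) (u : ℝ → E m) (y : ℝ → E d) : ℝ≥0∞ :=
  ∫⁻ t in Ioi (0 : ℝ), ENNReal.ofReal (P.ℓ (y t) + P.β / 2 * ‖u t‖ ^ 2)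

/-- The value function with values in `[0,∞]`. -/
def ControlProblem.eValue {d m : ℕ} (P : ControlProblem d m) (y₀ : E d) : ℝ≥0∞ :=
  ⨅ (u : ℝ → E m) (y : ℝ → E d) (_ : IsControlledPair P y₀ u y), P.cost u y

/-- The value function `V` as a real function (used where it is finite everywhere). -/
def ControlProblem.V {d m : ℕ} (P : ControlProblem d m) (y₀ : E d) : ℝ :=
  (P.eValue y₀).toReal

/-- The feedback law `u_v(y) = -β⁻¹ Bᵀ(y) ∇v(y)`. -/
def ControlProblem.feedback {d m : ℕ} (P : ControlProblem d m) (v : E d → ℝ) (y : E d) : E m :=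
  -(P.β⁻¹ • P.Bt y (gradient v y))

/-- `y` solves the closed loop equation `y' = f(y) + B(y) u(y)`, `y(0) = y₀` on `[0,T]` and
`y([0,T]) ⊆ Ω`. -/
structure IsClosedLoop {d m : ℕ} (P : ControlProblem d m) (Ω : Set (E d)) (u : E d → E m)
    (T : ℝ) (y₀ : E d) (y : ℝ → E d) : Prop where
  init : y 0 = y₀
  mem : ∀ t ∈ Icc (0 : ℝ) T, y t ∈ Ω
  deriv : ∀ t ∈ Icc (0 : ℝ) T,
    HasDerivWithinAt y (P.f (y t) + P.B (y t) (u (y t))) (Icc (0 : ℝ) T) t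

/-- The triplet `(u, ω, T)` is such that `u` is locally Lipschitz on `Ω`, `ω ⋐ Ω` is open,
`T > 0`, and for every `y₀ ∈ ω` the closed loop trajectory exists on `[0,T]` and stays in `Ω`. -/
structure StaysIn {d m : ℕ} (P : ControlProblem d m) (Ω : Set (E d)) (u : E d → E m)
    (ω : Set (E d)) (T : ℝ) : Prop where
  lip : LocallyLipschitzOn Ω u
  isOpen : IsOpen ω
  compact : IsCompact (closure ω)
  subset : closure ω ⊆ Ω
  pos : 0 < T
  exists_sol : ∀ y₀ ∈ ω, ∃ y : ℝ → E d, IsClosedLoop P Ω u T y₀ y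

open Classical in
/-- The closed loop trajectory `y(·; y₀, u)` on `[0,T]` in `Ω` (unique on `[0,T]` when `u` is
locally Lipschitz on `Ω`; the constant `y₀` if there is none). -/
def traj {d m : ℕ} (P : ControlProblem d m) (Ω : Set (E d)) (u : E d → E m)
    (T : ℝ) (y₀ : E d) : ℝ → E d :=
  if h : ∃ y : ℝ → E d, IsClosedLoop P Ω u T y₀ y then h.choose else fun _ => y₀

/-- The finite horizon cost `𝒱_{u,T}(y₀) = ∫₀ᵀ ℓ(y) + (β/2)|u(y)|² dt` of the feedback `u`. -/
def finiteCost {d m : ℕ} (P : ControlProblem d m) (Ω : Set (E d)) (u : E d → E m)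
    (T : ℝ) (y₀ : E d) : ℝ :=
  ∫ t in (0 : ℝ)..T,
    (P.ℓ (traj P Ω u T y₀ t) + P.β / 2 * ‖u (traj P Ω u T y₀ t)‖ ^ 2)

/-- `𝒱_{u,T}(y₀) + V(y(T; y₀, u)) - V(y₀)`. -/
def costGap {d m : ℕ} (P : ControlProblem d m) (Ω : Set (E d)) (u : E d → E m)
    (T : ℝ) (y₀ : E d) : ℝ :=
  finiteCost P Ω u T y₀ + P.V (traj P Ω u T y₀ T) - P.V y₀

/-- Smooth mollifiers, normalised to be supported in the unit ball. -/
structure IsMollifier {d : ℕ} (ρ : E d → ℝ) : Prop where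
  smooth : ContDiff ℝ ((⊤ : ℕ∞) : WithTop ℕ∞) ρ
  nonneg : ∀ x, 0 ≤ ρ x
  supp : tsupport ρ ⊆ Metric.closedBall 0 1
  integral_eq : ∫ x, ρ x = 1

/-- The mollification `ρ_ε ∗ v`, `ρ_ε(x) = ε⁻ᵈ ρ(x/ε)`. -/
def mollify {d : ℕ} (ρ : E d → ℝ) (ε : ℝ) (v : E d → ℝ) (x : E d) : ℝ :=
  ∫ y, (ε⁻¹) ^ d * ρ (ε⁻¹ • (x - y)) * v y

/-- `v` is continuous and `v - (C/2)|·|²` is concave on `Ω`. -/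
def SemiConcaveOn {d : ℕ} (Ω : Set (E d)) (C : ℝ) (v : E d → ℝ) : Prop :=
  ContinuousOn v Ω ∧ ConcaveOn ℝ Ω (fun x => v x - C / 2 * ‖x‖ ^ 2)

/-- `ω_δ = {y ∈ Ω : w(y) < sup_ω w + δ}`. -/
def omegaDelta {d : ℕ} (Ω ω : Set (E d)) (w : E d → ℝ) (δ : ℝ) : Set (E d) :=
  {y | y ∈ Ω ∧ w y < sSup (w '' ω) + δ}

/-- The Lyapunov hypothesis: `w ∈ C¹(Ω)`, `0 ≤ g ∈ C(Ω)`, `ω ⋐ ω_δ ⋐ Ω`, and `φ ∈ C(Ω)` is a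
viscosity supersolution of `-∇wᵀ(f + B u_φ) + g = 0` in `ω_δ`. -/
structure LyapunovHyp {d m : ℕ} (P : ControlProblem d m) (Ω ω : Set (E d)) (φ : E d → ℝ)
    (δ : ℝ) (w g : E d → ℝ) : Prop where
  δ_pos : 0 < δ
  φ_cont : ContinuousOn φ Ω
  w_C1 : ContDiffOn ℝ 1 w Ω
  g_cont : ContinuousOn g Ω
  g_nonneg : ∀ y ∈ Ω, 0 ≤ g y
  subset : closure ω ⊆ omegaDelta Ω ω w δ
  subset' : closure (omegaDelta Ω ω w δ) ⊆ Ω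
  supersol : ∀ y ∈ omegaDelta Ω ω w δ, ∀ h : E d → ℝ, ContDiffOn ℝ 1 h Ω →
    IsLocalMin (fun z => φ z - h z) y →
    inner ℝ (gradient w y) (P.f y + P.B y (P.feedback h y)) ≤ g y

/-- `σ¹_ε`. -/
def sigma1 {d m : ℕ} (P : ControlProblem d m) (w g : E d → ℝ) (S : Set (E d)) (ε : ℝ) : ℝ≥0∞ :=
  ⨆ x ∈ S, ⨆ y ∈ Metric.ball x ε, ENNReal.ofReal
    |g y - inner ℝ (gradient w y) (P.f y) + inner ℝ (gradient w x) (P.f x)|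

/-- `σ²_ε`. -/
def sigma2 {d m : ℕ} (P : ControlProblem d m) (w : E d → ℝ) (S : Set (E d)) (ε : ℝ) : ℝ≥0∞ :=
  ⨆ x ∈ S, ⨆ y ∈ Metric.ball x ε, ENNReal.ofReal
    ‖P.Bt x (gradient w x) - P.Bt y (gradient w y)‖

/-- The `(i,j)` entry of the matrix `B(x)`. -/
def ControlProblem.entry {d m : ℕ} (P : ControlProblem d m) (x : E d)
    (k : Fin d × Fin m) : ℝ :=
  P.B x (EuclideanSpace.single k.2 1) k.1

/-- `sup_{x ∈ S, k} |F_k(x)|` for a map `F` with finitely many real entries. -/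
def supNorm {d : ℕ} {ι : Type} (S : Set (E d)) (F : E d → ι → ℝ) : ℝ :=
  sSup {r | ∃ x ∈ S, ∃ k, r = |F x k|}

/-- The Lipschitz norm: largest entrywise Lipschitz constant plus largest entry. -/
def lipNorm {d : ℕ} {ι : Type} (S : Set (E d)) (F : E d → ι → ℝ) : ℝ :=
  sSup {r | ∃ x ∈ S, ∃ y ∈ S, ∃ k, r = |F x k - F y k| / ‖x - y‖} + supNorm S F

/-- The constant `K`. -/
def constK {d m : ℕ} (P : ControlProblem d m) (Ω S : Set (E d)) (C : ℝ) : ℝ :=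
  1 / P.β * (m * d * C * supNorm S P.entry ^ 2
      + m * d ^ 2 * lipNorm S P.entry ^ 2
        * (eLpNorm (gradient P.V) ∞ (volume.restrict S)).toReal)
    + d * lipNorm (closure Ω) (fun x i => P.f x i)

/-- `u_ε = u_{V_ε}` with `V_ε = ρ_ε ∗ V`. -/
def uEps {d m : ℕ} (P : ControlProblem d m) (ρ : E d → ℝ) (ε : ℝ) : E d → E m :=
  P.feedback (mollify ρ ε P.V)

/-- `‖u_ε - u_V‖_{L^q(S)}`. -/
def uErr {d m : ℕ} (P : ControlProblem d m) (ρ : E d → ℝ) (S : Set (E d)) (q ε : ℝ) : ℝ :=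
  (eLpNorm (fun y => uEps P ρ ε y - P.feedback P.V y) (ENNReal.ofReal q)
    (volume.restrict S)).toReal

open Classical in
/-- `κ` extended to `s = 0` by `κ(0) = lim_{s → 0+} κ(s) = ∞`. -/
def kappaExt (κ : ℝ → ℝ) (s : ℝ) : ℝ≥0∞ :=
  if s = 0 then ⊤ else ENNReal.ofReal (κ s)

/-- The horizon `τ_ε`, the minimum of `δ (σ¹_ε + β⁻¹ σ²_ε ‖Bᵀ∇V‖_{L^∞(ω_δ)})⁻¹` and
`κ(‖u_ε - u_V‖_{L^{2p}(ω_δ)})`, with values in `[0,∞]` and `δ / 0 = ∞`. -/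
def tauEps {d m : ℕ} (P : ControlProblem d m) (ρ : E d → ℝ) (w : E d → ℝ) (S : Set (E d))
    (δ p : ℝ) (κ : ℝ → ℝ) (ε : ℝ) : ℝ≥0∞ :=
  min (ENNReal.ofReal δ / (sigma1 P w 0 S ε + sigma2 P w S ε / ENNReal.ofReal P.β
        * eLpNorm (fun y => P.Bt y (gradient P.V y)) ∞ (volume.restrict S)))
    (kappaExt κ (uErr P ρ S (2 * p) ε))

end FeedbackHJB

end

open FeedbackHJB

/-! Cost estimate. At points where `P.V` is differentiable it satisfies the inequality ℓ + ∇V·f −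
|Bᵀ∇V|²/(2β) ≤ 0 (`ControlProblem.hamiltonian_nonpos`). Completing the square bounds ℓ + (β/2)|u|² +
(d/dt)V(y) by (β/2)|u − u_V|² along a closed loop trajectory of a feedback u. After integration the
cost gap is at most (β/2)∫|u_ε − u_V|² along the trajectory (`IsFlow.ae_flowGap_le`), and it is
nonnegative by dynamic programming (`IsFlow.flowGap_nonneg`).

To pass to the L^p norm over initial values, the flow must not concentrate. Semi-concavity survives
mollification as the one-sided bound D²V_ε ≤ C, so the closed loop field has divergence at least −K
(`Standing.neg_constK_le_trace`), and the image of Lebesgue measure under the flow at time t is at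
most e^{Kt} times Lebesgue measure (`volume_transport_le`). With Hölder in time, the p-th power of
the norm of the time integral is at most ((e^{KT} − 1)/K) T^{p−1} ‖u_ε − u_V‖_{2p}^{2p}. The growth
condition on κ says exactly that this vanishes for T ≤ κ(‖u_ε − u_V‖_{2p}).

Invariance. Write σ_ε for `sigmaSum`, so that Tσ_ε ≤ δ for T ≤ τ_ε. Averaging the viscosity
inequality over an ε-ball bounds the drift of w by σ_ε + c₀ε (`Standing.drift_le_of_ball_subset`),
and keeping these balls inside ω_δ costs a further Mε in the level of w. Both losses must be paid
although σ_ε alone may exhaust δ by time T. The remedy is to control w only on [0, T − η], which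
gains δη/T in the drift, and to cross the last interval with bounded velocity inside a neighbourhood
of ω_δ.

The balance is made in `Standing.eventually_exists_drift_bound`. If εT² is small, the gain beats
both losses. Otherwise 1/ε is at most of order T², while T ≤ κ(‖u_ε − u_V‖_{2p}) makes the feedback
error exponentially small in T. By Markov's inequality every ball of radius r = e^{−cT} in ω_δ then
contains a point where u_ε and u_V are r-close, and comparison with that point replaces c₀ε by a
multiple of r ε^{−(d+1)}, a polynomial times an exponential. The loss Mε is settled by a dichotomy.
Either σ_ε > Λε for all small ε, so ΛεT < δ; or σ_ε ≤ Λε for arbitrarily small ε, and then chaining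
makes the oscillation Λ-Lipschitz (`Standing.osc_le_of_frequently`) and the drift is exponentially
small. -/

open scoped NNReal

namespace FeedbackHJB

/-! ### Flows of bounded Lipschitz vector fields. -/

section Flow

variable {X : Type*} [NormedAddCommGroup X] [NormedSpace ℝ X]

/-- `y` is an integral curve of the vector field `F` on `[0,T]`. -/
def IsCurve (F : X → X) (T : ℝ) (y : ℝ → X) : Prop :=
  ∀ t ∈ Icc (0 : ℝ) T, HasDerivWithinAt y (F (y t)) (Icc (0 : ℝ) T) t

lemma IsCurve.continuousOn {F : X → X} {T : ℝ} {y : ℝ → X} (hy : IsCurve F T y) :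
    ContinuousOn y (Icc 0 T) := fun t ht => (hy t ht).continuousWithinAt

lemma IsCurve.mono {F : X → X} {T T' : ℝ} {y : ℝ → X} (hy : IsCurve F T y) (h : T' ≤ T) :
    IsCurve F T' y := fun t ht =>
  (hy t ⟨ht.1, ht.2.trans h⟩).mono (Icc_subset_Icc_right h)

lemma IsCurve.hasDerivWithinAt_Ici {F : X → X} {T : ℝ} {y : ℝ → X} (hy : IsCurve F T y)
    {t : ℝ} (ht : t ∈ Ico (0 : ℝ) T) : HasDerivWithinAt y (F (y t)) (Ici t) t :=
  (hy t ⟨ht.1, ht.2.le⟩).mono_of_mem_nhdsWithin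
    (mem_of_superset (Icc_mem_nhdsGE ht.2) (Icc_subset_Icc_left ht.1))

lemma IsCurve.dist_le {F : X → X} {K : ℝ≥0} (hF : LipschitzWith K F) {T : ℝ} {y z : ℝ → X}
    (hy : IsCurve F T y) (hz : IsCurve F T z) {t : ℝ} (ht : t ∈ Icc (0 : ℝ) T) :
    dist (y t) (z t) ≤ dist (y 0) (z 0) * Real.exp (K * t) := by
  simpa using dist_le_of_trajectories_ODE (v := fun _ => F) (fun _ => hF) hy.continuousOn
    (fun t ht => hy.hasDerivWithinAt_Ici ht) hz.continuousOn
    (fun t ht => hz.hasDerivWithinAt_Ici ht) le_rfl t ht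

lemma IsCurve.eqOn {F : X → X} {K : ℝ≥0} (hF : LipschitzWith K F) {T : ℝ} {y z : ℝ → X}
    (hy : IsCurve F T y) (hz : IsCurve F T z) (h0 : y 0 = z 0) : EqOn y z (Icc 0 T) := by
  intro t ht
  have := hy.dist_le hF hz ht
  rw [h0, dist_self, zero_mul] at this
  exact dist_le_zero.1 this

lemma IsCurve.norm_sub_le {F : X → X} {T M : ℝ} {y : ℝ → X} (hy : IsCurve F T y)
    {s t : ℝ} (hs : 0 ≤ s) (hst : s ≤ t) (ht : t ≤ T) (hM : ∀ r ∈ Ico s t, ‖F (y r)‖ ≤ M) :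
    ‖y t - y s‖ ≤ M * (t - s) :=
  norm_image_sub_le_of_norm_deriv_le_segment'
    (fun r hr => (hy r ⟨hs.trans hr.1, hr.2.trans ht⟩).mono (Icc_subset_Icc hs ht)) hM t
    ⟨hst, le_rfl⟩

/-- The flow on `[0,T]` of a bounded Lipschitz vector field. -/
lemma exists_flow [CompleteSpace X] {F : X → X} {K M : ℝ≥0} (hF : LipschitzWith K F)
    (hM : ∀ x, ‖F x‖ ≤ M) {T : ℝ} (hT : 0 ≤ T) :
    ∃ Φ : X → ℝ → X, Continuous (Function.uncurry Φ) ∧ ∀ x, Φ x 0 = x ∧ IsCurve F T (Φ x) := by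
  have ex : ∀ x : X, ∃ α : ℝ → X, α 0 = x ∧ IsCurve F T α := by
    intro x
    -- A field bounded by M cannot leave the ball of radius MT during [0,T], so a single application
    -- of Picard–Lindelöf covers the whole interval.
    have hpl : IsPicardLindelof (fun _ => F) (tmin := 0) (tmax := T) ⟨0, ⟨le_rfl, hT⟩⟩ x
        (M * T.toNNReal) 0 M K :=
      { lipschitzOnWith := fun _ _ => hF.lipschitzOnWith
        continuousOn := fun _ _ => continuousOn_const
        norm_le := fun _ _ x _ => hM x
        mul_max_le := by simp [hT] }
    exact hpl.exists_eq_forall_mem_Icc_hasDerivWithinAt₀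
  choose α hα0 hα using ex
  -- The solutions are frozen outside [0,T], so that joint continuity in (x,t) holds for every real
  -- t.
  have hα' : ∀ x, IsCurve F T (IccExtend hT ((Icc 0 T).domRestrict (α x))) := by
    intro x t ht
    have heq : ∀ s ∈ Icc 0 T, IccExtend hT ((Icc 0 T).domRestrict (α x)) s = α x s := fun s hs => by
      rw [IccExtend_of_mem _ _ hs]; rfl
    rw [heq t ht]
    exact (hα x t ht).congr_of_mem heq ht
  refine ⟨fun x => IccExtend hT ((Icc 0 T).domRestrict (α x)), ?_, fun x => ⟨?_, hα' x⟩⟩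
  · rw [continuous_iff_continuousAt]
    rintro ⟨x, t⟩
    rw [ContinuousAt, tendsto_iff_dist_tendsto_zero]
    have key : ∀ z : X × ℝ, dist (α z.1 (projIcc 0 T hT z.2)) (α x (projIcc 0 T hT t)) ≤
        dist z.1 x * Real.exp (K * T)
          + M * |(projIcc 0 T hT z.2 : ℝ) - projIcc 0 T hT t| := by
      rintro ⟨z, s⟩
      refine (dist_triangle _ (α x (projIcc 0 T hT s)) _).trans (add_le_add ?_ ?_)
      · have h1 := (hα z).dist_le hF (hα x) (projIcc 0 T hT s).2
        rw [hα0, hα0] at h1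
        refine h1.trans ?_
        gcongr
        exact (projIcc 0 T hT s).2.2
      · rcases le_total (projIcc 0 T hT s : ℝ) (projIcc 0 T hT t) with h | h
        · rw [dist_comm, dist_eq_norm, abs_sub_comm, abs_of_nonneg (sub_nonneg.2 h)]
          exact (hα x).norm_sub_le (projIcc 0 T hT s).2.1 h (projIcc 0 T hT t).2.2 fun r _ => hM _
        · rw [dist_eq_norm, abs_of_nonneg (sub_nonneg.2 h)]
          exact (hα x).norm_sub_le (projIcc 0 T hT t).2.1 h (projIcc 0 T hT s).2.2 fun r _ => hM _
    refine squeeze_zero (fun _ => dist_nonneg) key ?_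
    have hc : Continuous fun z : X × ℝ => dist z.1 x * Real.exp (K * T)
          + M * |(projIcc 0 T hT z.2 : ℝ) - projIcc 0 T hT t| := by
      have : Continuous fun z : X × ℝ => (projIcc 0 T hT z.2 : ℝ) :=
        continuous_subtype_val.comp (continuous_projIcc.comp continuous_snd)
      fun_prop
    exact (hc.tendsto' (x, t) 0 (by simp))
  · exact (IccExtend_of_mem hT _ ⟨le_rfl, hT⟩).trans (hα0 x)

end Flow

/-- A curve which starts in an open set and cannot leave it for the first time, stays in it. -/
lemma forall_mem_of_first_exit {X : Type*} [TopologicalSpace X] {y : ℝ → X} {T : ℝ}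
    (hy : ContinuousOn y (Icc 0 T)) {O : Set X} (hO : IsOpen O) 
    (hstep : ∀ s ∈ Icc (0 : ℝ) T, (∀ t ∈ Ico 0 s, y t ∈ O) → y s ∈ O) :
    ∀ t ∈ Icc (0 : ℝ) T, y t ∈ O := by
  by_contra! hcon
  obtain ⟨t, ht, hyt⟩ := hcon
  set A : Set ℝ := Icc 0 T ∩ y ⁻¹' Oᶜ with hA
  have hAc : IsClosed A := hy.preimage_isClosed_of_isClosed isClosed_Icc hO.isClosed_compl
  have hAne : A.Nonempty := ⟨t, ht, hyt⟩
  have hAb : BddBelow A := ⟨0, fun s hs => hs.1.1⟩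
  -- The exit times form a closed set, so the first one is attained; `hstep` excludes it.
  have hmem := hAc.csInf_mem hAne hAb
  refine hmem.2 (hstep _ hmem.1 fun s hs => ?_)
  by_contra hn
  exact absurd (csInf_le hAb (show s ∈ A from ⟨⟨hs.1, hs.2.le.trans hmem.1.2⟩, hn⟩))
    (not_le.2 hs.2)

/-! ### Liouville's volume estimate for Lipschitz fields, through Euler's scheme. -/

section Transport

variable {d : ℕ}

/-- The determinant is polynomial in the matrix entries, and its derivative at the identity is the
trace; the error term is the definition of differentiability. -/
lemma exists_det_one_add_ge (n : ℕ) {e : ℝ} (he : 0 < e) : ∃ r > 0, ∀ A : E n →L[ℝ] E n,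
    ‖A‖ < r → 1 + LinearMap.trace ℝ (E n) A - e * ‖A‖ ≤ (1 + A).det := by
  classical
  let b : Module.Basis (Fin n) ℝ (E n) := (EuclideanSpace.basisFun (Fin n) ℝ).toBasis
  let Mx : (E n →L[ℝ] E n) →ₗ[ℝ] Matrix (Fin n) (Fin n) ℝ :=
    (LinearMap.toMatrix b b).toLinearMap ∘ₗ ContinuousLinearMap.coeLM ℝ
  have hdet : ∀ A : E n →L[ℝ] E n, (1 + A).det = (1 + Mx A).det := by
    intro A
    change LinearMap.det (↑(1 + A) : E n →ₗ[ℝ] E n) = _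
    rw [← LinearMap.det_toMatrix b]
    congr 1
    have : (↑(1 + A) : E n →ₗ[ℝ] E n) = LinearMap.id + (A : E n →ₗ[ℝ] E n) := rfl
    rw [this, map_add, LinearMap.toMatrix_id]
    rfl
  have hcont : ∀ i j, ContDiff ℝ 1 fun A : E n →L[ℝ] E n => Mx A i j := by
    intro i j
    let l : (E n →L[ℝ] E n) →ₗ[ℝ] ℝ := (Matrix.entryLinearMap ℝ ℝ i j) ∘ₗ Mx
    exact (LinearMap.toContinuousLinearMap l).contDiff
  set φ : (E n →L[ℝ] E n) → ℝ := fun A => (1 + A).det with hφ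
  have hφ1 : ContDiff ℝ 1 φ := by
    have : φ = fun A => (1 + Mx A).det := funext hdet
    rw [this]
    simp only [Matrix.det_apply, Matrix.add_apply]
    refine ContDiff.sum fun σ _ => ContDiff.const_smul _ (contDiff_prod fun i _ => ?_)
    exact contDiff_const.add (hcont _ _)
  have hφd : DifferentiableAt ℝ φ 0 := (hφ1.differentiable one_ne_zero) 0
  have hfd : ∀ A, fderiv ℝ φ 0 A = LinearMap.trace ℝ (E n) A := by
    intro A
    have h1 : HasDerivAt (fun t : ℝ => φ (t • A)) (fderiv ℝ φ 0 A) 0 := by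
      have h0 : HasFDerivAt φ (fderiv ℝ φ 0) ((fun t : ℝ => t • A) 0) := by
        have hz : (fun t : ℝ => t • A) 0 = 0 := zero_smul ℝ A
        rw [hz]; exact hφd.hasFDerivAt
      have h2 : HasDerivAt (fun t : ℝ => t • A) A 0 := by
        simpa using (hasDerivAt_id (0 : ℝ)).smul_const A
      exact h0.comp_hasDerivAt _ h2
    have h2 : HasDerivAt (fun t : ℝ => φ (t • A)) (LinearMap.trace ℝ (E n) A) 0 := by
      -- The expansion det(1 + tA) = 1 + t tr A + t² q(t) with a polynomial q identifies the
      -- directional derivative.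
      have e1 : (fun t : ℝ => φ (t • A)) = fun t => 1 + (Mx A).trace * t +
          (Matrix.det (1 + (Polynomial.X : Polynomial ℝ) •
            (Mx A).map Polynomial.C)).divX.divX.eval t * t ^ 2 := by
        funext t
        rw [← Matrix.det_one_add_smul, hφ]
        simp only [hdet, map_smul]
      rw [e1]
      have e2 : LinearMap.trace ℝ (E n) A = (Mx A).trace := LinearMap.trace_eq_matrix_trace ℝ b _
      rw [e2]
      have h3 := (((hasDerivAt_id (0 : ℝ)).const_mul (Mx A).trace).const_add 1).fun_add
        ((Polynomial.hasDerivAt (Matrix.det (1 + (Polynomial.X : Polynomial ℝ) •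
            (Mx A).map Polynomial.C)).divX.divX (0 : ℝ)).fun_mul (hasDerivAt_pow 2 (0 : ℝ)))
      simpa using h3
    exact h1.unique h2
  have hlo := hφd.hasFDerivAt.isLittleO
  rw [Asymptotics.isLittleO_iff] at hlo
  obtain ⟨r, hr, hball⟩ := Metric.eventually_nhds_iff.1 (hlo he)
  refine ⟨r, hr, fun A hA => ?_⟩
  have h := hball (y := A) (by simpa using hA)
  rw [sub_zero, hfd, Real.norm_eq_abs] at h
  have h0 : φ 0 = 1 := by simp [hφ, ContinuousLinearMap.det]
  have := (abs_le.1 h).1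
  rw [h0] at this
  change _ ≤ φ A
  linarith

/-- One explicit Euler step does not contract volumes faster than the divergence allows. -/
lemma exists_volume_euler_step_le {F : E d → E d} {L : ℝ≥0} (hF : LipschitzWith L F)
    {U : Set (E d)} (hU : IsOpen U) {K : ℝ}
    (hK : ∀ᵐ x : E d, x ∈ U → -K ≤ LinearMap.trace ℝ (E d) (fderiv ℝ F x)) {e : ℝ} (he : 0 < e) :
    ∃ h₀ > 0, ∀ h ∈ Ioo 0 h₀, ∀ A : Set (E d), IsOpen A →
      volume (U ∩ (fun x => x + h • F x) ⁻¹' A) ≤ ENNReal.ofReal (Real.exp ((K + e) * h)) * volume A := by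
  -- The rate loss e is split in two: one half pays for the remainder of the determinant, where ‖DF‖
  -- ≤ L, the other for the second order remainder of the exponential.
  obtain ⟨r, hr, hdet⟩ := exists_det_one_add_ge d (e := e / (2 * (L + 1))) (by positivity)
  have hev : ∀ᶠ h : ℝ in 𝓝 0, h * L < r ∧ h * L < 1 ∧ |(K + e) * h| ≤ 1 ∧
      (K + e) ^ 2 * h ≤ e / 2 := by
    have c1 : Tendsto (fun h : ℝ => h * L) (𝓝 0) (𝓝 0) :=
      Continuous.tendsto' (by fun_prop) _ _ (by simp)
    have c2 : Tendsto (fun h : ℝ => |(K + e) * h|) (𝓝 0) (𝓝 0) :=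
      Continuous.tendsto' (by fun_prop) _ _ (by simp)
    have c3 : Tendsto (fun h : ℝ => (K + e) ^ 2 * h) (𝓝 0) (𝓝 0) :=
      Continuous.tendsto' (by fun_prop) _ _ (by simp)
    filter_upwards [c1.eventually_lt_const hr, c1.eventually_lt_const one_pos,
      c2.eventually_lt_const one_pos, c3.eventually_lt_const (half_pos he)] with h a1 a2 a3 a4
    exact ⟨a1, a2, a3.le, a4.le⟩
  obtain ⟨h₀, hh₀, hball⟩ := Metric.eventually_nhds_iff.1 hev
  refine ⟨h₀, hh₀, fun h hh A hA => ?_⟩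
  obtain ⟨a1, a2, a3, a4⟩ := hball (y := h) (by simpa [abs_of_pos hh.1] using hh.2)
  set G : E d → E d := fun x => x + h • F x with hG
  have hGc : Continuous G := by have := hF.continuous; fun_prop
  -- For hL < 1 the Euler map is a perturbation of the identity by a contraction.
  have hinj : Function.Injective G := by
    intro x y hxy
    by_contra hne
    have h1 : x - y = h • (F y - F x) := by
      have : x + h • F x = y + h • F y := hxy
      rw [smul_sub, sub_eq_sub_iff_add_eq_add, this, add_comm]
    have h2 : ‖x - y‖ ≤ h * (L * ‖x - y‖) := by
      conv_lhs => rw [h1, norm_smul, Real.norm_of_nonneg hh.1.le]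
      have := hF.norm_sub_le y x
      rw [norm_sub_rev y x] at this
      exact mul_le_mul_of_nonneg_left this hh.1.le
    have h3 : 0 < ‖x - y‖ := norm_pos_iff.2 (sub_ne_zero.2 hne)
    nlinarith
  set W := U ∩ G ⁻¹' A with hW
  have hWo : IsOpen W := hU.inter (hA.preimage hGc)
  set D := {x | DifferentiableAt ℝ F x} with hD
  have hDm : MeasurableSet D := measurableSet_of_differentiableAt ℝ F
  have hDae : ∀ᵐ x : E d, x ∈ D := hF.ae_differentiableAt
  have hlow : ∀ᵐ x : E d, x ∈ W ∩ D → ENNReal.ofReal (Real.exp (-((K + e) * h))) ≤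
      ENNReal.ofReal |(1 + h • fderiv ℝ F x).det| := by
    filter_upwards [hK] with x hx hxW
    apply ENNReal.ofReal_le_ofReal
    refine le_trans ?_ (le_abs_self _)
    have hn : ‖fderiv ℝ F x‖ ≤ L := norm_fderiv_le_of_lipschitz ℝ hF
    have hn' : ‖h • fderiv ℝ F x‖ ≤ h * L := by
      rw [norm_smul, Real.norm_of_nonneg hh.1.le]
      exact mul_le_mul_of_nonneg_left hn hh.1.le
    refine le_trans ?_ (hdet _ (hn'.trans_lt a1))
    have htr : LinearMap.trace ℝ (E d) (h • fderiv ℝ F x : E d →L[ℝ] E d) =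
        h * LinearMap.trace ℝ (E d) (fderiv ℝ F x) := by
      rw [ContinuousLinearMap.toLinearMap_smul, map_smul, smul_eq_mul]
    rw [htr]
    have h1 : h * (-K) ≤ h * LinearMap.trace ℝ (E d) (fderiv ℝ F x) :=
      mul_le_mul_of_nonneg_left (hx hxW.1.1) hh.1.le
    have h2 : e / (2 * (L + 1)) * ‖h • fderiv ℝ F x‖ ≤ e / 2 * h := by
      calc _ ≤ e / (2 * (L + 1)) * (h * L) := by gcongr
        _ = e / 2 * h * (L / (L + 1)) := by field_simp
        _ ≤ e / 2 * h * 1 := by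
          have := hh.1
          gcongr
          rw [div_le_one (by positivity)]; linarith
        _ = _ := mul_one _
    have h3 := (abs_le.1 (Real.abs_exp_sub_one_sub_id_le (x := -((K + e) * h))
      (by rwa [abs_neg]))).2
    have h4 : (-((K + e) * h)) ^ 2 ≤ e / 2 * h := by
      calc (-((K + e) * h)) ^ 2 = (K + e) ^ 2 * h * h := by ring
        _ ≤ e / 2 * h := mul_le_mul_of_nonneg_right a4 hh.1.le
    linarith
  have hvol : ENNReal.ofReal (Real.exp (-((K + e) * h))) * volume W ≤ volume A := by
    -- By Rademacher the points of non-differentiability can be dropped before the change of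
    -- variables.
    have e1 : volume W = volume (W ∩ D) := by
      refine measure_congr (Filter.eventuallyEq_set.2 ?_)
      filter_upwards [hDae] with x hx
      exact ⟨fun h => ⟨h, hx⟩, fun h => h.1⟩
    have hmeas : MeasurableSet (W ∩ D) := hWo.measurableSet.inter hDm
    rw [e1, ← setLIntegral_const]
    calc _ ≤ ∫⁻ x in W ∩ D, ENNReal.ofReal |(1 + h • fderiv ℝ F x).det| :=
          setLIntegral_mono_ae' hmeas hlow
      _ = volume (G '' (W ∩ D)) := by
          refine lintegral_abs_det_fderiv_eq_addHaar_image volume hmeas (fun x hx => ?_) hinj.injOn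
          exact ((hasFDerivAt_id x).add (hx.2.hasFDerivAt.const_smul h)).hasFDerivWithinAt
      _ ≤ volume A := measure_mono (by rintro _ ⟨x, hx, rfl⟩; exact hx.1.2)
  calc volume W = ENNReal.ofReal (Real.exp ((K + e) * h)) *
        (ENNReal.ofReal (Real.exp (-((K + e) * h))) * volume W) := by
        rw [← mul_assoc, ← ENNReal.ofReal_mul (Real.exp_pos _).le, ← Real.exp_add]
        simp
    _ ≤ _ := by gcongr

/-- Peeling off the last step turns the target A into U ∩ G⁻¹(A), which is again open, so the
one-step bound iterates. -/
lemma volume_euler_iterate_le {G : E d → E d} (hG : Continuous G) {U : Set (E d)} (hU : IsOpen U)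
    {q : ℝ≥0∞} (hq : ∀ A : Set (E d), IsOpen A → volume (U ∩ G ⁻¹' A) ≤ q * volume A)
    (n : ℕ) : ∀ A : Set (E d), IsOpen A →
      volume {x | (∀ j < n, G^[j] x ∈ U) ∧ G^[n] x ∈ A} ≤ q ^ n * volume A := by
  induction n with
  | zero => intro A _; simp
  | succ n ih =>
    intro A hA
    calc _ ≤ volume {x | (∀ j < n, G^[j] x ∈ U) ∧ G^[n] x ∈ U ∩ G ⁻¹' A} := by
          refine measure_mono fun x hx => ⟨fun j hj => hx.1 j (by omega), hx.1 n (by omega), ?_⟩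
          have := hx.2
          rwa [Function.iterate_succ_apply'] at this
      _ ≤ q ^ n * volume (U ∩ G ⁻¹' A) := ih _ (hU.inter (hA.preimage hG))
      _ ≤ q ^ n * (q * volume A) := by gcongr; exact hq A hA
      _ = _ := by rw [pow_succ, mul_assoc]

/-- One step has consistency error LMh², and earlier errors are multiplied by 1 + Lh ≤ e^{Lh}. The
iteration gives first order convergence of Euler's scheme, with constants depending only on the
curve. -/
lemma IsCurve.norm_euler_sub_le {F : E d → E d} {L : ℝ≥0} (hF : LipschitzWith L F) {T M : ℝ}
    {y : ℝ → E d} (hy : IsCurve F T y) (hM : ∀ t ∈ Icc 0 T, ‖F (y t)‖ ≤ M) {h : ℝ} (hh : 0 ≤ h)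
    (n : ℕ) (hn : n * h ≤ T) :
    ‖(fun x => x + h • F x)^[n] (y 0) - y (n * h)‖ ≤ n * (L * M * h ^ 2) * Real.exp (L * h * n) := by
  induction n with
  | zero => simp
  | succ n ih =>
    have hn' : n * h ≤ T := by push_cast at hn; linarith
    have h0 : 0 ≤ n * h := by positivity
    specialize ih hn'
    rw [Function.iterate_succ_apply']
    set a := (fun x => x + h • F x)^[n] (y 0)
    set s := n * h with hs
    have hst : ((n + 1 : ℕ) : ℝ) * h = s + h := by push_cast; ring
    rw [hst] at hn ⊢
    have hM0 : 0 ≤ M := (norm_nonneg _).trans (hM s ⟨h0, hn'⟩)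
    have cons : ‖y (s + h) - y s - h • F (y s)‖ ≤ L * M * h ^ 2 := by
      have := norm_image_sub_le_of_norm_deriv_le_segment' (f := fun t => y t - t • F (y s))
        (f' := fun t => F (y t) - F (y s)) (a := s) (b := s + h) (C := L * (M * h)) (fun t ht => by
          have h1 := (hy t ⟨h0.trans ht.1, ht.2.trans hn⟩).mono (Icc_subset_Icc h0 hn)
          have h2 := ((hasDerivAt_id t).smul_const (F (y s))).hasDerivWithinAt (s := Icc s (s + h))
          simpa using h1.fun_sub h2) (fun t ht => by
          refine (hF.norm_sub_le _ _).trans ?_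
          gcongr
          refine (hy.norm_sub_le h0 ht.1 (ht.2.le.trans hn) fun r hr => hM r
            ⟨h0.trans hr.1, (hr.2.trans ht.2).le.trans hn⟩).trans ?_
          gcongr
          linarith [ht.2]) (s + h) ⟨by linarith, le_rfl⟩
      have e1 : y (s + h) - (s + h) • F (y s) - (y s - s • F (y s)) =
          y (s + h) - y s - h • F (y s) := by rw [add_smul]; abel
      simp only [e1] at this
      calc _ ≤ _ := this
        _ = _ := by ring
    have hdiff : a + h • F a - y (s + h) =
        (a - y s) + h • (F a - F (y s)) - (y (s + h) - y s - h • F (y s)) := by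
      rw [smul_sub]; abel
    have hexp : 1 + L * h ≤ Real.exp (L * h) := by linarith [Real.add_one_le_exp (L * h : ℝ)]
    calc ‖a + h • F a - y (s + h)‖
        ≤ ‖a - y s‖ + ‖h • (F a - F (y s))‖ + ‖y (s + h) - y s - h • F (y s)‖ := by
          rw [hdiff]
          exact (_root_.norm_sub_le _ _).trans (by gcongr; exact norm_add_le _ _)
      _ ≤ ‖a - y s‖ + h * (L * ‖a - y s‖) + L * M * h ^ 2 := by
          gcongr
          rw [norm_smul, Real.norm_of_nonneg hh]
          gcongr
          exact hF.norm_sub_le _ _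
      _ = (1 + L * h) * ‖a - y s‖ + L * M * h ^ 2 := by ring
      _ ≤ Real.exp (L * h) * (n * (L * M * h ^ 2) * Real.exp (L * h * n)) +
          L * M * h ^ 2 * Real.exp (L * h * (n + 1 : ℕ)) := by
          have h5 : L * M * h ^ 2 ≤ L * M * h ^ 2 * Real.exp (L * h * (n + 1 : ℕ)) :=
            le_mul_of_one_le_right (by positivity) (Real.one_le_exp (by positivity))
          have h6 := mul_le_mul hexp ih (norm_nonneg _) (Real.exp_pos _).le
          linarith
      _ = _ := by
          push_cast
          rw [show (L : ℝ) * h * (n + 1) = L * h + L * h * n by ring, Real.exp_add]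
          ring

/-- Liouville's estimate for a Lipschitz field with divergence bounded below by `-K` on `U`: the
set of points which the flow carries through `U` into `A` in time `T` has volume at most
`e^{KT} |A|`. -/
lemma volume_transport_le {F : E d → E d} {L : ℝ≥0} (hF : LipschitzWith L F) {U : Set (E d)}
    (hU : IsOpen U) {K : ℝ}
    (hK : ∀ᵐ x : E d, x ∈ U → -K ≤ LinearMap.trace ℝ (E d) (fderiv ℝ F x))
    {T : ℝ} (hT : 0 ≤ T) (Y : E d → ℝ → E d) {S : Set (E d)} (hY0 : ∀ x ∈ S, Y x 0 = x)
    (hY : ∀ x ∈ S, IsCurve F T (Y x)) (hYU : ∀ x ∈ S, ∀ t ∈ Icc 0 T, Y x t ∈ U)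
    (A : Set (E d)) :
    volume {x ∈ S | Y x T ∈ A} ≤ ENNReal.ofReal (Real.exp (K * T)) * volume A := by
  -- open targets, with a small loss in the rate
  have hopen : ∀ e > 0, ∀ A : Set (E d), IsOpen A →
      volume {x ∈ S | Y x T ∈ A} ≤ ENNReal.ofReal (Real.exp ((K + e) * T)) * volume A := by
    intro e he A hA
    obtain ⟨h₀, hh₀, hstep⟩ := exists_volume_euler_step_le hF hU hK he
    rcases hT.eq_or_lt with rfl | hTpos
    · simp only [mul_zero, Real.exp_zero, ENNReal.ofReal_one, one_mul]
      refine measure_mono fun x hx => ?_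
      have := hx.2
      rwa [hY0 x hx.1] at this
    set G : ℕ → E d → E d := fun n x => x + (T / n) • F x with hG
    set En : ℕ → Set (E d) := fun n => {x | (∀ j < n, (G n)^[j] x ∈ U) ∧ (G n)^[n] x ∈ A} with hEn
    obtain ⟨n₀, hn₀⟩ := exists_nat_gt (T / h₀)
    have hEvol : ∀ n > n₀, volume (En n) ≤
        ENNReal.ofReal (Real.exp ((K + e) * T)) * volume A := by
      intro n hn
      have hnpos : (0 : ℝ) < n := by exact_mod_cast (Nat.zero_le _).trans_lt hn
      have hh : T / n ∈ Ioo 0 h₀ := by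
        refine ⟨by positivity, ?_⟩
        rw [div_lt_comm₀ hnpos hh₀]
        exact hn₀.trans (by exact_mod_cast hn)
      have hGc : Continuous (G n) := by have := hF.continuous; fun_prop
      refine (volume_euler_iterate_le hGc hU (hstep _ hh) n A hA).trans_eq ?_
      rw [← ENNReal.ofReal_pow (Real.exp_pos _).le, ← Real.exp_nat_mul]
      rw [show (n : ℝ) * ((K + e) * (T / n)) = (K + e) * T by field_simp]
    -- No uniformity in x is needed: as U and A are open, the Euler orbit of each such x eventually
    -- stays in U and ends in A. The set thus lies in the lower limit of the `En`, whose measure is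
    -- controlled by continuity from below.
    have hsub : {x ∈ S | Y x T ∈ A} ⊆ ⋃ N, ⋂ n ∈ Ici N, En n := by
      rintro x ⟨hxS, hxA⟩
      have hc := (hY x hxS).continuousOn
      have hcomp : IsCompact (Y x '' Icc 0 T) := isCompact_Icc.image_of_continuousOn hc
      obtain ⟨M, hM⟩ : ∃ M, ∀ t ∈ Icc 0 T, ‖F (Y x t)‖ ≤ M := by
        obtain ⟨M, hM⟩ := (hcomp.image hF.continuous).isBounded.exists_norm_le
        exact ⟨M, fun t ht => hM _ ⟨_, ⟨t, ht, rfl⟩, rfl⟩⟩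
      obtain ⟨r, hr, hrU⟩ := hcomp.exists_thickening_subset_open hU
        (by rintro _ ⟨t, ht, rfl⟩; exact hYU x hxS t ht)
      obtain ⟨r', hr', hrA⟩ := Metric.isOpen_iff.1 hA _ hxA
      have hM0 : 0 ≤ M := (norm_nonneg _).trans (hM 0 ⟨le_rfl, hT⟩)
      have hlim : Tendsto (fun n : ℕ => L * M * T ^ 2 * Real.exp (L * T) / n) atTop (𝓝 0) :=
        tendsto_const_div_atTop_nhds_zero_nat _
      obtain ⟨N, hN⟩ := eventually_atTop.1
        ((hlim.eventually_lt_const (lt_min hr hr')).and (eventually_gt_atTop 0))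
      have hclose : ∀ n ≥ N, ∀ j ≤ n, dist ((G n)^[j] x) (Y x (j * (T / n))) < min r r' ∧
          (j : ℝ) * (T / n) ∈ Icc 0 T := by
        intro n hn j hj
        obtain ⟨hlt, hn0⟩ := hN n hn
        have hnpos : (0 : ℝ) < n := by exact_mod_cast hn0
        have hjn : (j : ℝ) ≤ n := by exact_mod_cast hj
        have hjT : (j : ℝ) * (T / n) ≤ T := by
          calc (j : ℝ) * (T / n) ≤ n * (T / n) := by gcongr
            _ = T := by field_simp
        refine ⟨?_, by positivity, hjT⟩
        have h1 := (hY x hxS).norm_euler_sub_le hF hM (h := T / n) (by positivity) j hjT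
        rw [hY0 x hxS] at h1
        rw [dist_eq_norm]
        refine h1.trans_lt (lt_of_le_of_lt ?_ hlt)
        have h3 : (L : ℝ) * (T / n) * j ≤ L * T := by
          rw [mul_assoc, mul_comm (T / n) (j : ℝ)]
          gcongr
        calc (j : ℝ) * (L * M * (T / n) ^ 2) * Real.exp (L * (T / n) * j)
            ≤ n * (L * M * (T / n) ^ 2) * Real.exp (L * T) := by gcongr
          _ = _ := by field_simp
      refine mem_iUnion.2 ⟨N, mem_iInter₂.2 fun n hn => ⟨fun j hj => hrU ?_, hrA ?_⟩⟩
      · obtain ⟨h1, h2⟩ := hclose n hn j hj.le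
        exact Metric.mem_thickening_iff.2 ⟨_, ⟨_, h2, rfl⟩, h1.trans_le (min_le_left _ _)⟩
      · obtain ⟨h1, -⟩ := hclose n hn n le_rfl
        have hnpos : (n : ℝ) ≠ 0 := by exact_mod_cast (hN n hn).2.ne'
        rw [show (n : ℝ) * (T / n) = T by field_simp] at h1
        exact Metric.mem_ball.2 (h1.trans_le (min_le_right _ _))
    refine (measure_mono hsub).trans ?_
    have hmono : Monotone fun N => ⋂ n ∈ Ici N, En n := fun a b hab =>
      biInter_subset_biInter_left (Ici_subset_Ici.2 hab)
    rw [hmono.measure_iUnion]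
    refine iSup_le fun N => ?_
    refine (measure_mono (biInter_subset_of_mem (mem_Ici.2 (le_max_left N (n₀ + 1))))).trans (hEvol _ (lt_of_lt_of_le (Nat.lt_succ_self _) (le_max_right _ _)))
  have hopen' : ∀ A : Set (E d), IsOpen A →
      volume {x ∈ S | Y x T ∈ A} ≤ ENNReal.ofReal (Real.exp (K * T)) * volume A := by
    intro A hA
    by_cases hAtop : volume A = ⊤
    · rw [hAtop, ENNReal.mul_top]
      · exact le_top
      · simpa using Real.exp_pos _
    have hlim : Tendsto (fun e : ℝ => ENNReal.ofReal (Real.exp ((K + e) * T)) * volume A) (𝓝[>] 0)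
        (𝓝 (ENNReal.ofReal (Real.exp (K * T)) * volume A)) := by
      refine ENNReal.Tendsto.mul_const ?_ (Or.inr hAtop)
      refine ENNReal.tendsto_ofReal ?_
      refine Tendsto.mono_left (Continuous.tendsto' (by fun_prop) _ _ (by simp)) nhdsWithin_le_nhds
    exact ge_of_tendsto hlim (by filter_upwards [self_mem_nhdsWithin] with e he using hopen e he A hA)
  -- Outer regularity passes from open targets to arbitrary ones, measurable or not.
  rw [Set.measure_eq_iInf_isOpen A]
  rw [ENNReal.mul_iInf_of_ne (by simpa using Real.exp_pos _) ENNReal.ofReal_ne_top]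
  refine le_iInf fun V => ?_
  by_cases hAV : A ⊆ V
  · by_cases hVo : IsOpen V
    · simp only [hAV, hVo, iInf_pos]
      exact (measure_mono (t := {x ∈ S | Y x T ∈ V}) fun x hx => ⟨hx.1, hAV hx.2⟩).trans
        (hopen' V hVo)
    · simp only [hAV, hVo, iInf_false, iInf_pos]
      rw [ENNReal.mul_top (by simpa using Real.exp_pos _)]; exact le_top
  · simp only [hAV, iInf_false]
    rw [ENNReal.mul_top (by simpa using Real.exp_pos _)]; exact le_top

end Transport

/-! ### Rademacher's theorem on open sets, and gradients. -/

section LocallyLipschitz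

/-- Rademacher's theorem applies on a small ball around each point, and a set that is locally null
is null. -/
lemma LocallyLipschitzOn.ae_differentiableAt {X Y : Type*} [NormedAddCommGroup X] [NormedSpace ℝ X]
    [FiniteDimensional ℝ X] [MeasurableSpace X] [BorelSpace X] (μ : Measure X)
    [μ.IsAddHaarMeasure] [NormedAddCommGroup Y] [NormedSpace ℝ Y] [FiniteDimensional ℝ Y]
    {U : Set X} (hU : IsOpen U) {g : X → Y} (hg : LocallyLipschitzOn U g) :
    ∀ᵐ x ∂μ, x ∈ U → DifferentiableAt ℝ g x := by
  rw [ae_iff]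
  refine measure_null_of_locally_null _ fun x hx => ?_
  have hxU : x ∈ U := by by_contra h; exact hx fun h' => absurd h' h
  obtain ⟨K, t, ht, hK⟩ := hg hxU
  rw [hU.nhdsWithin_eq hxU] at ht
  obtain ⟨r, hr, hrt⟩ := Metric.mem_nhds_iff.1 ht
  have h1 := (hK.mono hrt).ae_differentiableWithinAt_of_mem (μ := μ)
  refine ⟨_, inter_mem_nhdsWithin _ (Metric.ball_mem_nhds x hr), ?_⟩
  rw [ae_iff] at h1
  refine measure_mono_null (fun z hz => ?_) h1
  intro h2
  exact hz.1 fun _ => (h2 hz.2).differentiableAt (Metric.isOpen_ball.mem_nhds hz.2)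

end LocallyLipschitz

section Gradient

variable {d : ℕ}

lemma norm_gradient (v : E d → ℝ) (x : E d) : ‖gradient v x‖ = ‖fderiv ℝ v x‖ := by
  simp [gradient]

lemma inner_gradient (v : E d → ℝ) (x h : E d) : inner ℝ (gradient v x) h = fderiv ℝ v x h := by
  simp [gradient]

lemma measurable_gradient (v : E d → ℝ) : Measurable (gradient v) :=
  (LinearIsometryEquiv.continuous _).measurable.comp (measurable_fderiv ℝ v)

lemma norm_gradient_le {v : E d → ℝ} {U : Set (E d)} {x : E d} (hU : U ∈ 𝓝 x) {L : ℝ≥0}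
    (hv : LipschitzOnWith L v U) : ‖gradient v x‖ ≤ L := by
  rw [norm_gradient]
  exact norm_fderiv_le_of_lipschitzOn ℝ hU hv

end Gradient

/-! ### Semi-concave functions and their gradients. -/

section SemiConcave

variable {d : ℕ} {Ω : Set (E d)} {C : ℝ} {v : E d → ℝ}

/-- A concave function on an open set of a finite-dimensional space is locally Lipschitz; the smooth
quadratic is then added back. -/
lemma SemiConcaveOn.locallyLipschitzOn (h : SemiConcaveOn Ω C v) (hΩ : IsOpen Ω) :
    LocallyLipschitzOn Ω v := by
  have h1 := h.2.locallyLipschitzOn hΩ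
  have h2 : LocallyLipschitzOn Ω fun x : E d => C / 2 * ‖x‖ ^ 2 := by
    apply LocallyLipschitz.locallyLipschitzOn
    apply ContDiff.locallyLipschitz (𝕂 := ℝ)
    exact contDiff_const.mul (contDiff_norm_sq ℝ)
  intro x hx
  obtain ⟨K1, t1, ht1, hK1⟩ := h1 hx
  obtain ⟨K2, t2, ht2, hK2⟩ := h2 hx
  refine ⟨K1 + K2, t1 ∩ t2, inter_mem ht1 ht2, ?_⟩
  have := (hK1.mono inter_subset_left).add (hK2.mono inter_subset_right)
  simpa only [sub_add_cancel] using this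

/-- The concave function v − (C/2)|·|² lies below its tangent at z. Expanding the two squares around
z leaves exactly (C/2)|x − z|². -/
lemma SemiConcaveOn.le_tangent (h : SemiConcaveOn Ω C v) {z x : E d} (hz : z ∈ Ω) (hx : x ∈ Ω)
    (hd : DifferentiableAt ℝ v z) :
    v x ≤ v z + inner ℝ (gradient v z) (x - z) + C / 2 * ‖x - z‖ ^ 2 := by
  set g : E d → ℝ := fun x => v x - C / 2 * ‖x‖ ^ 2 with hg
  have hline : HasDerivAt (fun t : ℝ => z + t • (x - z)) (x - z) 0 := by
    simpa using ((hasDerivAt_id (0 : ℝ)).smul_const (x - z)).const_add z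
  have hz0 : (fun t : ℝ => z + t • (x - z)) 0 = z := by simp
  have hv' : HasDerivAt (fun t : ℝ => v (z + t • (x - z))) (fderiv ℝ v z (x - z)) 0 := by
    have : HasFDerivAt v (fderiv ℝ v z) ((fun t : ℝ => z + t • (x - z)) 0) := by
      rw [hz0]; exact hd.hasFDerivAt
    exact this.comp_hasDerivAt _ hline
  have hsq : HasDerivAt (fun t : ℝ => ‖z + t • (x - z)‖ ^ 2) (2 * inner ℝ z (x - z)) 0 := by
    have := hline.norm_sq
    simpa using this
  have hg' := hv'.fun_sub (hsq.const_mul (C / 2))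
  rw [hasDerivAt_iff_tendsto_slope] at hg'
  have hlim := hg'.mono_left (nhdsWithin_mono 0 (show Ioi (0 : ℝ) ⊆ {0}ᶜ from fun t ht => ne_of_gt ht))
  -- Difference quotients of a concave function on the segment from z to x decrease in t, so those
  -- near 0 dominate the one at t = 1.
  have hkey : ∀ᶠ t : ℝ in 𝓝[>] 0, g x - g z ≤
      slope (fun t : ℝ => v (z + t • (x - z)) - C / 2 * ‖z + t • (x - z)‖ ^ 2) 0 t := by
    filter_upwards [Ioo_mem_nhdsGT (zero_lt_one' ℝ)] with t ht
    have hc := h.2.2 hz hx (sub_nonneg.2 ht.2.le) ht.1.le (by ring)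
    have e1 : (1 - t) • z + t • x = z + t • (x - z) := by
      rw [sub_smul, smul_sub, one_smul]; abel
    rw [e1] at hc
    simp only [smul_eq_mul] at hc
    rw [slope_def_field, le_div_iff₀ (by linarith [ht.1])]
    simp only [hg, zero_smul, add_zero, sub_zero]
    nlinarith
  have hle := ge_of_tendsto hlim hkey
  rw [inner_gradient]
  have e2 : ‖x - z‖ ^ 2 = ‖x‖ ^ 2 - ‖z‖ ^ 2 - 2 * inner ℝ z (x - z) := by
    rw [norm_sub_sq_real, inner_sub_right, real_inner_self_eq_norm_sq, real_inner_comm]; ring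
  simp only [hg] at hle
  rw [e2]
  linarith

/-- Sum of the tangent inequalities at the two points. This is D²v ≤ C in a form that needs first
derivatives only and survives averaging. -/
lemma SemiConcaveOn.inner_gradient_sub_le (h : SemiConcaveOn Ω C v) {z x : E d} (hz : z ∈ Ω)
    (hx : x ∈ Ω) (hdz : DifferentiableAt ℝ v z) (hdx : DifferentiableAt ℝ v x) :
    inner ℝ (gradient v x - gradient v z) (x - z) ≤ C * ‖x - z‖ ^ 2 := by
  have h1 := h.le_tangent hz hx hdz
  have h2 := h.le_tangent hx hz hdx
  rw [← neg_sub x z, inner_neg_right, norm_neg] at h2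
  rw [inner_sub_left]
  linarith

lemma tendsto_of_tendsto_inner {α : Type*} {l : Filter α} {g : α → E d} {a : E d}
    (h : ∀ b, Tendsto (fun x => inner ℝ (g x) b) l (𝓝 (inner ℝ a b))) : Tendsto g l (𝓝 a) := by
  have h1 : Tendsto (fun x => ∑ i, (inner ℝ (g x) (EuclideanSpace.single i (1 : ℝ))) •
      (EuclideanSpace.single i (1 : ℝ) : E d)) l
      (𝓝 (∑ i, (inner ℝ a (EuclideanSpace.single i (1 : ℝ))) •
      (EuclideanSpace.single i (1 : ℝ) : E d))) :=
    tendsto_finsetSum _ fun i _ => (h _).smul_const _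
  have e : ∀ a : E d, ∑ i, (inner ℝ a (EuclideanSpace.single i (1 : ℝ))) •
      (EuclideanSpace.single i (1 : ℝ) : E d) = a := by
    intro a
    have := (EuclideanSpace.basisFun (Fin d) ℝ).sum_repr' a
    simpa [real_inner_comm] using this
  simpa only [e] using h1

/-- The gradient of a semi-concave function is continuous along the points of
differentiability. -/
lemma SemiConcaveOn.tendsto_gradient (h : SemiConcaveOn Ω C v) (hΩ : IsOpen Ω) {z : E d}
    (hz : z ∈ Ω) (hd : DifferentiableAt ℝ v z) :
    Tendsto (gradient v) (𝓝[{x | DifferentiableAt ℝ v x}] z) (𝓝 (gradient v z)) := by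
  -- A lower bound in every direction suffices, since b may be replaced by −b. It comes from the
  -- tangent inequality at x tested at x + tb: with t fixed, the difference quotient of v is
  -- continuous in x and the error is (C/2)t|b|².
  have hlow : ∀ b : E d, ∀ e > 0, ∀ᶠ x in 𝓝[{x | DifferentiableAt ℝ v x}] z,
      inner ℝ (gradient v z) b - e < inner ℝ (gradient v x) b := by
    intro b e he
    -- a step `t` along which the difference quotient is close to the derivative
    have hline : HasDerivAt (fun t : ℝ => v (z + t • b)) (fderiv ℝ v z b) 0 := by
      have h0 : HasDerivAt (fun t : ℝ => z + t • b) b 0 := by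
        simpa using ((hasDerivAt_id (0 : ℝ)).smul_const b).const_add z
      have : HasFDerivAt v (fderiv ℝ v z) ((fun t : ℝ => z + t • b) 0) := by
        simpa using hd.hasFDerivAt
      exact this.comp_hasDerivAt _ h0
    have hsl := ((hasDerivAt_iff_tendsto_slope.1 hline).mono_left (nhdsWithin_mono 0
      (show Ioi (0 : ℝ) ⊆ {0}ᶜ from fun t ht => ne_of_gt ht))).eventually_const_lt
      (show fderiv ℝ v z b - e / 3 < fderiv ℝ v z b by linarith)
    have hin : ∀ᶠ t : ℝ in 𝓝[>] 0, z + t • b ∈ Ω := by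
      have : Tendsto (fun t : ℝ => z + t • b) (𝓝[>] 0) (𝓝 z) :=
        (Continuous.tendsto' (by fun_prop) _ _ (by simp)).mono_left nhdsWithin_le_nhds
      exact this (hΩ.mem_nhds hz)
    have hsm : ∀ᶠ t : ℝ in 𝓝[>] 0, C / 2 * t * ‖b‖ ^ 2 < e / 3 := by
      have : Tendsto (fun t : ℝ => C / 2 * t * ‖b‖ ^ 2) (𝓝[>] 0) (𝓝 0) :=
        (Continuous.tendsto' (by fun_prop) _ _ (by simp)).mono_left nhdsWithin_le_nhds
      exact this.eventually_lt_const (by linarith)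
    obtain ⟨t, ⟨⟨ht1, ht2⟩, ht3⟩, ht0 : 0 < t⟩ := (((hsl.and hin).and hsm).and self_mem_nhdsWithin).exists
    rw [slope_def_field] at ht1
    simp only [zero_smul, add_zero, sub_zero] at ht1
    have hc : ContinuousAt v z := hd.continuousAt
    have hc1 : Tendsto (fun x => v (x + t • b)) (𝓝 z) (𝓝 (v (z + t • b))) := by
      have : ContinuousAt v (z + t • b) := (h.1.continuousAt (hΩ.mem_nhds ht2))
      exact this.tendsto.comp (Continuous.tendsto' (by fun_prop) _ _ rfl)
    have hq : Tendsto (fun x => (v (x + t • b) - v x) / t) (𝓝 z)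
        (𝓝 ((v (z + t • b) - v z) / t)) := (hc1.sub hc).div_const t
    have hq' := hq.eventually_const_lt (show fderiv ℝ v z b - e / 3 < _ from ht1)
    have hin' : ∀ᶠ x in 𝓝 z, x + t • b ∈ Ω :=
      (Continuous.tendsto' (f := fun x : E d => x + t • b) (by fun_prop) z _ rfl) (hΩ.mem_nhds ht2)
    filter_upwards [nhdsWithin_le_nhds hq', nhdsWithin_le_nhds hin',
      nhdsWithin_le_nhds (hΩ.mem_nhds hz), self_mem_nhdsWithin] with x h1 h2 h3 h4
    have h5 := h.le_tangent h3 h2 h4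
    rw [add_sub_cancel_left, inner_smul_right, norm_smul, Real.norm_of_nonneg ht0.le, mul_pow] at h5
    rw [inner_gradient]
    have h6 : (v (x + t • b) - v x) / t ≤ inner ℝ (gradient v x) b + C / 2 * t * ‖b‖ ^ 2 := by
      rw [div_le_iff₀ ht0]; nlinarith
    linarith
  refine tendsto_of_tendsto_inner fun b => ?_
  rw [Metric.tendsto_nhds]
  intro e he
  filter_upwards [hlow b e he, hlow (-b) e he] with x h1 h2
  rw [inner_neg_right, inner_neg_right] at h2
  rw [Real.dist_eq, abs_lt]
  constructor <;> linarith

end SemiConcave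

/-! ### Mollification as averaging. -/

section Mollify

variable {d : ℕ} {ρ : E d → ℝ}

/-- The set where ρ ≠ 0 is open, hence contained in the interior of the closed unit ball. The strict
inequality lets averages see only open balls, as in the definitions of `sigma1` and `sigma2`. -/
lemma IsMollifier.norm_lt_one (hρ : IsMollifier ρ) {ζ : E d} (h : ρ ζ ≠ 0) : ‖ζ‖ < 1 := by
  have h1 : Function.support ρ ⊆ interior (Metric.closedBall (0 : E d) 1) :=
    interior_maximal ((subset_tsupport ρ).trans hρ.supp)
      (hρ.smooth.continuous.isOpen_support)
  rw [interior_closedBall _ one_ne_zero] at h1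
  simpa using h1 h

lemma IsMollifier.hasCompactSupport (hρ : IsMollifier ρ) : HasCompactSupport ρ :=
  (isCompact_closedBall (0 : E d) 1).of_isClosed_subset (isClosed_tsupport ρ) hρ.supp

lemma IsMollifier.integrable (hρ : IsMollifier ρ) : Integrable ρ :=
  hρ.smooth.continuous.integrable_of_hasCompactSupport hρ.hasCompactSupport

lemma IsMollifier.sub_smul_mem_ball (hρ : IsMollifier ρ) {ζ : E d} (h : ρ ζ ≠ 0) (x : E d) {ε : ℝ}
    (hε : 0 < ε) : x - ε • ζ ∈ Metric.ball x ε := by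
  rw [mem_ball_iff_norm, sub_sub_cancel_left, norm_neg, norm_smul, Real.norm_of_nonneg hε.le]
  have := hρ.norm_lt_one h
  nlinarith

/-- The average `∫ ρ(ζ) g(x - εζ) dζ` of `g` around `x`. -/
noncomputable def mavg {F : Type*} [NormedAddCommGroup F] [NormedSpace ℝ F] (ρ : E d → ℝ) (ε : ℝ)
    (g : E d → F) (x : E d) : F := ∫ ζ, ρ ζ • g (x - ε • ζ)

lemma integral_comp_sub_smul {F : Type*} [NormedAddCommGroup F] [NormedSpace ℝ F] {ε : ℝ}
    (hε : 0 < ε) (x : E d) (k : E d → F) :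
    ∫ ζ, k (ε⁻¹ • (x - ζ)) = ε ^ d • ∫ ζ, k ζ := by
  rw [integral_sub_left_eq_self (fun z => k (ε⁻¹ • z)) volume x,
    Measure.integral_comp_smul]
  simp [abs_of_pos hε]

lemma mavg_eq_integral {F : Type*} [NormedAddCommGroup F] [NormedSpace ℝ F] {ε : ℝ} (hε : 0 < ε)
    (g : E d → F) (x : E d) :
    mavg ρ ε g x = ∫ z, ((ε⁻¹) ^ d * ρ (ε⁻¹ • (x - z))) • g z := by
  have h := integral_comp_sub_smul hε x fun ζ => ((ε⁻¹) ^ d * ρ ζ) • g (x - ε • ζ)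
  have e1 : ∀ z, x - ε • ε⁻¹ • (x - z) = z := fun z => by
    rw [smul_inv_smul₀ hε.ne', sub_sub_cancel]
  simp only [e1] at h
  rw [h, mavg, ← integral_smul]
  congr 1; funext ζ
  rw [smul_smul, ← mul_assoc, ← mul_pow, mul_inv_cancel₀ hε.ne', one_pow, one_mul]

lemma mollify_eq_mavg {ε : ℝ} (hε : 0 < ε) (v : E d → ℝ) (x : E d) :
    mollify ρ ε v x = mavg ρ ε v x := by
  rw [mavg_eq_integral hε]; rfl

/-- The map ζ ↦ x − εζ pulls null sets back to null sets and sends the points with ρ ≠ 0 into the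
open ε-ball; an almost everywhere property there can therefore be averaged. -/
lemma IsMollifier.ae_comp (hρ : IsMollifier ρ) {ε : ℝ} (hε : 0 < ε) {x : E d} {p : E d → Prop}
    (h : ∀ᵐ z : E d, z ∈ Metric.ball x ε → p z) : ∀ᵐ ζ, ρ ζ ≠ 0 → p (x - ε • ζ) := by
  have h1 : Measure.QuasiMeasurePreserving (fun ζ : E d => x - ε • ζ) volume volume := by
    refine (Measure.measurePreserving_sub_left volume x).quasiMeasurePreserving.comp
      ⟨by fun_prop, ?_⟩
    rw [Measure.map_addHaar_smul volume hε.ne']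
    exact Measure.smul_absolutelyContinuous
  filter_upwards [h1.ae h] with ζ hζ h0
  exact hζ (hρ.sub_smul_mem_ball h0 x hε)

variable {F : Type*} [NormedAddCommGroup F] [NormedSpace ℝ F] [MeasurableSpace F] [BorelSpace F]
  [SecondCountableTopology F]

lemma IsMollifier.integrable_smul (hρ : IsMollifier ρ) {ε : ℝ} (hε : 0 < ε) {x : E d}
    {g : E d → F} (hg : Measurable g) {M : ℝ}
    (h : ∀ᵐ z : E d, z ∈ Metric.ball x ε → ‖g z‖ ≤ M) :
    Integrable fun ζ => ρ ζ • g (x - ε • ζ) := by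
  refine (hρ.integrable.mul_const M).mono' ?_ ?_
  · exact (hρ.smooth.continuous.measurable.smul
      (hg.comp (by fun_prop : Measurable fun ζ : E d => x - ε • ζ))).aestronglyMeasurable
  · filter_upwards [hρ.ae_comp hε h] with ζ hζ
    rw [norm_smul, Real.norm_of_nonneg (hρ.nonneg ζ)]
    by_cases h0 : ρ ζ = 0
    · simp [h0]
    · exact mul_le_mul_of_nonneg_left (hζ h0) (hρ.nonneg ζ)

lemma IsMollifier.norm_mavg_sub_le [CompleteSpace F] (hρ : IsMollifier ρ) {ε : ℝ} (hε : 0 < ε)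
    {x : E d} {g : E d → F} (hg : Measurable g) {η : ℝ} {c : F}
    (h : ∀ᵐ z : E d, z ∈ Metric.ball x ε → ‖g z - c‖ ≤ η) :
    ‖mavg ρ ε g x - c‖ ≤ η := by
  have hb : ∀ᵐ z : E d, z ∈ Metric.ball x ε → ‖g z‖ ≤ η + ‖c‖ := by
    filter_upwards [h] with z hz hzb
    calc ‖g z‖ = ‖(g z - c) + c‖ := by rw [sub_add_cancel]
      _ ≤ _ := (norm_add_le _ _).trans (by gcongr; exact hz hzb)
  have hi := hρ.integrable_smul hε hg hb
  have hc : c = ∫ ζ, ρ ζ • c := by rw [integral_smul_const, hρ.integral_eq, one_smul]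
  have e : mavg ρ ε g x - c = ∫ ζ, ρ ζ • (g (x - ε • ζ) - c) := by
    conv_lhs => rw [hc]
    rw [mavg, ← integral_sub hi (hρ.integrable.smul_const c)]
    simp only [smul_sub]
  rw [e]
  have h2 : ‖∫ ζ, ρ ζ • (g (x - ε • ζ) - c)‖ ≤ ∫ ζ, ρ ζ * η := by
    refine norm_integral_le_of_norm_le (hρ.integrable.mul_const η) ?_
    filter_upwards [hρ.ae_comp hε h] with ζ hζ
    rw [norm_smul, Real.norm_of_nonneg (hρ.nonneg ζ)]
    by_cases h0 : ρ ζ = 0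
    · simp [h0]
    · exact mul_le_mul_of_nonneg_left (hζ h0) (hρ.nonneg ζ)
  rwa [integral_mul_const, hρ.integral_eq, one_mul] at h2

lemma IsMollifier.mavg_le (hρ : IsMollifier ρ) {ε : ℝ} (hε : 0 < ε) {x : E d} {g : E d → ℝ}
    (hg : Measurable g) {M c : ℝ} (hM : ∀ᵐ z : E d, z ∈ Metric.ball x ε → ‖g z‖ ≤ M)
    (h : ∀ᵐ z : E d, z ∈ Metric.ball x ε → g z ≤ c) : mavg ρ ε g x ≤ c := by
  have hi := hρ.integrable_smul hε hg hM
  have h2 : mavg ρ ε g x ≤ ∫ ζ, ρ ζ * c := by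
    refine integral_mono_ae hi (hρ.integrable.mul_const c) ?_
    filter_upwards [hρ.ae_comp hε h] with ζ hζ
    by_cases h0 : ρ ζ = 0
    · simp [h0]
    · exact mul_le_mul_of_nonneg_left (hζ h0) (hρ.nonneg ζ)
  rwa [integral_mul_const, hρ.integral_eq, one_mul] at h2

lemma mollify_contDiff (hρ : IsMollifier ρ) {ε : ℝ} (hε : 0 < ε) {v : E d → ℝ}
    (hv : Continuous v) : ContDiff ℝ ((⊤ : ℕ∞) : WithTop ℕ∞) (mollify ρ ε v) := by
  set k : E d → ℝ := fun t => (ε⁻¹) ^ d * ρ (ε⁻¹ • t) with hk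
  have e : mollify ρ ε v = convolution k v (ContinuousLinearMap.mul ℝ ℝ) volume := by
    funext x
    rw [convolution_eq_swap]
    rfl
  rw [e]
  refine HasCompactSupport.contDiff_convolution_left _ ?_ ?_ hv.locallyIntegrable
  · have : HasCompactSupport fun t : E d => ρ (ε⁻¹ • t) :=
      hρ.hasCompactSupport.comp_smul (inv_ne_zero hε.ne')
    exact this.mul_left
  · exact contDiff_const.mul (hρ.smooth.comp (contDiff_const_smul _))

/-- The gradient of the mollification is the average of the gradient. -/
lemma IsMollifier.gradient_mollify (hρ : IsMollifier ρ) {ε r : ℝ} (hε : 0 < ε) (hr : ε < r)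
    {v : E d → ℝ} (hv : Continuous v) {L : ℝ≥0} {x : E d}
    (hL : LipschitzOnWith L v (Metric.ball x r)) :
    gradient (mollify ρ ε v) x = mavg ρ ε (gradient v) x := by
  have hdiff : ∀ᵐ z : E d, z ∈ Metric.ball x ε → DifferentiableAt ℝ v z := by
    filter_upwards [LocallyLipschitzOn.ae_differentiableAt volume Metric.isOpen_ball
      (fun z hz => ⟨L, _, self_mem_nhdsWithin, hL⟩)] with z hz hzb
    exact hz (Metric.ball_subset_ball hr.le hzb)
  have hcont : ∀ x' : E d, Continuous fun ζ => ρ ζ * v (x' - ε • ζ) := fun x' =>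
    hρ.smooth.continuous.mul (hv.comp (by fun_prop))
  -- The base point moves in the ball of radius r − ε, so that all translates by εζ stay where v is
  -- Lipschitz.
  have key := hasFDerivAt_integral_of_dominated_loc_of_lip (μ := (volume : Measure (E d))) (𝕜 := ℝ)
    (F := fun x ζ => ρ ζ * v (x - ε • ζ)) (F' := fun ζ => ρ ζ • fderiv ℝ v (x - ε • ζ))
    (x₀ := x) (s := Metric.ball x (r - ε)) (bound := fun ζ => ρ ζ * L)
    (Metric.ball_mem_nhds x (by linarith))
    (Eventually.of_forall fun x' => (hcont x').aestronglyMeasurable)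
    ((hcont x).integrable_of_hasCompactSupport hρ.hasCompactSupport.mul_right)
    ((hρ.smooth.continuous.measurable.smul ((measurable_fderiv ℝ v).comp
      (by fun_prop : Measurable fun ζ : E d => x - ε • ζ))).aestronglyMeasurable)
    (Eventually.of_forall fun ζ => ?_) (hρ.integrable.mul_const _) ?_
  · have h1 : HasFDerivAt (mollify ρ ε v) (∫ ζ, ρ ζ • fderiv ℝ v (x - ε • ζ)) x := by
      have : mollify ρ ε v = fun x => ∫ ζ, ρ ζ * v (x - ε • ζ) :=
        funext fun x => mollify_eq_mavg hε v x
      rw [this]; exact key.2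
    rw [gradient, h1.fderiv, mavg]
    have h2 := ((InnerProductSpace.toDual ℝ (E d)).symm.toContinuousLinearEquiv.integral_comp_comm
      (μ := volume) fun ζ => ρ ζ • fderiv ℝ v (x - ε • ζ))
    refine h2.symm.trans (integral_congr_ae (Eventually.of_forall fun ζ => ?_))
    exact map_smul (InnerProductSpace.toDual ℝ (E d)).symm _ _
  · refine LipschitzOnWith.of_dist_le_mul fun a ha b hb => ?_
    have hb0 : 0 ≤ ρ ζ * (L : ℝ) := mul_nonneg (hρ.nonneg ζ) L.2
    rw [Real.coe_nnabs, abs_of_nonneg hb0, Real.dist_eq, ← mul_sub, abs_mul, abs_of_nonneg (hρ.nonneg ζ), mul_assoc]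
    by_cases h0 : ρ ζ = 0
    · simp [h0]
    have hin : ∀ a ∈ Metric.ball x (r - ε), a - ε • ζ ∈ Metric.ball x r := by
      intro a ha
      have h1 := hρ.sub_smul_mem_ball h0 a hε
      have := dist_triangle (a - ε • ζ) a x
      rw [Metric.mem_ball] at *
      linarith
    refine mul_le_mul_of_nonneg_left ?_ (hρ.nonneg ζ)
    have := hL.dist_le_mul _ (hin a ha) _ (hin b hb)
    rwa [Real.dist_eq, dist_sub_right] at this
  · filter_upwards [hρ.ae_comp hε hdiff] with ζ hζ
    by_cases h0 : ρ ζ = 0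
    · simpa [h0] using hasFDerivAt_const (0 : ℝ) x
    have h1 : HasFDerivAt (fun x : E d => v (x - ε • ζ)) (fderiv ℝ v (x - ε • ζ)) x := by
      have := (hζ h0).hasFDerivAt.comp x ((hasFDerivAt_id x).sub_const (ε • ζ))
      exact this
    exact h1.const_mul (ρ ζ)

end Mollify

/-! ### Mollified gradients of semi-concave functions. -/

section MollifySemiConcave

variable {d : ℕ} {ρ : E d → ℝ} {Ω : Set (E d)} {C : ℝ} {v : E d → ℝ}

/-- A compact ball in an open set can be enlarged slightly. The strict gap r > ε is the room needed
to differentiate under the integral. -/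
lemma exists_lipschitzOnWith_ball (hΩ : IsOpen Ω) (hsc : SemiConcaveOn Ω C v) {x : E d} {ε : ℝ}
    (hε : 0 < ε) (hx : Metric.closedBall x ε ⊆ Ω) :
    ∃ r > ε, ∃ L : ℝ≥0, LipschitzOnWith L v (Metric.ball x r) ∧ Metric.ball x r ⊆ Ω := by
  obtain ⟨δ, hδ, hsub⟩ := (isCompact_closedBall x ε).exists_cthickening_subset_open hΩ hx
  rw [cthickening_closedBall hδ.le hε.le] at hsub
  obtain ⟨L, hL⟩ := ((hsc.locallyLipschitzOn hΩ).mono hsub).exists_lipschitzOnWith_of_compact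
    (isCompact_closedBall x _)
  exact ⟨δ + ε, by linarith, L, hL.mono Metric.ball_subset_closedBall,
    Metric.ball_subset_closedBall.trans hsub⟩

lemma SemiConcaveOn.gradient_mollify (hρ : IsMollifier ρ) (hΩ : IsOpen Ω)
    (hsc : SemiConcaveOn Ω C v) (hv : Continuous v) {x : E d} {ε : ℝ} (hε : 0 < ε)
    (hx : Metric.closedBall x ε ⊆ Ω) :
    gradient (mollify ρ ε v) x = mavg ρ ε (gradient v) x := by
  obtain ⟨r, hr, L, hL, -⟩ := exists_lipschitzOnWith_ball hΩ hsc hε hx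
  exact hρ.gradient_mollify hε hr hv hL

lemma SemiConcaveOn.ae_differentiableAt (hΩ : IsOpen Ω) (hsc : SemiConcaveOn Ω C v) :
    ∀ᵐ x : E d, x ∈ Ω → DifferentiableAt ℝ v x :=
  LocallyLipschitzOn.ae_differentiableAt volume hΩ (hsc.locallyLipschitzOn hΩ)

lemma exists_norm_gradient_le_ball (hΩ : IsOpen Ω) (hsc : SemiConcaveOn Ω C v) {x : E d} {ε : ℝ}
    (hε : 0 < ε) (hx : Metric.closedBall x ε ⊆ Ω) :
    ∃ M, ∀ z ∈ Metric.ball x ε, ‖gradient v z‖ ≤ M := by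
  obtain ⟨r, hr, L, hL, -⟩ := exists_lipschitzOnWith_ball hΩ hsc hε hx
  exact ⟨L, fun z hz => norm_gradient_le (Metric.isOpen_ball.mem_nhds
    (Metric.ball_subset_ball hr.le hz)) hL⟩

lemma IsMollifier.inner_mavg (hρ : IsMollifier ρ) {ε : ℝ} (hε : 0 < ε) {x : E d}
    {g : E d → E d} (hg : Measurable g) {M : ℝ}
    (h : ∀ᵐ z : E d, z ∈ Metric.ball x ε → ‖g z‖ ≤ M) (a : E d) :
    inner ℝ (mavg ρ ε g x) a = mavg ρ ε (fun z => inner ℝ (g z) a) x := by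
  have hi := hρ.integrable_smul hε hg h
  rw [real_inner_comm, mavg, ← integral_inner hi, mavg]
  congr 1; funext ζ
  rw [inner_smul_right, real_inner_comm, smul_eq_mul]

/-- Mollification keeps the one-sided Lipschitz bound of the gradient. -/
lemma SemiConcaveOn.inner_gradient_mollify_sub_le (hρ : IsMollifier ρ) (hΩ : IsOpen Ω)
    (hsc : SemiConcaveOn Ω C v) (hv : Continuous v) {x x' : E d} {ε : ℝ} (hε : 0 < ε)
    (hx : Metric.closedBall x ε ⊆ Ω) (hx' : Metric.closedBall x' ε ⊆ Ω) :
    inner ℝ (gradient (mollify ρ ε v) x - gradient (mollify ρ ε v) x') (x - x') ≤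
      C * ‖x - x'‖ ^ 2 := by
  rw [hsc.gradient_mollify hρ hΩ hv hε hx, hsc.gradient_mollify hρ hΩ hv hε hx']
  obtain ⟨M, hM⟩ := exists_norm_gradient_le_ball hΩ hsc hε hx
  obtain ⟨M', hM'⟩ := exists_norm_gradient_le_ball hΩ hsc hε hx'
  have hball : ∀ z ∈ Metric.ball x ε, z + (x' - x) ∈ Metric.ball x' ε := by
    intro z hz
    rw [mem_ball_iff_norm] at hz ⊢
    rwa [show z + (x' - x) - x' = z - x by abel]
  have hgm := measurable_gradient v
  have hgm' : Measurable fun z => gradient v (z + (x' - x)) := hgm.comp (by fun_prop)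
  -- Written as averages over the same ball, the two gradients are compared at pairs z and z + (x' −
  -- x) with constant difference, so the one-sided inequality is integrated with fixed second factor
  -- x − x'.
  have hshift : mavg ρ ε (gradient v) x' = mavg ρ ε (fun z => gradient v (z + (x' - x))) x := by
    rw [mavg, mavg]
    congr 1; funext ζ
    congr 2; abel
  have e1 : mavg ρ ε (gradient v) x - mavg ρ ε (gradient v) x' =
      mavg ρ ε (fun z => gradient v z - gradient v (z + (x' - x))) x := by
    have i1 := hρ.integrable_smul hε hgm (Eventually.of_forall hM)
    have i2 := hρ.integrable_smul hε hgm' (Eventually.of_forall fun z hz => hM' _ (hball z hz))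
    rw [hshift]
    unfold mavg
    rw [← integral_sub i1 i2]
    simp only [smul_sub]
  have hb : ∀ z ∈ Metric.ball x ε, ‖gradient v z - gradient v (z + (x' - x))‖ ≤ M + M' :=
    fun z hz => (norm_sub_le _ _).trans (add_le_add (hM z hz) (hM' _ (hball z hz)))
  have hsm : Measurable fun z => gradient v z - gradient v (z + (x' - x)) := hgm.sub hgm'
  have him : Measurable fun z => inner ℝ (gradient v z - gradient v (z + (x' - x))) (x - x') :=
    hsm.inner measurable_const
  rw [e1, hρ.inner_mavg hε hsm (Eventually.of_forall hb)]
  refine hρ.mavg_le hε (M := (M + M') * ‖x - x'‖) him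
    (Eventually.of_forall fun z hz => (norm_inner_le_norm _ _).trans ?_) ?_
  · exact mul_le_mul_of_nonneg_right (hb z hz) (norm_nonneg _)
  · have hd := hsc.ae_differentiableAt hΩ
    have hd' : ∀ᵐ z : E d, z + (x' - x) ∈ Ω → DifferentiableAt ℝ v (z + (x' - x)) :=
      (measurePreserving_add_right volume (x' - x)).quasiMeasurePreserving.ae hd
    filter_upwards [hd, hd'] with z h1 h2 hz
    have hz1 := hx (Metric.ball_subset_closedBall hz)
    have hz2 := hx' (Metric.ball_subset_closedBall (hball z hz))
    have := hsc.inner_gradient_sub_le hz2 hz1 (h2 hz2) (h1 hz1)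
    rwa [show z - (z + (x' - x)) = x - x' by abel] at this

/-- The average of a bounded function is Lipschitz, with a constant of order `ε^{-(d+1)}`. -/
lemma IsMollifier.exists_norm_mavg_sub_mavg_le (hρ : IsMollifier ρ) {G : ℝ} (hG : 0 ≤ G) :
    ∃ c ≥ 0, ∀ ε ∈ Ioc (0 : ℝ) 1, ∀ g : E d → E d, Measurable g → ∀ x x' : E d,
      (∀ z ∈ Metric.ball x ε, ‖g z‖ ≤ G) → (∀ z ∈ Metric.ball x' ε, ‖g z‖ ≤ G) →
      ‖mavg ρ ε g x - mavg ρ ε g x'‖ ≤ c * (ε⁻¹) ^ (d + 1) * ‖x - x'‖ := by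
  obtain ⟨Lρ, hLρ⟩ := (hρ.smooth.of_le (by exact_mod_cast le_top)
    : ContDiff ℝ 1 ρ).lipschitzWith_of_hasCompactSupport hρ.hasCompactSupport one_ne_zero
  set m := (volume (Metric.ball (0 : E d) 1)).toReal
  -- The two kernels differ by at most ε^{−d} Lρ ε^{−1}|x − x'| and live on two balls whose volumes
  -- are crudely bounded by m, as ε ≤ 1. Any power of ε⁻¹ would do: it is later beaten by an
  -- exponential.
  refine ⟨2 * m * Lρ * G, by positivity, fun ε hε g hg x x' hx hx' => ?_⟩
  have hint : ∀ x : E d, (∀ z ∈ Metric.ball x ε, ‖g z‖ ≤ G) →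
      Integrable fun z => ((ε⁻¹) ^ d * ρ (ε⁻¹ • (x - z))) • g z := by
    intro x hx
    have h1 : Continuous fun z : E d => (ε⁻¹) ^ d * ρ (ε⁻¹ • (x - z)) := by
      have := hρ.smooth.continuous
      fun_prop
    have h2 : HasCompactSupport fun z : E d => (ε⁻¹) ^ d * ρ (ε⁻¹ • (x - z)) := by
      refine HasCompactSupport.intro (isCompact_closedBall x ε) fun z hz => ?_
      by_contra hne
      have h3 := hρ.norm_lt_one (right_ne_zero_of_mul hne)
      rw [norm_smul, Real.norm_of_nonneg (inv_nonneg.2 hε.1.le), inv_mul_lt_one₀ hε.1] at h3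
      exact hz (by rw [Metric.mem_closedBall, dist_comm, dist_eq_norm]; exact h3.le)
    refine ((h1.integrable_of_hasCompactSupport h2).norm.mul_const G).mono'
      (h1.measurable.smul hg).aestronglyMeasurable (Eventually.of_forall fun z => ?_)
    rw [norm_smul]
    by_cases h0 : (ε⁻¹) ^ d * ρ (ε⁻¹ • (x - z)) = 0
    · rw [h0]; simp
    · have h3 := hρ.norm_lt_one (right_ne_zero_of_mul h0)
      rw [norm_smul, Real.norm_of_nonneg (inv_nonneg.2 hε.1.le), inv_mul_lt_one₀ hε.1] at h3
      exact mul_le_mul_of_nonneg_left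
        (hx z (by rw [Metric.mem_ball, dist_comm, dist_eq_norm]; exact h3)) (norm_nonneg _)
  rw [mavg_eq_integral hε.1, mavg_eq_integral hε.1, ← integral_sub (hint x hx) (hint x' hx')]
  set B := Metric.ball x ε ∪ Metric.ball x' ε
  set c := (ε⁻¹) ^ d * (Lρ * (ε⁻¹ * ‖x - x'‖)) * G with hc
  have hB : volume B < ⊤ := measure_union_lt_top measure_ball_lt_top measure_ball_lt_top
  have hBm : MeasurableSet B := measurableSet_ball.union measurableSet_ball
  have hεi : 0 ≤ ε⁻¹ := inv_nonneg.2 hε.1.le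
  have hbound : ∀ z, ‖((ε⁻¹) ^ d * ρ (ε⁻¹ • (x - z))) • g z -
      ((ε⁻¹) ^ d * ρ (ε⁻¹ • (x' - z))) • g z‖ ≤ B.indicator (fun _ => c) z := by
    intro z
    rw [← sub_smul, ← mul_sub, norm_smul]
    by_cases hz : z ∈ B
    · rw [indicator_of_mem hz, hc]
      have h1 : ‖g z‖ ≤ G := hz.elim (hx z) (hx' z)
      have h2 : |ρ (ε⁻¹ • (x - z)) - ρ (ε⁻¹ • (x' - z))| ≤ Lρ * (ε⁻¹ * ‖x - x'‖) := by
        have h3 := hLρ.dist_le_mul (ε⁻¹ • (x - z)) (ε⁻¹ • (x' - z))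
        rw [dist_eq_norm (ε⁻¹ • (x - z)), ← smul_sub, norm_smul, Real.norm_of_nonneg hεi,
          sub_sub_sub_cancel_right, Real.dist_eq] at h3
        exact h3
      have h4 : 0 ≤ (ε⁻¹) ^ d := pow_nonneg hεi d
      rw [norm_mul, Real.norm_of_nonneg h4, Real.norm_eq_abs]
      exact mul_le_mul (mul_le_mul_of_nonneg_left h2 h4) h1 (norm_nonneg _) (by positivity)
    · have hzero : ∀ y : E d, z ∉ Metric.ball y ε → ρ (ε⁻¹ • (y - z)) = 0 := by
        intro y hy
        by_contra hne
        have h3 := hρ.norm_lt_one hne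
        rw [norm_smul, Real.norm_of_nonneg hεi, inv_mul_lt_one₀ hε.1] at h3
        exact hy (by rw [Metric.mem_ball, dist_comm, dist_eq_norm]; exact h3)
      rw [indicator_of_notMem hz, hzero x fun h => hz (Or.inl h), hzero x' fun h => hz (Or.inr h)]
      simp
  refine (norm_integral_le_of_norm_le ((integrable_indicator_iff hBm).2
    (integrableOn_const hB.ne)) (Eventually.of_forall hbound)).trans ?_
  rw [integral_indicator hBm, setIntegral_const, smul_eq_mul]
  have hvolball : ∀ y : E d, (volume (Metric.ball y ε)).toReal ≤ m := by
    intro y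
    have h1 : volume (Metric.ball y ε) ≤ volume (Metric.ball y 1) :=
      measure_mono (Metric.ball_subset_ball hε.2)
    rw [Measure.addHaar_ball_center volume y 1] at h1
    exact ENNReal.toReal_mono measure_ball_lt_top.ne h1
  have hvol : volume.real B ≤ 2 * m := by
    refine (measureReal_union_le _ _).trans ?_
    have h1 := hvolball x
    have h2 := hvolball x'
    simp only [Measure.real]
    linarith
  calc volume.real B * c ≤ 2 * m * c := by
        refine mul_le_mul_of_nonneg_right hvol ?_
        positivity
    _ = _ := by rw [hc, pow_succ]; ring

/-- The gradients of the mollifications converge at the points of differentiability. -/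
lemma SemiConcaveOn.tendsto_gradient_mollify (hρ : IsMollifier ρ) (hΩ : IsOpen Ω)
    (hsc : SemiConcaveOn Ω C v) (hv : Continuous v) {x : E d} (hx : x ∈ Ω)
    (hd : DifferentiableAt ℝ v x) :
    Tendsto (fun ε => gradient (mollify ρ ε v) x) (𝓝[>] 0) (𝓝 (gradient v x)) := by
  rw [Metric.tendsto_nhds]
  intro η hη
  have h1 := hsc.tendsto_gradient hΩ hx hd
  rw [Metric.tendsto_nhdsWithin_nhds] at h1
  obtain ⟨r, hr, h2⟩ := h1 (η / 2) (half_pos hη)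
  obtain ⟨r', hr', hball⟩ := Metric.isOpen_iff.1 hΩ x hx
  filter_upwards [Ioo_mem_nhdsGT (lt_min hr hr')] with ε hε
  have hsub : Metric.closedBall x ε ⊆ Ω :=
    (Metric.closedBall_subset_ball (hε.2.trans_le (min_le_right _ _))).trans hball
  rw [hsc.gradient_mollify hρ hΩ hv hε.1 hsub, dist_eq_norm]
  refine (hρ.norm_mavg_sub_le hε.1 (measurable_gradient v) (η := η / 2) ?_).trans_lt (by linarith)
  filter_upwards [hsc.ae_differentiableAt hΩ] with z hz hzb
  rw [← dist_eq_norm]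
  exact (h2 (hz (hsub (Metric.ball_subset_closedBall hzb)))
    (lt_of_lt_of_le (Metric.mem_ball.1 hzb) (hε.2.le.trans (min_le_left _ _)))).le

end MollifySemiConcave

/-! ### Dynamic programming and the Hamilton–Jacobi–Bellman inequality. -/

section DynamicProgramming

variable {d m : ℕ} {P : ControlProblem d m}

lemma ControlProblem.inner_Bt (P : ControlProblem d m) (x p : E d) (u : E m) :
    inner ℝ (P.Bt x p) u = inner ℝ p (P.B x u) :=
  ContinuousLinearMap.adjoint_inner_left _ _ _

lemma ControlProblem.norm_Bt_le (P : ControlProblem d m) (x p : E d) :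
    ‖P.Bt x p‖ ≤ ‖P.B x‖ * ‖p‖ := by
  refine (ContinuousLinearMap.le_opNorm _ _).trans_eq ?_
  rw [LinearIsometryEquiv.norm_map]

lemma ControlProblem.continuous_Bt (P : ControlProblem d m) :
    Continuous fun z : E d × E d => P.Bt z.1 z.2 := by
  have h1 : Continuous fun x : E d => ContinuousLinearMap.adjoint (P.B x) :=
    (LinearIsometryEquiv.continuous _).comp P.B_lip.continuous
  exact (h1.comp continuous_fst).clm_apply continuous_snd

lemma ControlProblem.aestronglyMeasurable_B {y : ℝ → E d} {u : ℝ → E m} {μ : Measure ℝ}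
    (P : ControlProblem d m) (hy : AEStronglyMeasurable y μ) (hu : AEStronglyMeasurable u μ) :
    AEStronglyMeasurable (fun s => P.B (y s) (u s)) μ :=
  isBoundedBilinearMap_apply.continuous.comp_aestronglyMeasurable
    ((P.B_lip.continuous.comp_aestronglyMeasurable hy).prodMk hu)

lemma ControlProblem.intervalIntegrable_field (P : ControlProblem d m) {y : ℝ → E d} {u : ℝ → E m}
    {a b : ℝ} (hab : a ≤ b) (hy : ContinuousOn y (Icc a b))
    (hu : MemLp u 2 (volume.restrict (Ioc a b))) :
    IntervalIntegrable (fun s => P.f (y s) + P.B (y s) (u s)) volume a b := by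
  have hy' : AEStronglyMeasurable y (volume.restrict (Ioc a b)) :=
    (hy.mono Ioc_subset_Icc_self).aestronglyMeasurable measurableSet_Ioc
  have h1 : IntervalIntegrable (fun s => P.f (y s)) volume a b := by
    refine ContinuousOn.intervalIntegrable ?_
    rw [uIcc_of_le hab]
    exact P.f_lip.continuous.comp_continuousOn hy
  refine h1.add ?_
  rw [intervalIntegrable_iff_integrableOn_Ioc_of_le hab]
  obtain ⟨M, hM⟩ := (isCompact_Icc.image_of_continuousOn
    (P.B_lip.continuous.comp_continuousOn hy)).isBounded.exists_norm_le
  refine ((hu.integrable (by norm_num)).norm.const_mul M).mono'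
    (P.aestronglyMeasurable_B hy' hu.1) ?_
  filter_upwards [ae_restrict_mem measurableSet_Ioc] with s hs
  refine (ContinuousLinearMap.le_opNorm _ _).trans ?_
  exact mul_le_mul_of_nonneg_right (hM _ ⟨s, Ioc_subset_Icc_self hs, rfl⟩) (norm_nonneg _)

lemma IsControlledPair.memLp_Ioc {x : E d} {u : ℝ → E m} {y : ℝ → E d}
    (h : IsControlledPair P x u y) {a b : ℝ} (ha : 0 ≤ a) :
    MemLp u 2 (volume.restrict (Ioc a b)) :=
  h.memLp.mono_measure (Measure.restrict_mono (fun _ hs => ha.trans_lt hs.1) le_rfl)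

lemma IsControlledPair.intervalIntegrable {x : E d} {u : ℝ → E m} {y : ℝ → E d}
    (h : IsControlledPair P x u y) {a b : ℝ} (ha : 0 ≤ a) (hab : a ≤ b) :
    IntervalIntegrable (fun s => P.f (y s) + P.B (y s) (u s)) volume a b :=
  P.intervalIntegrable_field hab (h.cont.mono fun _ hs => ha.trans hs.1) (h.memLp_Ioc ha)

lemma memLp_comp_add_Ioi {u : ℝ → E m} {a : ℝ} {c : ℝ} :
    MemLp (fun t => u (t + a)) 2 (volume.restrict (Ioi c)) ↔
      MemLp u 2 (volume.restrict (Ioi (c + a))) := by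
  have h := (measurePreserving_add_right (volume : Measure ℝ) a).restrict_preimage_emb
    (MeasurableEquiv.addRight a).measurableEmbedding (Ioi (c + a))
  have hpre : (fun x : ℝ => x + a) ⁻¹' Ioi (c + a) = Ioi c := by ext; simp
  rw [hpre] at h
  constructor
  · intro hu
    have e : u = (fun t => u (t + a)) ∘ fun t => t + -a := by funext t; simp
    have h' := (measurePreserving_add_right (volume : Measure ℝ) (-a)).restrict_preimage_emb
      (MeasurableEquiv.addRight (-a)).measurableEmbedding (Ioi c)
    have hpre' : (fun x : ℝ => x + -a) ⁻¹' Ioi c = Ioi (c + a) := by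
      ext; simp [← sub_eq_add_neg]
    rw [hpre'] at h'
    rw [e]
    exact hu.comp_measurePreserving h'
  · intro hu
    exact hu.comp_measurePreserving h

lemma lintegral_comp_add_Ioi (g : ℝ → ℝ≥0∞) (a c : ℝ) :
    ∫⁻ t in Ioi c, g (t + a) = ∫⁻ t in Ioi (c + a), g t := by
  have h := (measurePreserving_add_right (volume : Measure ℝ) a).setLIntegral_comp_preimage_emb
    (MeasurableEquiv.addRight a).measurableEmbedding g (Ioi (c + a))
  have hpre : (fun x : ℝ => x + a) ⁻¹' Ioi (c + a) = Ioi c := by ext; simp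
  rwa [hpre] at h

lemma IsControlledPair.tail {x : E d} {u : ℝ → E m} {y : ℝ → E d} (h : IsControlledPair P x u y)
    {a : ℝ} (ha : 0 ≤ a) : IsControlledPair P (y a) (fun t => u (t + a)) fun t => y (t + a) where
  memLp := memLp_comp_add_Ioi.2 (h.memLp.mono_measure
    (Measure.restrict_mono (Ioi_subset_Ioi (by linarith)) le_rfl))
  cont := h.cont.comp (by fun_prop) fun t ht => add_nonneg ht ha
  eq := by
    intro t ht
    rw [h.eq (t + a) (by linarith), h.eq a ha, add_assoc]
    congr 1
    have h1 := intervalIntegral.integral_comp_add_right (a := 0) (b := t)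
      (fun s => P.f (y s) + P.B (y s) (u s)) a
    rw [zero_add] at h1
    rw [h1, intervalIntegral.integral_add_adjacent_intervals]
    · exact h.intervalIntegrable le_rfl ha
    · exact h.intervalIntegrable ha (by linarith)

lemma ControlProblem.cost_eq_add (P : ControlProblem d m) (u : ℝ → E m) (y : ℝ → E d) {a : ℝ}
    (ha : 0 ≤ a) :
    P.cost u y = (∫⁻ t in Ioc 0 a, ENNReal.ofReal (P.ℓ (y t) + P.β / 2 * ‖u t‖ ^ 2)) +
      P.cost (fun t => u (t + a)) fun t => y (t + a) := by
  have h1 := lintegral_comp_add_Ioi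
    (fun t => ENNReal.ofReal (P.ℓ (y t) + P.β / 2 * ‖u t‖ ^ 2)) a 0
  simp only [zero_add] at h1
  rw [ControlProblem.cost, ControlProblem.cost, h1, ← lintegral_union measurableSet_Ioi,
    Ioc_union_Ioi_eq_Ioi ha]
  exact Set.disjoint_left.2 fun t h1 h2 => absurd h1.2 (not_le.2 h2)

lemma ControlProblem.eValue_le_cost (P : ControlProblem d m) {x : E d} {u : ℝ → E m}
    {y : ℝ → E d} (h : IsControlledPair P x u y) : P.eValue x ≤ P.cost u y :=
  iInf_le_of_le u (iInf_le_of_le y (iInf_le_of_le h le_rfl))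

/-- Continuous controls on `[0,T]` are suboptimal. -/
lemma ControlProblem.eValue_le_lintegral_add (P : ControlProblem d m) {T : ℝ} (hT : 0 ≤ T)
    {x : E d} {u₁ : ℝ → E m} {y₁ : ℝ → E d} (hu : ContinuousOn u₁ (Icc 0 T))
    (hy : ContinuousOn y₁ (Icc 0 T))
    (heq : ∀ t ∈ Icc 0 T, y₁ t = x + ∫ s in (0 : ℝ)..t, (P.f (y₁ s) + P.B (y₁ s) (u₁ s))) :
    P.eValue x ≤ (∫⁻ t in Ioc 0 T, ENNReal.ofReal (P.ℓ (y₁ t) + P.β / 2 * ‖u₁ t‖ ^ 2)) +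
      P.eValue (y₁ T) := by
  classical
  conv_rhs => rw [ControlProblem.eValue]
  rw [ENNReal.add_iInf]
  refine le_iInf fun u₂ => ?_
  rw [ENNReal.add_iInf]
  refine le_iInf fun y₂ => ?_
  rw [ENNReal.add_iInf]
  refine le_iInf fun h₂ => ?_
  -- The given control is followed up to T, then an arbitrary competitor for the state `y₁ T`; this
  -- concatenation is admissible for x.
  set u : ℝ → E m := fun t => if t ≤ T then u₁ t else u₂ (t - T) with hudef
  set y : ℝ → E d := fun t => if t ≤ T then y₁ t else y₂ (t - T) with hydef
  have hy20 : y₂ 0 = y₁ T := by simpa using h₂.eq 0 le_rfl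
  have huT : EqOn u u₁ (Iic T) := fun t ht => if_pos ht
  have hyT : EqOn y y₁ (Iic T) := fun t ht => if_pos ht
  have hu2 : ∀ t > 0, u (t + T) = u₂ t := fun t ht => by
    rw [hudef]; simp [ht]
  have hy2 : ∀ t ≥ 0, y (t + T) = y₂ t := fun t ht => by
    rcases ht.eq_or_lt with rfl | ht
    · rw [zero_add, hyT self_mem_Iic, hy20]
    · rw [hydef]; simp [ht]
  have hyc : ContinuousOn y (Ici 0) := by
    have hpm : ContinuousOn (fun t => y₂ (t - T)) (Ici T) :=
      h₂.cont.comp (by fun_prop) fun t ht => mem_Ici.2 (sub_nonneg.2 ht)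
    have c1 : ContinuousOn y (Icc 0 T) := hy.congr fun t ht => hyT ht.2
    have c2 : ContinuousOn y (Ici T) := hpm.congr fun t ht => by
      have := hy2 (t - T) (sub_nonneg.2 ht)
      rwa [sub_add_cancel] at this
    have := c1.union_of_isClosed c2 isClosed_Icc isClosed_Ici
    rwa [Icc_union_Ici_eq_Ici hT] at this
  have hu1p : MemLp u 2 (volume.restrict (Ioc 0 T)) := by
    obtain ⟨M, hM⟩ := (isCompact_Icc.image_of_continuousOn hu).isBounded.exists_norm_le
    have h1 : MemLp u₁ 2 (volume.restrict (Ioc 0 T)) := by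
      refine MemLp.of_bound
        ((hu.mono Ioc_subset_Icc_self).aestronglyMeasurable measurableSet_Ioc) M ?_
      filter_upwards [ae_restrict_mem measurableSet_Ioc] with s hs
      exact hM _ ⟨s, Ioc_subset_Icc_self hs, rfl⟩
    refine h1.ae_eq ?_
    filter_upwards [ae_restrict_mem measurableSet_Ioc] with s hs
    exact (huT hs.2).symm
  have hpair : IsControlledPair P x u y := by
    refine ⟨?_, hyc, ?_⟩
    · rw [← Ioc_union_Ioi_eq_Ioi hT]
      have h1 : MemLp u 2 (volume.restrict (Ioi T)) := by
        rw [← zero_add T, ← memLp_comp_add_Ioi]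
        refine h₂.memLp.ae_eq ?_
        filter_upwards [ae_restrict_mem measurableSet_Ioi] with s hs
        exact (hu2 s hs).symm
      have hmeas : AEStronglyMeasurable u (volume.restrict (Ioc 0 T ∪ Ioi T)) :=
        aestronglyMeasurable_union_iff.2 ⟨hu1p.1, h1.1⟩
      refine (memLp_two_iff_integrable_sq_norm hmeas).2 ?_
      exact IntegrableOn.union (μ := volume) ((memLp_two_iff_integrable_sq_norm hu1p.1).1 hu1p)
        ((memLp_two_iff_integrable_sq_norm h1.1).1 h1)
    · intro t ht
      rcases le_total t T with htT | htT
      · rw [hyT htT, heq t ⟨ht, htT⟩]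
        congr 1
        refine intervalIntegral.integral_congr fun s hs => ?_
        rw [uIcc_of_le ht] at hs
        simp only [hyT (hs.2.trans htT), huT (hs.2.trans htT)]
      · have i1 : IntervalIntegrable (fun s => P.f (y s) + P.B (y s) (u s)) volume 0 T :=
          P.intervalIntegrable_field hT (hyc.mono fun s hs => hs.1) hu1p
        have e1 : ∫ s in (0 : ℝ)..T, (P.f (y s) + P.B (y s) (u s)) =
            ∫ s in (0 : ℝ)..T, (P.f (y₁ s) + P.B (y₁ s) (u₁ s)) := by
          refine intervalIntegral.integral_congr fun s hs => ?_
          rw [uIcc_of_le hT] at hs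
          simp only [hyT hs.2, huT hs.2]
        have h0t : 0 ≤ t - T := sub_nonneg.2 htT
        have e2 : ∫ s in T..t, (P.f (y s) + P.B (y s) (u s)) =
            ∫ s in (0 : ℝ)..(t - T), (P.f (y₂ s) + P.B (y₂ s) (u₂ s)) := by
          have h1 := intervalIntegral.integral_comp_add_right (a := 0) (b := t - T)
            (fun s => P.f (y s) + P.B (y s) (u s)) T
          rw [zero_add, sub_add_cancel] at h1
          rw [← h1]
          refine intervalIntegral.integral_congr_ae (Eventually.of_forall fun s hs => ?_)
          rw [uIoc_of_le h0t] at hs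
          simp only [hy2 s hs.1.le, hu2 s hs.1]
        have i2 : IntervalIntegrable (fun s => P.f (y s) + P.B (y s) (u s)) volume T t := by
          have h1 := h₂.intervalIntegrable le_rfl h0t
          have h2 : IntervalIntegrable (fun s => P.f (y (s + T)) + P.B (y (s + T)) (u (s + T)))
              volume 0 (t - T) := by
            refine h1.congr ?_
            intro s hs
            rw [uIoc_of_le h0t] at hs
            simp only [hy2 s hs.1.le, hu2 s hs.1]
          have h3 := h2.comp_add_right (-T)
          simpa using h3
        have hyt := hy2 (t - T) h0t
        rw [sub_add_cancel] at hyt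
        rw [← intervalIntegral.integral_add_adjacent_intervals i1 i2, e1, e2, hyt,
          h₂.eq _ h0t, heq T ⟨hT, le_rfl⟩, add_assoc]
  refine (P.eValue_le_cost hpair).trans_eq ?_
  rw [P.cost_eq_add u y hT]
  congr 1
  · refine setLIntegral_congr_fun measurableSet_Ioc fun s hs => ?_
    simp only [hyT hs.2, huT hs.2]
  · refine setLIntegral_congr_fun measurableSet_Ioi fun s hs => ?_
    simp only [hy2 s (le_of_lt hs), hu2 s hs]

lemma IsControlledPair.integrableOn_sq {x : E d} {u : ℝ → E m} {y : ℝ → E d}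
    (h : IsControlledPair P x u y) : IntegrableOn (fun t => ‖u t‖ ^ 2) (Ioi 0) :=
  (memLp_two_iff_integrable_sq_norm h.memLp.1).1 h.memLp

lemma IsControlledPair.integrableOn_running {x : E d} {u : ℝ → E m} {y : ℝ → E d}
    (h : IsControlledPair P x u y) (a : ℝ) :
    IntegrableOn (fun t => P.ℓ (y t) + P.β / 2 * ‖u t‖ ^ 2) (Ioc 0 a) := by
  refine Integrable.add ?_ ((h.integrableOn_sq.mono_set fun t ht => ht.1).const_mul _)
  exact ((P.ℓ_lip.continuous.comp_continuousOn (h.cont.mono fun t ht => ht.1)).integrableOn_Icc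
    (a := 0) (b := a)).mono_set Ioc_subset_Icc_self

lemma ControlProblem.running_nonneg (P : ControlProblem d m) (x : E d) (u : E m) :
    0 ≤ P.ℓ x + P.β / 2 * ‖u‖ ^ 2 := by
  have := P.ℓ_nonneg x; have := P.β_pos; positivity

/-- The tail of an e-optimal pair is admissible for the state reached, so it costs at least the
value there. The same pair thus serves all times a, which allows e = h² to be fixed before the
trajectory is known. -/
lemma ControlProblem.exists_pair_le (P : ControlProblem d m) (hVfin : ∀ y, P.eValue y ≠ ⊤)
    (x : E d) {e : ℝ} (he : 0 < e) : ∃ u y, IsControlledPair P x u y ∧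
      ∀ a ≥ 0, (∫ t in Ioc 0 a, (P.ℓ (y t) + P.β / 2 * ‖u t‖ ^ 2)) + P.V (y a) ≤ P.V x + e := by
  have hlt : P.eValue x < P.eValue x + ENNReal.ofReal e :=
    ENNReal.lt_add_right (hVfin x) (by simpa using he)
  conv_lhs at hlt => rw [ControlProblem.eValue]
  simp only [iInf_lt_iff] at hlt
  obtain ⟨u, y, h, hlt⟩ := hlt
  refine ⟨u, y, h, fun a ha => ?_⟩
  rw [P.cost_eq_add u y ha] at hlt
  have h1 := (add_le_add_right (P.eValue_le_cost (h.tail ha)) _).trans hlt.le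
  have hi := h.integrableOn_running a
  rw [← ofReal_integral_eq_lintegral_ofReal hi
    (Eventually.of_forall fun t => P.running_nonneg _ _),
    ← ENNReal.ofReal_toReal (hVfin (y a)), ← ENNReal.ofReal_toReal (hVfin x),
    ← ENNReal.ofReal_add (integral_nonneg fun t => P.running_nonneg _ _) ENNReal.toReal_nonneg,
    ← ENNReal.ofReal_add ENNReal.toReal_nonneg he.le,
    ENNReal.ofReal_le_ofReal_iff (add_nonneg ENNReal.toReal_nonneg he.le)] at h1
  exact h1

/-- Complete the square in u, then absorb the linear penalty k‖u + b/β‖ into the square by Young at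
the price k²/(2β). The two terms k‖·‖ on the left cancel; only the constants remain. -/
lemma quadratic_lower_bound {β : ℝ} (hβ : 0 < β) (b u : E m) {k : ℝ} :
    -(‖b‖ ^ 2 / (2 * β)) - k ^ 2 / (2 * β) - k * ‖u + β⁻¹ • b‖ + k * ‖u + β⁻¹ • b‖ ≤
      β / 2 * ‖u‖ ^ 2 + inner ℝ b u - k * ‖u + β⁻¹ • b‖ := by
  have h1 : ‖u + β⁻¹ • b‖ ^ 2 = ‖u‖ ^ 2 + 2 * β⁻¹ * inner ℝ b u + (β⁻¹) ^ 2 * ‖b‖ ^ 2 := by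
    rw [norm_add_sq_real, inner_smul_right, norm_smul, mul_pow, real_inner_comm,
      Real.norm_eq_abs, sq_abs]; ring
  have h2 : β / 2 * ‖u‖ ^ 2 + inner ℝ b u = β / 2 * ‖u + β⁻¹ • b‖ ^ 2 - ‖b‖ ^ 2 / (2 * β) := by
    rw [h1]; field_simp; ring
  have h3 : 0 ≤ β / 2 * (‖u + β⁻¹ • b‖ - k / β) ^ 2 := by positivity
  have h4 : β / 2 * (‖u + β⁻¹ • b‖ - k / β) ^ 2 =
      β / 2 * ‖u + β⁻¹ • b‖ ^ 2 - k * ‖u + β⁻¹ • b‖ + k ^ 2 / (2 * β) := by field_simp; ring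
  rw [h2]; linarith

lemma ControlProblem.continuous_hamiltonian (P : ControlProblem d m) (p : E d) :
    Continuous fun y => P.ℓ y + inner ℝ p (P.f y) - ‖P.Bt y p‖ ^ 2 / (2 * P.β) := by
  have h1 := P.ℓ_lip.continuous
  have h2 := P.f_lip.continuous
  have h3 : Continuous fun y => P.Bt y p :=
    P.continuous_Bt.comp (f := fun y : E d => (y, p)) (by fun_prop)
  fun_prop

/-- The value function is a subsolution of the Hamilton-Jacobi-Bellman equation at its points of
differentiability. -/
lemma ControlProblem.hamiltonian_nonpos (P : ControlProblem d m) (hVfin : ∀ y, P.eValue y ≠ ⊤)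
    {x : E d} (hd : DifferentiableAt ℝ P.V x) :
    P.ℓ x + inner ℝ (gradient P.V x) (P.f x) - ‖P.Bt x (gradient P.V x)‖ ^ 2 / (2 * P.β) ≤ 0 := by
  by_contra! hpos
  -- If the Hamiltonian at x were 2a > 0, then near x the running cost plus p·y' would be at least a
  -- for every control, hence at least a/2 after subtracting eM(1 + |u|). Integrating over [0,h]
  -- along an h²-optimal pair, with the Taylor error of V at most e∫M(1 + |u|), gives ah/2 ≤ h²,
  -- against h < a/2.
  set p := gradient P.V x with hp
  set H : E d → ℝ := fun y => P.ℓ y + inner ℝ p (P.f y) - ‖P.Bt y p‖ ^ 2 / (2 * P.β) with hH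
  have hHc : Continuous H := P.continuous_hamiltonian p
  set a := H x / 2 with ha
  have ha0 : 0 < a := half_pos hpos
  have hβ := P.β_pos
  -- bounds on the unit ball
  obtain ⟨M1, hM1⟩ := ((isCompact_closedBall x 1).image P.f_lip.continuous).isBounded.exists_norm_le
  obtain ⟨M2, hM2⟩ := ((isCompact_closedBall x 1).image P.B_lip.continuous).isBounded.exists_norm_le
  set M := max 1 (max M1 M2) with hM
  have hM0 : 0 < M := lt_of_lt_of_le one_pos (le_max_left _ _)
  have hfM : ∀ y ∈ Metric.closedBall x 1, ‖P.f y‖ ≤ M := fun y hy =>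
    (hM1 _ ⟨y, hy, rfl⟩).trans ((le_max_left _ _).trans (le_max_right _ _))
  have hBM : ∀ y ∈ Metric.closedBall x 1, ‖P.B y‖ ≤ M := fun y hy =>
    (hM2 _ ⟨y, hy, rfl⟩).trans ((le_max_right _ _).trans (le_max_right _ _))
  -- the small parameter
  obtain ⟨e, he0, he⟩ : ∃ e > 0,
      (e * M) ^ 2 / (2 * P.β) + e * M * (P.β⁻¹ * (M * ‖p‖)) + e * M < a / 2 := by
    have hc : Tendsto (fun e : ℝ => (e * M) ^ 2 / (2 * P.β) + e * M * (P.β⁻¹ * (M * ‖p‖)) + e * M)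
        (𝓝[>] 0) (𝓝 0) :=
      (Continuous.tendsto' (by fun_prop) _ _ (by simp)).mono_left nhdsWithin_le_nhds
    obtain ⟨e, h1, h2⟩ := ((hc.eventually_lt_const (half_pos ha0)).and self_mem_nhdsWithin).exists
    exact ⟨e, h2, h1⟩
  -- the radius
  have hlo := hd.hasFDerivAt.isLittleO
  rw [Asymptotics.isLittleO_iff] at hlo
  have hev : ∀ᶠ y in 𝓝 x, ‖P.V y - P.V x - fderiv ℝ P.V x (y - x)‖ ≤ e * ‖y - x‖ ∧ a < H y :=
    (hlo he0).and (hHc.continuousAt.eventually (lt_mem_nhds (by rw [ha]; linarith)))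
  obtain ⟨r₀, hr₀, hball⟩ := Metric.eventually_nhds_iff.1 hev
  set r := min r₀ 1 with hr
  have hr0 : 0 < r := lt_min hr₀ one_pos
  -- the time step
  set Q := 2 / P.β * (P.V x + 1) with hQ
  have hV0 : ∀ y, 0 ≤ P.V y := fun y => ENNReal.toReal_nonneg
  have hQ0 : 0 ≤ Q := by have := hV0 x; positivity
  obtain ⟨h, hh0, hh1, hha, hhr⟩ : ∃ h > 0, h < 1 ∧ h < a / 2 ∧
      M * h + M * (Real.sqrt h * Real.sqrt Q) < r := by
    have c1 : Tendsto (fun h : ℝ => M * h + M * (Real.sqrt h * Real.sqrt Q)) (𝓝[>] 0) (𝓝 0) :=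
      (Continuous.tendsto' (by fun_prop) _ _ (by simp)).mono_left nhdsWithin_le_nhds
    obtain ⟨h, h1, h2⟩ := ((c1.eventually_lt_const hr0).and
      (Ioo_mem_nhdsGT (lt_min one_pos (half_pos ha0)))).exists
    exact ⟨h, h2.1, h2.2.trans_le (min_le_left _ _), h2.2.trans_le (min_le_right _ _), h1⟩
  obtain ⟨u, y, hpair, hle⟩ := P.exists_pair_le hVfin x (show 0 < h ^ 2 by positivity)
  have hcost := hle h hh0.le
  have hy0 : y 0 = x := by simpa using hpair.eq 0 le_rfl
  have hsqi : IntegrableOn (fun t => ‖u t‖ ^ 2) (Ioc 0 h) :=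
    hpair.integrableOn_sq.mono_set fun t ht => ht.1
  have hui : IntegrableOn (fun t => ‖u t‖) (Ioc 0 h) :=
    ((hpair.memLp_Ioc le_rfl).integrable (by norm_num)).norm
  have hui1 : IntegrableOn (fun t => M * (1 + ‖u t‖)) (Ioc 0 h) :=
    ((integrableOn_const measure_Ioc_lt_top.ne).add hui).const_mul M
  have hsq : ∫ t in Ioc 0 h, ‖u t‖ ^ 2 ≤ Q := by
    have h1 : P.β / 2 * ∫ t in Ioc 0 h, ‖u t‖ ^ 2 ≤
        ∫ t in Ioc 0 h, (P.ℓ (y t) + P.β / 2 * ‖u t‖ ^ 2) := by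
      rw [← integral_const_mul]
      exact setIntegral_mono (hsqi.const_mul _) (hpair.integrableOn_running h)
        fun t => by have := P.ℓ_nonneg (y t); linarith
    have h2 : P.β / 2 * ∫ t in Ioc 0 h, ‖u t‖ ^ 2 ≤ P.V x + 1 := by
      have := hV0 (y h); nlinarith
    rw [hQ, div_mul_eq_mul_div, le_div_iff₀ hβ]; linarith
  -- Controls are only square integrable. The cost bounds ∫|u|² by Q, and Cauchy–Schwarz then makes
  -- the displacement O(√h), so the trajectory stays in the small ball.
  have hl1 : ∫ t in Ioc 0 h, ‖u t‖ ≤ Real.sqrt h * Real.sqrt Q := by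
    have := integral_mul_le_Lp_mul_Lq_of_nonneg (μ := volume.restrict (Ioc 0 h))
      Real.HolderConjugate.two_two (f := fun _ => (1 : ℝ)) (g := fun t => ‖u t‖)
      (Eventually.of_forall fun _ => zero_le_one) (Eventually.of_forall fun _ => norm_nonneg _)
      (memLp_const 1) (by simpa using (hpair.memLp_Ioc (a := 0) (b := h) le_rfl).norm)
    simp only [one_mul, Real.rpow_two] at this
    refine this.trans ?_
    rw [← Real.sqrt_eq_rpow, ← Real.sqrt_eq_rpow]
    gcongr
    simp [hh0.le]
  -- displacement while the trajectory stays in the unit ball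
  have hdisp : ∀ s ∈ Icc 0 h, (∀ t ∈ Ico 0 s, y t ∈ Metric.ball x r) →
      ‖y s - x‖ ≤ ∫ t in Ioc 0 s, M * (1 + ‖u t‖) := by
    intro s hs hin
    rw [hpair.eq s hs.1, add_sub_cancel_left, intervalIntegral.integral_of_le hs.1]
    refine norm_integral_le_of_norm_le (hui1.mono_set (Ioc_subset_Ioc_right hs.2)) ?_
    rw [← restrict_Ioo_eq_restrict_Ioc]
    filter_upwards [ae_restrict_mem measurableSet_Ioo] with t ht
    have htb : y t ∈ Metric.closedBall x 1 := Metric.ball_subset_closedBall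
      (Metric.ball_subset_ball (min_le_right _ _) (hin t ⟨ht.1.le, ht.2⟩))
    calc ‖P.f (y t) + P.B (y t) (u t)‖ ≤ ‖P.f (y t)‖ + ‖P.B (y t)‖ * ‖u t‖ :=
          (norm_add_le _ _).trans (by gcongr; exact ContinuousLinearMap.le_opNorm _ _)
      _ ≤ M + M * ‖u t‖ := by gcongr; exacts [hfM _ htb, hBM _ htb]
      _ = _ := by ring
  have hstay : ∀ t ∈ Icc (0 : ℝ) h, y t ∈ Metric.ball x r := by
    refine forall_mem_of_first_exit (hpair.cont.mono fun t ht => ht.1) Metric.isOpen_ball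
      fun s hs hin => ?_
    rw [mem_ball_iff_norm]
    refine (hdisp s hs hin).trans_lt (lt_of_le_of_lt ?_ hhr)
    calc ∫ t in Ioc 0 s, M * (1 + ‖u t‖) ≤ ∫ t in Ioc 0 h, M * (1 + ‖u t‖) :=
          setIntegral_mono_set hui1 (Eventually.of_forall fun t => by positivity)
            (Ioc_subset_Ioc_right hs.2).eventuallyLE
      _ = M * h + M * ∫ t in Ioc 0 h, ‖u t‖ := by
          rw [integral_const_mul, integral_add (integrable_const _) hui]
          simp [hh0.le]; ring
      _ ≤ _ := by gcongr
  have hdh := hdisp h ⟨hh0.le, le_rfl⟩ fun t ht => hstay t ⟨ht.1, ht.2.le⟩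
  -- the pointwise lower bound
  have hfi := hpair.intervalIntegrable le_rfl hh0.le
  rw [intervalIntegrable_iff_integrableOn_Ioc_of_le hh0.le] at hfi
  have hinner : ∫ t in Ioc 0 h, inner ℝ p (P.f (y t) + P.B (y t) (u t)) = inner ℝ p (y h - x) := by
    rw [integral_inner hfi, hpair.eq h hh0.le, add_sub_cancel_left,
      intervalIntegral.integral_of_le hh0.le]
  have hψ : ∀ t ∈ Ioc 0 h, a / 2 ≤ (P.ℓ (y t) + P.β / 2 * ‖u t‖ ^ 2) +
      inner ℝ p (P.f (y t) + P.B (y t) (u t)) - e * (M * (1 + ‖u t‖)) := by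
    intro t ht
    have hb := hstay t ⟨ht.1.le, ht.2⟩
    have hHt : a < H (y t) := (hball (lt_of_lt_of_le (Metric.mem_ball.1 hb) (min_le_left _ _))).2
    have hbt : ‖P.Bt (y t) p‖ ≤ M * ‖p‖ := (P.norm_Bt_le _ _).trans (by
      gcongr
      exact hBM _ (Metric.ball_subset_closedBall (Metric.ball_subset_ball (min_le_right _ _) hb)))
    -- With k = eM the quadratic cost absorbs the Taylor error, which is linear in the unbounded
    -- control.
    have hq := quadratic_lower_bound hβ (P.Bt (y t) p) (u t) (k := e * M)
    have hu : ‖u t‖ ≤ ‖u t + P.β⁻¹ • P.Bt (y t) p‖ + P.β⁻¹ * (M * ‖p‖) := by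
      calc ‖u t‖ = ‖(u t + P.β⁻¹ • P.Bt (y t) p) - P.β⁻¹ • P.Bt (y t) p‖ := by
            rw [add_sub_cancel_right]
        _ ≤ _ := (norm_sub_le _ _).trans (by
            rw [norm_smul, Real.norm_of_nonneg (inv_nonneg.2 hβ.le)]; gcongr)
    have hu' := mul_le_mul_of_nonneg_left hu (by positivity : 0 ≤ e * M)
    rw [inner_add_right, ← P.inner_Bt]
    simp only [hH] at hHt
    linarith
  have hint1 := hpair.integrableOn_running h
  have hint2 : IntegrableOn (fun t => inner ℝ p (P.f (y t) + P.B (y t) (u t))) (Ioc 0 h) :=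
    hfi.const_inner p
  have hfin : ∫ t in Ioc 0 h, a / 2 ≤ ∫ t in Ioc 0 h, ((P.ℓ (y t) + P.β / 2 * ‖u t‖ ^ 2) +
      inner ℝ p (P.f (y t) + P.B (y t) (u t)) - e * (M * (1 + ‖u t‖))) :=
    setIntegral_mono_on (integrableOn_const measure_Ioc_lt_top.ne)
      ((hint1.add hint2).sub (hui1.const_mul e)) measurableSet_Ioc hψ
  have hsplit : ∫ t in Ioc 0 h, ((P.ℓ (y t) + P.β / 2 * ‖u t‖ ^ 2) +
      inner ℝ p (P.f (y t) + P.B (y t) (u t)) - e * (M * (1 + ‖u t‖))) =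
      (∫ t in Ioc 0 h, (P.ℓ (y t) + P.β / 2 * ‖u t‖ ^ 2)) + inner ℝ p (y h - x) -
        e * ∫ t in Ioc 0 h, M * (1 + ‖u t‖) := by
    rw [← hinner, ← integral_const_mul, ← integral_add hint1 hint2]
    exact integral_sub (hint1.add hint2) (hui1.const_mul e)
  rw [hsplit] at hfin
  simp only [setIntegral_const, Measure.real, Real.volume_Ioc, sub_zero,
    ENNReal.toReal_ofReal hh0.le, smul_eq_mul] at hfin
  have htay := (hball (lt_of_lt_of_le (Metric.mem_ball.1 (hstay h ⟨hh0.le, le_rfl⟩))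
    (min_le_left _ _))).1
  rw [Real.norm_eq_abs, ← inner_gradient, ← hp] at htay
  have htay' := (abs_le.1 htay).1
  have h5 := mul_le_mul_of_nonneg_left hdh he0.le
  nlinarith

/-- Completing the square in the Hamilton-Jacobi-Bellman inequality. -/
lemma ControlProblem.running_add_inner_le (P : ControlProblem d m) (hVfin : ∀ y, P.eValue y ≠ ⊤)
    {x : E d} (hd : DifferentiableAt ℝ P.V x) (u : E m) :
    P.ℓ x + P.β / 2 * ‖u‖ ^ 2 + inner ℝ (gradient P.V x) (P.f x + P.B x u) ≤
      P.β / 2 * ‖u - P.feedback P.V x‖ ^ 2 := by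
  have h := P.hamiltonian_nonpos hVfin hd
  have hβ := P.β_pos
  set b := P.Bt x (gradient P.V x) with hb
  have h1 : ‖u - P.feedback P.V x‖ ^ 2 =
      ‖u‖ ^ 2 + 2 * P.β⁻¹ * inner ℝ b u + (P.β⁻¹) ^ 2 * ‖b‖ ^ 2 := by
    rw [ControlProblem.feedback, sub_neg_eq_add, norm_add_sq_real, inner_smul_right, norm_smul,
      mul_pow, real_inner_comm, Real.norm_eq_abs, sq_abs]; ring
  have h2 : P.β / 2 * (‖u‖ ^ 2 + 2 * P.β⁻¹ * inner ℝ b u + (P.β⁻¹) ^ 2 * ‖b‖ ^ 2) =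
      P.β / 2 * ‖u‖ ^ 2 + inner ℝ b u + ‖b‖ ^ 2 / (2 * P.β) := by field_simp
  rw [h1, h2, inner_add_right, ← P.inner_Bt]
  linarith

end DynamicProgramming

/-! ### The viscosity inequality at points of differentiability. -/

section Viscosity

variable {d m : ℕ} {P : ControlProblem d m} {Ω ω : Set (E d)} {φ w : E d → ℝ} {δ : ℝ}

lemma continuousOn_gradient {w : E d → ℝ} (hΩ : IsOpen Ω) (hw : ContDiffOn ℝ 1 w Ω) :
    ContinuousOn (gradient w) Ω :=
  (LinearIsometryEquiv.continuous _).comp_continuousOn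
    (hw.continuousOn_fderiv_of_isOpen hΩ le_rfl)

lemma isOpen_omegaDelta (hΩ : IsOpen Ω) (hw : ContDiffOn ℝ 1 w Ω) :
    IsOpen (omegaDelta Ω ω w δ) := by
  have := hw.continuousOn.isOpen_inter_preimage hΩ (isOpen_Iio (a := sSup (w '' ω) + δ))
  exact this

lemma ControlProblem.inner_law (P : ControlProblem d m) (a x q : E d) :
    inner ℝ a (P.f x + P.B x (-(P.β⁻¹ • P.Bt x q))) =
      inner ℝ a (P.f x) - P.β⁻¹ * inner ℝ (P.Bt x a) (P.Bt x q) := by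
  rw [inner_add_right, map_neg, map_smul, inner_neg_right, inner_smul_right, ← P.inner_Bt]
  ring

lemma hasGradientAt_quadratic (p z x : E d) (k : ℝ) :
    HasGradientAt (fun x => inner ℝ p (x - z) - k * ‖x - z‖ ^ 2) (p - (2 * k) • (x - z)) x := by
  rw [hasGradientAt_iff_hasFDerivAt]
  have h1 : HasFDerivAt (fun x : E d => x - z) (ContinuousLinearMap.id ℝ (E d)) x :=
    (hasFDerivAt_id x).sub_const z
  have h2 := ((innerSL ℝ p).hasFDerivAt.comp x h1).fun_sub (h1.norm_sq.const_mul k)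
  refine h2.congr_fderiv ?_
  ext v
  simp
  ring

/-- A viscosity supersolution satisfies the inequality at its points of differentiability. -/
lemma LyapunovHyp.inner_le (hΩ : IsOpen Ω) (h : LyapunovHyp P Ω ω φ δ w 0) {z : E d}
    (hz : z ∈ omegaDelta Ω ω w δ) (hd : DifferentiableAt ℝ φ z) :
    inner ℝ (gradient w z) (P.f z + P.B z (P.feedback φ z)) ≤ 0 := by
  set S := omegaDelta Ω ω w δ
  have hS : IsOpen S := isOpen_omegaDelta hΩ h.w_C1
  have hSΩ : S ⊆ Ω := fun x hx => hx.1
  set p := gradient φ z with hp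
  by_contra! hpos
  rw [ControlProblem.feedback, P.inner_law] at hpos
  have hgw : ContinuousAt (gradient w) z :=
    (continuousOn_gradient hΩ h.w_C1).continuousAt (hΩ.mem_nhds (hSΩ hz))
  have hcont : ContinuousAt (fun y : E d × E d => inner ℝ (gradient w y.1) (P.f y.1) -
      P.β⁻¹ * inner ℝ (P.Bt y.1 (gradient w y.1)) (P.Bt y.1 y.2)) (z, p) := by
    have c1 : ContinuousAt (fun y : E d × E d => gradient w y.1) (z, p) :=
      ContinuousAt.comp (f := Prod.fst) (x := (z, p)) (g := gradient w) hgw continuousAt_fst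
    have c2 : ContinuousAt (fun y : E d × E d => P.f y.1) (z, p) :=
      (P.f_lip.continuous.comp continuous_fst).continuousAt
    have c3 : ContinuousAt (fun y : E d × E d => P.Bt y.1 (gradient w y.1)) (z, p) :=
      ContinuousAt.comp (f := fun y : E d × E d => (y.1, gradient w y.1))
        P.continuous_Bt.continuousAt (continuousAt_fst.prodMk c1)
    have c4 : ContinuousAt (fun y : E d × E d => P.Bt y.1 y.2) (z, p) :=
      P.continuous_Bt.continuousAt
    exact (c1.inner c2).sub (continuousAt_const.mul (c3.inner c4))
  have hev := hcont.eventually (lt_mem_nhds hpos)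
  obtain ⟨η, hη, hball⟩ := Metric.eventually_nhds_iff.1 hev
  set e := η / 4 with he
  have he0 : 0 < e := by positivity
  have hlo := hd.hasFDerivAt.isLittleO
  rw [Asymptotics.isLittleO_iff] at hlo
  obtain ⟨r₀, hr₀, hb₀⟩ := Metric.eventually_nhds_iff.1 ((hlo he0).and (hS.mem_nhds hz))
  set r := min r₀ η / 2 with hr
  have hrr : 0 < r := by have := lt_min hr₀ hη; positivity
  have hrr₀ : r < r₀ := by have := min_le_left r₀ η; linarith
  have hrη : r < η := by have := min_le_right r₀ η; linarith
  have hin : ∀ x ∈ Metric.closedBall z r,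
      ‖φ x - φ z - fderiv ℝ φ z (x - z)‖ ≤ e * ‖x - z‖ ∧ x ∈ S := fun x hx =>
    hb₀ (lt_of_le_of_lt (Metric.mem_closedBall.1 hx) hrr₀)
  -- The test function is the affine part of φ at z minus k|x − z|², and a minimiser x is taken over
  -- the ball of radius r. Differentiability gives k|x − z| ≤ e, so |x − z| ≤ r/2 and the minimum is
  -- interior. The gradient of the test function at x differs from p by at most 2e = η/2, within the
  -- tolerance where the inequality is still violated.
  set k := 2 * e / r with hk
  have hk0 : 0 < k := by positivity
  set hf : E d → ℝ := fun x => inner ℝ p (x - z) - k * ‖x - z‖ ^ 2 with hhf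
  have hfc : ContDiff ℝ 1 hf := by
    have h1 : ContDiff ℝ 1 fun x : E d => x - z := contDiff_id.sub contDiff_const
    exact (contDiff_const.inner ℝ h1).sub (contDiff_const.mul (h1.norm_sq ℝ))
  have hcq : ContinuousOn (fun x => φ x - hf x) (Metric.closedBall z r) :=
    (h.φ_cont.mono fun x hx => hSΩ (hin x hx).2).sub hfc.continuous.continuousOn
  obtain ⟨x, hx, hmin⟩ := (isCompact_closedBall z r).exists_isMinOn
    ⟨z, Metric.mem_closedBall_self hrr.le⟩ hcq
  have h1 : φ x - hf x ≤ φ z - hf z := hmin (Metric.mem_closedBall_self hrr.le)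
  have h2 := (abs_le.1 ((Real.norm_eq_abs _) ▸ (hin x hx).1)).1
  rw [← inner_gradient, ← hp] at h2
  simp only [hhf, sub_self, inner_zero_right, norm_zero] at h1
  have h3 : k * ‖x - z‖ ^ 2 ≤ e * ‖x - z‖ := by
    norm_num at h1; linarith
  have h4 : k * ‖x - z‖ ≤ e := by
    rcases (norm_nonneg (x - z)).eq_or_lt with h0 | h0
    · rw [← h0, mul_zero]; exact he0.le
    · nlinarith
  have h5 : ‖x - z‖ ≤ r / 2 := by
    rw [hk, div_mul_eq_mul_div, div_le_iff₀ hrr] at h4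
    nlinarith
  have hloc : IsLocalMin (fun y => φ y - hf y) x := by
    refine (hmin.filter_mono ?_ : _)
    refine le_principal_iff.2 (mem_of_superset (Metric.isOpen_ball.mem_nhds (?_ : x ∈
      Metric.ball z r)) Metric.ball_subset_closedBall)
    rw [mem_ball_iff_norm]; linarith
  have hsup := h.supersol x (hin x hx).2 hf hfc.contDiffOn hloc
  have hgr : gradient hf x = p - (2 * k) • (x - z) := (hasGradientAt_quadratic p z x k).gradient
  rw [ControlProblem.feedback, hgr, P.inner_law] at hsup
  refine absurd hsup (not_le.2 (hball (y := (x, p - (2 * k) • (x - z))) ?_))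
  rw [Prod.dist_eq, max_lt_iff]
  constructor
  · exact (Metric.mem_closedBall.1 hx).trans_lt hrη
  · rw [dist_eq_norm, sub_sub_cancel_left, norm_neg, norm_smul, Real.norm_of_nonneg (by positivity)]
    linarith

end Viscosity

/-! ### Entrywise supremum and Lipschitz norms. -/

section Norms

variable {d : ℕ} {ι : Type}

lemma supNorm_nonneg (A : Set (E d)) (F : E d → ι → ℝ) : 0 ≤ supNorm A F :=
  Real.sSup_nonneg (by rintro _ ⟨x, _, k, rfl⟩; exact abs_nonneg _)

lemma abs_le_supNorm {A : Set (E d)} {F : E d → ι → ℝ} {M : ℝ} (hM : ∀ x ∈ A, ∀ k, |F x k| ≤ M)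
    {x : E d} (hx : x ∈ A) (k : ι) : |F x k| ≤ supNorm A F :=
  le_csSup ⟨M, by rintro _ ⟨x, hx, k, rfl⟩; exact hM x hx k⟩ ⟨x, hx, k, rfl⟩

/-- A real `sSup` is zero on unbounded sets, so some Lipschitz constant L must be known before the
supremum of the quotients can serve as one. Diagonal quotients vanish and are treated apart. -/
lemma exists_lipNorm_eq {A : Set (E d)} {F : E d → ι → ℝ} {L : ℝ} (hL0 : 0 ≤ L)
    (hL : ∀ x ∈ A, ∀ y ∈ A, ∀ k, |F x k - F y k| ≤ L * ‖x - y‖) :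
    ∃ l ≥ 0, lipNorm A F = l + supNorm A F ∧
      ∀ x ∈ A, ∀ y ∈ A, ∀ k, |F x k - F y k| ≤ l * ‖x - y‖ := by
  refine ⟨_, Real.sSup_nonneg (by rintro _ ⟨x, _, y, _, k, rfl⟩; positivity), rfl,
    fun x hx y hy k => ?_⟩
  rcases (norm_nonneg (x - y)).eq_or_lt with h0 | h0
  · have := hL x hx y hy k
    rw [← h0, mul_zero] at this ⊢
    exact this
  · rw [← div_le_iff₀ h0]
    refine le_csSup ⟨L, ?_⟩ ⟨x, hx, y, hy, k, rfl⟩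
    rintro _ ⟨x, hx, y, hy, k, rfl⟩
    exact div_le_of_le_mul₀ (norm_nonneg _) hL0 (hL x hx y hy k)

end Norms

/-! ### Divergence of a closed loop field. -/

section Divergence

variable {d m : ℕ} {P : ControlProblem d m}

lemma trace_eq_sum_apply (A : E d →L[ℝ] E d) :
    LinearMap.trace ℝ (E d) A = ∑ i, A (EuclideanSpace.single i 1) i := by
  rw [LinearMap.trace_eq_sum_inner _ (EuclideanSpace.basisFun (Fin d) ℝ)]
  refine Finset.sum_congr rfl fun i _ => ?_
  simp [EuclideanSpace.inner_single_left]

lemma ControlProblem.field_apply (P : ControlProblem d m) (x g : E d) (i : Fin d) :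
    (P.f x + P.B x (-(P.β⁻¹ • P.Bt x g))) i =
      P.f x i - P.β⁻¹ * ∑ j, ∑ k, P.entry x (i, j) * P.entry x (k, j) * g k := by
  have hu : ∀ u : E m, P.B x u i = ∑ j, P.entry x (i, j) * u j := by
    intro u
    conv_lhs => rw [← (EuclideanSpace.basisFun (Fin m) ℝ).sum_repr u]
    simp [map_sum, ControlProblem.entry, mul_comm]
  have hb : ∀ j, P.Bt x g j = ∑ k, P.entry x (k, j) * g k := by
    intro j
    have h1 : P.Bt x g j = inner ℝ (P.Bt x g) (EuclideanSpace.single j 1) := by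
      simp [EuclideanSpace.inner_single_right]
    rw [h1, P.inner_Bt, real_inner_comm, PiLp.inner_apply]
    simp [ControlProblem.entry, mul_comm]
  rw [PiLp.add_apply, map_neg, map_smul, PiLp.neg_apply, PiLp.smul_apply, hu, smul_eq_mul,
    ← sub_eq_add_neg]
  congr 2
  refine Finset.sum_congr rfl fun j _ => ?_
  rw [hb, Finset.mul_sum]
  exact Finset.sum_congr rfl fun k _ => by ring

lemma abs_apply_le_norm {n : ℕ} (x : E n) (i : Fin n) : |x i| ≤ ‖x‖ := by
  simpa using PiLp.norm_apply_le x i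

lemma hasDerivAt_line {φ : E d → ℝ} {x : E d} (h : DifferentiableAt ℝ φ x) (e : E d) :
    HasDerivAt (fun t : ℝ => φ (x + t • e)) (fderiv ℝ φ x e) 0 := by
  have h0 : HasDerivAt (fun t : ℝ => x + t • e) e 0 := by
    simpa using ((hasDerivAt_id (0 : ℝ)).smul_const e).const_add x
  have : HasFDerivAt φ (fderiv ℝ φ x) ((fun t : ℝ => x + t • e) 0) := by
    simpa using h.hasFDerivAt
  exact this.comp_hasDerivAt _ h0

lemma differentiableAt_entry {x : E d} (hB : DifferentiableAt ℝ P.B x) (k : Fin d × Fin m) :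
    DifferentiableAt ℝ (fun y => P.entry y k) x := by
  have h1 : DifferentiableAt ℝ (fun y => P.B y (EuclideanSpace.single k.2 1)) x :=
    hB.clm_apply (differentiableAt_const _)
  exact (EuclideanSpace.proj (𝕜 := ℝ) k.1).differentiableAt.comp x h1

/-- Lower bound for the divergence of the closed loop field of `-β⁻¹ Bᵀ g` in terms of entrywise
bounds and the one-sided bound `⟪Dg b, b⟫ ≤ C|b|²`. -/
lemma ControlProblem.neg_le_trace (P : ControlProblem d m) {x : E d} {g : E d → E d}
    (hf : DifferentiableAt ℝ P.f x) (hB : DifferentiableAt ℝ P.B x) (hg : DifferentiableAt ℝ g x)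
    {C s l lf G : ℝ} (hs : ∀ k, |P.entry x k| ≤ s) (hs0 : 0 ≤ s) (hl0 : 0 ≤ l)
    (hC0 : 0 ≤ C)
    (hl : ∀ k i, |fderiv ℝ (fun y => P.entry y k) x (EuclideanSpace.single i 1)| ≤ l)
    (hlf : ∀ i, |fderiv ℝ (fun y => P.f y i) x (EuclideanSpace.single i 1)| ≤ lf)
    (hG : ‖g x‖ ≤ G) (hC : ∀ b, inner ℝ (fderiv ℝ g x b) b ≤ C * ‖b‖ ^ 2) :
    -(1 / P.β * (m * d * C * s ^ 2 + m * d ^ 2 * (l + s) ^ 2 * G) + d * lf) ≤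
      LinearMap.trace ℝ (E d)
        (fderiv ℝ (fun y => P.f y + P.B y (-(P.β⁻¹ • P.Bt y (g y)))) x) := by
  set F : E d → E d := fun y => P.f y + P.B y (-(P.β⁻¹ • P.Bt y (g y))) with hF
  set e : Fin d → E d := fun i => EuclideanSpace.single i 1 with he
  set b : Fin d → Fin m → ℝ := fun i j => P.entry x (i, j) with hb
  set Db : Fin d → Fin m → Fin d → ℝ := fun k j i =>
    fderiv ℝ (fun y => P.entry y (k, j)) x (e i) with hDb
  set Dg : Fin d → Fin d → ℝ := fun k i => fderiv ℝ (fun y => g y k) x (e i) with hDg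
  set Df : Fin d → ℝ := fun i => fderiv ℝ (fun y => P.f y i) x (e i) with hDf
  have hfi : ∀ i, DifferentiableAt ℝ (fun y => P.f y i) x := fun i =>
    (EuclideanSpace.proj (𝕜 := ℝ) i).differentiableAt.comp x hf
  have hgi : ∀ i, DifferentiableAt ℝ (fun y => g y i) x := fun i =>
    (EuclideanSpace.proj (𝕜 := ℝ) i).differentiableAt.comp x hg
  have hbd : ∀ k, DifferentiableAt ℝ (fun y => P.entry y k) x := differentiableAt_entry hB
  have hFi : ∀ i, (fun y => F y i) = fun y => P.f y i - P.β⁻¹ * ∑ j, ∑ k,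
      P.entry y (i, j) * P.entry y (k, j) * g y k := fun i => funext fun y => P.field_apply y (g y) i
  have hFd : DifferentiableAt ℝ F x := by
    rw [differentiableAt_piLp]
    intro i
    rw [hFi]
    refine (hfi i).sub (DifferentiableAt.const_mul ?_ _)
    refine DifferentiableAt.fun_sum fun j _ => DifferentiableAt.fun_sum fun k _ => ?_
    exact ((hbd _).mul (hbd _)).mul (hgi k)
  have hcomp : ∀ i, fderiv ℝ F x (e i) i = Df i - P.β⁻¹ * ∑ j, ∑ k,
      ((Db i j i * b k j + b i j * Db k j i) * g x k + b i j * b k j * Dg k i) := by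
    intro i
    have h1 : HasDerivAt (fun t : ℝ => F (x + t • e i) i) (fderiv ℝ F x (e i) i) 0 := by
      have h2 := hasDerivAt_line
        ((EuclideanSpace.proj (𝕜 := ℝ) i).differentiableAt.comp x hFd) (e i)
      have h3 : fderiv ℝ ((EuclideanSpace.proj (𝕜 := ℝ) i : E d →L[ℝ] ℝ) ∘ F) x (e i) =
          fderiv ℝ F x (e i) i := by
        rw [fderiv_comp x (EuclideanSpace.proj (𝕜 := ℝ) i).differentiableAt hFd,
          ContinuousLinearMap.fderiv]
        rfl
      rw [h3] at h2
      exact h2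
    have h4 : HasDerivAt (fun t : ℝ => F (x + t • e i) i) (Df i - P.β⁻¹ * ∑ j, ∑ k,
        ((Db i j i * b k j + b i j * Db k j i) * g x k + b i j * b k j * Dg k i)) 0 := by
      have h5 : (fun t : ℝ => F (x + t • e i) i) = fun t => P.f (x + t • e i) i - P.β⁻¹ *
          ∑ j, ∑ k, P.entry (x + t • e i) (i, j) * P.entry (x + t • e i) (k, j) *
            g (x + t • e i) k := funext fun t => congrFun (hFi i) _
      rw [h5]
      refine (hasDerivAt_line (hfi i) (e i)).fun_sub (HasDerivAt.const_mul _ ?_)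
      refine HasDerivAt.fun_sum fun j _ => HasDerivAt.fun_sum fun k _ => ?_
      have h6 := ((hasDerivAt_line (hbd (i, j)) (e i)).fun_mul
        (hasDerivAt_line (hbd (k, j)) (e i))).fun_mul (hasDerivAt_line (hgi k) (e i))
      simpa using h6
    exact h1.unique h4
  rw [trace_eq_sum_apply, Finset.sum_congr rfl fun i _ => hcomp i, Finset.sum_sub_distrib,
    ← Finset.mul_sum]
  have hβ := P.β_pos
  have hgk : ∀ k, |g x k| ≤ G := fun k => (abs_apply_le_norm _ _).trans hG
  -- the divergence of `f`
  have t1 : -(d * lf) ≤ ∑ i, Df i := by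
    have : ∑ _i : Fin d, -lf ≤ ∑ i, Df i :=
      Finset.sum_le_sum fun i _ => (abs_le.1 (hlf i)).1
    simpa using this
  -- the terms with derivatives of `B`
  have t2 : ∑ i, ∑ j, ∑ k, (Db i j i * b k j + b i j * Db k j i) * g x k ≤
      m * d ^ 2 * (l + s) ^ 2 * G := by
    -- The product rule gives 2ls, which is at most (l + s)², the square of the full Lipschitz norm
    -- in K.
    have hterm : ∀ i j k, (Db i j i * b k j + b i j * Db k j i) * g x k ≤ (l + s) ^ 2 * G := by
      intro i j k
      refine (le_abs_self _).trans ?_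
      rw [abs_mul]
      refine mul_le_mul ?_ (hgk k) (abs_nonneg _) (by positivity)
      have a1 : |Db i j i * b k j| ≤ l * s := by
        rw [abs_mul]; exact mul_le_mul (hl _ _) (hs _) (abs_nonneg _) hl0
      have a2 : |b i j * Db k j i| ≤ s * l := by
        rw [abs_mul]; exact mul_le_mul (hs _) (hl _ _) (abs_nonneg _) hs0
      have := (abs_add_le (Db i j i * b k j) (b i j * Db k j i))
      nlinarith [sq_nonneg l, sq_nonneg s]
    have : ∑ i, ∑ j, ∑ k, (Db i j i * b k j + b i j * Db k j i) * g x k ≤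
        ∑ _i : Fin d, ∑ _j : Fin m, ∑ _k : Fin d, (l + s) ^ 2 * G :=
      Finset.sum_le_sum fun i _ => Finset.sum_le_sum fun j _ => Finset.sum_le_sum fun k _ =>
        hterm i j k
    refine this.trans_eq ?_
    simp only [Finset.sum_const, Finset.card_univ, Fintype.card_fin, nsmul_eq_mul]
    ring
  -- the second order term
  have t3 : ∑ i, ∑ j, ∑ k, b i j * b k j * Dg k i ≤ m * d * C * s ^ 2 := by
    -- For fixed j the sum is the quadratic form of Dg on the j-th column c of B, so the one-sided
    -- bound on Dg is enough; no two-sided bound on second derivatives of V_ε is available uniformly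
    -- in ε.
    have hcol : ∀ j, ∑ i, ∑ k, b i j * b k j * Dg k i ≤ d * C * s ^ 2 := by
      intro j
      set c : E d := ∑ i, b i j • e i with hc
      have hck : ∀ k, c k = b k j := by
        intro k
        change (EuclideanSpace.proj (𝕜 := ℝ) k : E d →L[ℝ] ℝ) c = b k j
        rw [hc, map_sum, Finset.sum_eq_single k]
        · simp [he]
        · intro i _ hik
          simp [he, hik.symm]
        · simp
      have hDgk : ∀ i k, fderiv ℝ g x (e i) k = Dg k i := by
        intro i k
        have h3 : fderiv ℝ ((EuclideanSpace.proj (𝕜 := ℝ) k : E d →L[ℝ] ℝ) ∘ g) x (e i) =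
            fderiv ℝ g x (e i) k := by
          rw [fderiv_comp x (EuclideanSpace.proj (𝕜 := ℝ) k).differentiableAt hg,
            ContinuousLinearMap.fderiv]
          rfl
        exact h3.symm
      have h1 : inner ℝ (fderiv ℝ g x c) c = ∑ i, ∑ k, b i j * b k j * Dg k i := by
        conv_lhs => rw [hc, map_sum, sum_inner, ← hc]
        refine Finset.sum_congr rfl fun i _ => ?_
        rw [map_smul, inner_smul_left, PiLp.inner_apply, Finset.mul_sum]
        refine Finset.sum_congr rfl fun k _ => ?_
        rw [hck, hDgk]
        simp
        ring
      have h2 : ‖c‖ ^ 2 ≤ d * s ^ 2 := by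
        rw [EuclideanSpace.norm_sq_eq]
        have : ∑ i, ‖c i‖ ^ 2 ≤ ∑ _i : Fin d, s ^ 2 := Finset.sum_le_sum fun i _ => by
          rw [hck, Real.norm_eq_abs]
          exact pow_le_pow_left₀ (abs_nonneg _) (hs _) 2
        simpa using this
      calc _ = inner ℝ (fderiv ℝ g x c) c := h1.symm
        _ ≤ C * ‖c‖ ^ 2 := hC c
        _ ≤ C * (d * s ^ 2) := by gcongr
        _ = _ := by ring
    calc ∑ i, ∑ j, ∑ k, b i j * b k j * Dg k i = ∑ j, ∑ i, ∑ k, b i j * b k j * Dg k i :=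
          Finset.sum_comm
      _ ≤ ∑ _j : Fin m, d * C * s ^ 2 := Finset.sum_le_sum fun j _ => hcol j
      _ = _ := by simp; ring
  have t4 : ∑ i, ∑ j, ∑ k,
      ((Db i j i * b k j + b i j * Db k j i) * g x k + b i j * b k j * Dg k i) ≤
      m * d * C * s ^ 2 + m * d ^ 2 * (l + s) ^ 2 * G := by
    simp only [Finset.sum_add_distrib]
    simp only at t2
    linarith
  have t5 := mul_le_mul_of_nonneg_left t4 (inv_nonneg.2 hβ.le)
  rw [one_div]
  linarith

end Divergence

/-! ### Uniform bounds near ω_δ, and two bounds for the drift of w. -/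

/-- The standing assumptions on the value function, the domain, the Lyapunov function and the
mollifier. -/
structure Standing {d m : ℕ} (P : ControlProblem d m) (Ω ω : Set (E d)) (δ : ℝ) (w : E d → ℝ)
    (C : ℝ) (ρ : E d → ℝ) : Prop where
  finite : ∀ y, P.eValue y ≠ ⊤
  cont : Continuous P.V
  isOpen : IsOpen Ω
  convex : Convex ℝ Ω
  bounded : Bornology.IsBounded Ω
  isOpen_ω : IsOpen ω
  closure_ω : closure ω ⊆ Ω
  lyap : LyapunovHyp P Ω ω P.V δ w 0
  C_pos : 0 < C
  semiConcave : SemiConcaveOn Ω C P.V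
  mollifier : IsMollifier ρ

/-- Uniform bounds on the `D`-neighbourhood of `S`. -/
structure Bounds {d m : ℕ} (P : ControlProblem d m) (Ω S : Set (E d)) (w : E d → ℝ) (D M : ℝ) :
    Prop where
  D_pos : 0 < D
  one_le : 1 ≤ M
  mem : ∀ x ∈ S, ∀ y, dist y x ≤ D → y ∈ Ω
  gradV : ∀ x ∈ S, ∀ y, dist y x ≤ D → ‖gradient P.V y‖ ≤ M
  gradw : ∀ x ∈ S, ∀ y, dist y x ≤ D → ‖gradient w y‖ ≤ M
  f_le : ∀ x ∈ S, ∀ y, dist y x ≤ D → ‖P.f y‖ ≤ M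
  B_le : ∀ x ∈ S, ∀ y, dist y x ≤ D → ‖P.B y‖ ≤ M
  w_lip : ∀ x ∈ S, ∀ y, dist y x ≤ D → |w y - w x| ≤ M * dist y x
  B_lip : ∀ x ∈ S, ∀ y, dist y x ≤ D → ‖P.B y - P.B x‖ ≤ M * dist y x

section

variable {d m : ℕ} {P : ControlProblem d m} {Ω ω : Set (E d)} {δ : ℝ} {w : E d → ℝ}
  {C : ℝ} {ρ : E d → ℝ}

local notation "SS" => omegaDelta Ω ω w δ

lemma Standing.isOpen_S (h : Standing P Ω ω δ w C ρ) : IsOpen SS :=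
  isOpen_omegaDelta h.isOpen h.lyap.w_C1

lemma omegaDelta_subset : SS ⊆ Ω := fun _ hx => hx.1

lemma Standing.volume_S_lt_top (h : Standing P Ω ω δ w C ρ) : volume SS < ⊤ :=
  (h.bounded.subset omegaDelta_subset).measure_lt_top

/-- The closure of ω_δ is compact in Ω, hence so is a closed neighbourhood N of it, on which locally
Lipschitz data are Lipschitz. Taking half the thickness as D makes N a neighbourhood of each point
involved, as the gradient bounds require. -/
lemma Standing.exists_bounds (h : Standing P Ω ω δ w C ρ) : ∃ D M, Bounds P Ω SS w D M := by
  have hcomp : IsCompact (closure SS) :=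
    Metric.isCompact_of_isClosed_isBounded isClosed_closure
      (h.bounded.subset omegaDelta_subset).closure
  obtain ⟨D₂, hD₂, hsub⟩ := hcomp.exists_cthickening_subset_open h.isOpen h.lyap.subset'
  set N := Metric.cthickening D₂ (closure SS) with hN
  have hNc : IsCompact N := hcomp.cthickening
  have hin : ∀ x ∈ SS, ∀ y, dist y x ≤ D₂ → y ∈ N := fun x hx y hy =>
    Metric.mem_cthickening_of_dist_le y x D₂ _ (subset_closure hx) hy
  have hnhds : ∀ x ∈ SS, ∀ y, dist y x ≤ D₂ / 2 → N ∈ 𝓝 y := by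
    intro x hx y hy
    refine mem_of_superset (Metric.ball_mem_nhds y (half_pos hD₂)) fun z hz => hin x hx z ?_
    have := dist_triangle z y x
    rw [Metric.mem_ball] at hz
    linarith
  obtain ⟨LV, hLV⟩ := ((h.semiConcave.locallyLipschitzOn h.isOpen).mono
    hsub).exists_lipschitzOnWith_of_compact hNc
  obtain ⟨Lw, hLw⟩ := ((h.lyap.w_C1.locallyLipschitzOn h.convex).mono
    hsub).exists_lipschitzOnWith_of_compact hNc
  obtain ⟨LB, hLB⟩ := (P.B_lip.locallyLipschitzOn (s := N)).exists_lipschitzOnWith_of_compact hNc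
  obtain ⟨Mf, hMf⟩ := (hNc.image P.f_lip.continuous).isBounded.exists_norm_le
  obtain ⟨MB, hMB⟩ := (hNc.image P.B_lip.continuous).isBounded.exists_norm_le
  set M := 1 + LV + Lw + LB + |Mf| + |MB| with hM
  have p1 := LV.2
  have p2 := Lw.2
  have p3 := LB.2
  have p4 := abs_nonneg Mf
  have p5 := abs_nonneg MB
  have l1 : (LV : ℝ) ≤ M := by rw [hM]; simp only [NNReal.val_eq_coe] at *; linarith
  have l2 : (Lw : ℝ) ≤ M := by rw [hM]; simp only [NNReal.val_eq_coe] at *; linarith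
  have l3 : (LB : ℝ) ≤ M := by rw [hM]; simp only [NNReal.val_eq_coe] at *; linarith
  have l4 : |Mf| ≤ M := by rw [hM]; simp only [NNReal.val_eq_coe] at *; linarith
  have l5 : |MB| ≤ M := by rw [hM]; simp only [NNReal.val_eq_coe] at *; linarith
  have hself : ∀ x ∈ SS, x ∈ N := fun x hx => hin x hx x (by rw [dist_self]; exact hD₂.le)
  have hhalf : ∀ x ∈ SS, ∀ y, dist y x ≤ D₂ / 2 → y ∈ N := fun x hx y hy =>
    hin x hx y (hy.trans (by linarith))
  refine ⟨D₂ / 2, M, half_pos hD₂, ?_, fun x hx y hy => hsub (hhalf x hx y hy), ?_, ?_, ?_, ?_,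
    ?_, ?_⟩
  · rw [hM]; simp only [NNReal.val_eq_coe] at *; linarith
  · exact fun x hx y hy => (norm_gradient_le (hnhds x hx y hy) hLV).trans l1
  · exact fun x hx y hy => (norm_gradient_le (hnhds x hx y hy) hLw).trans l2
  · exact fun x hx y hy => (hMf _ ⟨y, hhalf x hx y hy, rfl⟩).trans ((le_abs_self _).trans l4)
  · exact fun x hx y hy => (hMB _ ⟨y, hhalf x hx y hy, rfl⟩).trans ((le_abs_self _).trans l5)
  · intro x hx y hy
    have := hLw.dist_le_mul y (hhalf x hx y hy) x (hself x hx)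
    rw [Real.dist_eq] at this
    exact this.trans (by gcongr)
  · intro x hx y hy
    have := hLB.dist_le_mul y (hhalf x hx y hy) x (hself x hx)
    rw [dist_eq_norm (P.B y)] at this
    exact this.trans (by gcongr)

variable {D M : ℝ}

lemma Bounds.M_nonneg {S : Set (E d)} (hb : Bounds P Ω S w D M) : 0 ≤ M :=
  zero_le_one.trans hb.one_le

lemma dist_le_of_mem_closedBall {x y : E d}
    (hy : dist y x ≤ D / 2) {ε : ℝ} (hε : ε ≤ D / 2) {z : E d} (hz : z ∈ Metric.closedBall y ε) :
    dist z x ≤ D := by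
  have := dist_triangle z y x
  rw [Metric.mem_closedBall] at hz
  linarith

lemma Standing.gradient_mollify (h : Standing P Ω ω δ w C ρ) (hb : Bounds P Ω SS w D M) {x y : E d}
    (hx : x ∈ SS) (hy : dist y x ≤ D / 2) {ε : ℝ} (hε : ε ∈ Ioc 0 (D / 2)) :
    gradient (mollify ρ ε P.V) y = mavg ρ ε (gradient P.V) y :=
  h.semiConcave.gradient_mollify h.mollifier h.isOpen h.cont hε.1
    fun z hz => hb.mem x hx z (dist_le_of_mem_closedBall hy hε.2 hz)

lemma Standing.norm_gradient_mollify_le (h : Standing P Ω ω δ w C ρ) (hb : Bounds P Ω SS w D M)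
    {x y : E d} (hx : x ∈ SS) (hy : dist y x ≤ D / 2) {ε : ℝ} (hε : ε ∈ Ioc 0 (D / 2)) :
    ‖gradient (mollify ρ ε P.V) y‖ ≤ M := by
  rw [h.gradient_mollify hb hx hy hε]
  have := h.mollifier.norm_mavg_sub_le hε.1 (x := y) (measurable_gradient P.V) (c := 0) (η := M)
    (Eventually.of_forall fun z hz => by
      rw [sub_zero]
      exact hb.gradV x hx z (dist_le_of_mem_closedBall hy hε.2 (Metric.ball_subset_closedBall hz)))
  rwa [sub_zero] at this

lemma Bounds.norm_law_le {S : Set (E d)} (hb : Bounds P Ω S w D M) {x y : E d} (hx : x ∈ S)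
    (hy : dist y x ≤ D) {q : E d} (hq : ‖q‖ ≤ M) : ‖-(P.β⁻¹ • P.Bt y q)‖ ≤ P.β⁻¹ * (M * M) := by
  rw [norm_neg, norm_smul, Real.norm_of_nonneg (inv_nonneg.2 P.β_pos.le)]
  refine mul_le_mul_of_nonneg_left ((P.norm_Bt_le _ _).trans ?_) (inv_nonneg.2 P.β_pos.le)
  exact mul_le_mul (hb.B_le x hx y hy) hq (norm_nonneg _) hb.M_nonneg

lemma Standing.norm_uEps_le (h : Standing P Ω ω δ w C ρ) (hb : Bounds P Ω SS w D M)
    {x y : E d} (hx : x ∈ SS) (hy : dist y x ≤ D / 2) {ε : ℝ} (hε : ε ∈ Ioc 0 (D / 2)) :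
    ‖uEps P ρ ε y‖ ≤ P.β⁻¹ * (M * M) :=
  hb.norm_law_le hx (hy.trans (by linarith [hb.D_pos])) (h.norm_gradient_mollify_le hb hx hy hε)

lemma Bounds.norm_feedback_le {S : Set (E d)} (hb : Bounds P Ω S w D M) {x y : E d} (hx : x ∈ S)
    (hy : dist y x ≤ D) : ‖P.feedback P.V y‖ ≤ P.β⁻¹ * (M * M) :=
  hb.norm_law_le hx hy (hb.gradV x hx y hy)

lemma Bounds.norm_Bt_gradw_le {S : Set (E d)} (hb : Bounds P Ω S w D M) {x y : E d} (hx : x ∈ S)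
    (hy : dist y x ≤ D) : ‖P.Bt y (gradient w y)‖ ≤ M * M :=
  (P.norm_Bt_le _ _).trans (mul_le_mul (hb.B_le x hx y hy) (hb.gradw x hx y hy) (norm_nonneg _)
    hb.M_nonneg)

/-- Velocities of the closed loop system near `S`. -/
lemma Standing.norm_field_le (h : Standing P Ω ω δ w C ρ) (hb : Bounds P Ω SS w D M)
    {x y : E d} (hx : x ∈ SS) (hy : dist y x ≤ D / 2) {ε : ℝ} (hε : ε ∈ Ioc 0 (D / 2)) :
    ‖P.f y + P.B y (uEps P ρ ε y)‖ ≤ M + M * (P.β⁻¹ * (M * M)) := by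
  have hyD : dist y x ≤ D := hy.trans (by linarith [hb.D_pos])
  refine (norm_add_le _ _).trans (add_le_add (hb.f_le x hx y hyD) ?_)
  exact (ContinuousLinearMap.le_opNorm _ _).trans (mul_le_mul (hb.B_le x hx y hyD)
    (h.norm_uEps_le hb hx hy hε) (norm_nonneg _) hb.M_nonneg)

/-- The oscillation `|G(x) - G(z)| + β⁻¹ b |H(x) - H(z)|` with `G = ∇wᵀf` and `H = Bᵀ∇w`. -/
noncomputable def osc (P : ControlProblem d m) (w : E d → ℝ) (b : ℝ) (x z : E d) : ℝ :=
  |inner ℝ (gradient w x) (P.f x) - inner ℝ (gradient w z) (P.f z)| +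
    P.β⁻¹ * b * ‖P.Bt x (gradient w x) - P.Bt z (gradient w z)‖

lemma Bt_sub_Bt (P : ControlProblem d m) (x y p : E d) :
    P.Bt x p - P.Bt y p = ContinuousLinearMap.adjoint (P.B x - P.B y) p := by
  rw [map_sub]; rfl

/-- First bound for the drift of `w`: by averaging the viscosity inequality over the
`ε`-ball. -/
lemma Standing.drift_le_of_ball_subset (h : Standing P Ω ω δ w C ρ) (hb : Bounds P Ω SS w D M)
    {b : ℝ} (hbV : ∀ᵐ z : E d, z ∈ SS → ‖P.Bt z (gradient P.V z)‖ ≤ b) {ε s : ℝ}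
    (hε : ε ∈ Ioc 0 (D / 2)) {x : E d} (hball : Metric.ball x ε ⊆ SS)
    (hs : ∀ z ∈ Metric.ball x ε, osc P w b x z ≤ s) :
    inner ℝ (gradient w x) (P.f x + P.B x (uEps P ρ ε x)) ≤
      s + P.β⁻¹ * M ^ 4 * ε := by
  have hx : x ∈ SS := hball (Metric.mem_ball_self hε.1)
  have hβ := inv_nonneg.2 P.β_pos.le
  have hM := hb.M_nonneg
  have hD := hb.D_pos
  have hself : dist x x ≤ D / 2 := by rw [dist_self]; linarith
  have hxx : dist x x ≤ D := by rw [dist_self]; linarith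
  -- At a fixed x the drift is affine in the gradient of the value function, with linear part ⟨·,
  -- a⟩. It therefore commutes with the average defining ∇V_ε.
  set a : E d := -(P.β⁻¹ • P.B x (P.Bt x (gradient w x))) with ha
  have hlaw : ∀ q : E d, -(P.β⁻¹ * inner ℝ (P.Bt x (gradient w x)) (P.Bt x q)) = inner ℝ q a := by
    intro q
    rw [ha, inner_neg_right, inner_smul_right, real_inner_comm, P.inner_Bt]
  have hgV : ∀ z ∈ Metric.ball x ε, ‖gradient P.V z‖ ≤ M := fun z hz =>
    hb.gradV x hx z (dist_le_of_mem_closedBall hself hε.2 (Metric.ball_subset_closedBall hz))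
  have e1 : inner ℝ (gradient w x) (P.f x + P.B x (uEps P ρ ε x)) =
      inner ℝ (gradient w x) (P.f x) + mavg ρ ε (fun z => inner ℝ (gradient P.V z) a) x := by
    rw [uEps, ControlProblem.feedback, P.inner_law, sub_eq_add_neg, hlaw,
      h.gradient_mollify hb hx hself hε, h.mollifier.inner_mavg hε.1 (measurable_gradient _)
        (Eventually.of_forall hgV)]
  rw [e1]
  have hkey : mavg ρ ε (fun z => inner ℝ (gradient P.V z) a) x ≤
      s + P.β⁻¹ * M ^ 4 * ε - inner ℝ (gradient w x) (P.f x) := by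
    refine h.mollifier.mavg_le hε.1 (M := M * ‖a‖) ((measurable_gradient P.V).inner measurable_const)
      (Eventually.of_forall fun z hz => (norm_inner_le_norm _ _).trans ?_) ?_
    · exact mul_le_mul_of_nonneg_right (hgV z hz) (norm_nonneg _)
    filter_upwards [hbV, h.semiConcave.ae_differentiableAt h.isOpen] with z hz1 hz2 hz
    have hzS := hball hz
    have hvis := h.lyap.inner_le h.isOpen hzS (hz2 (omegaDelta_subset hzS))
    rw [ControlProblem.feedback, P.inner_law] at hvis
    have hosc := hs z hz
    rw [osc] at hosc
    have hzD : dist z x ≤ D := by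
      have := Metric.mem_ball.1 hz; linarith [hε.2]
    rw [← hlaw]
    set p := gradient P.V z
    set Hx := P.Bt x (gradient w x)
    set Hz := P.Bt z (gradient w z)
    -- The viscosity inequality holds at z, while the average is taken with the coefficients of x.
    -- The discrepancy consists of the oscillation of Bᵀ∇w and of B(z) − B(x) in front of the
    -- gradient; only the latter yields the extra M⁴ε.
    have t1 : inner ℝ Hz (P.Bt z p) - inner ℝ Hx (P.Bt x p) =
        -inner ℝ (Hx - Hz) (P.Bt z p) + inner ℝ Hx (P.Bt z p - P.Bt x p) := by
      rw [inner_sub_left, inner_sub_right]; ring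
    have t2 : -inner ℝ (Hx - Hz) (P.Bt z p) ≤ ‖Hx - Hz‖ * b :=
      (neg_le_abs _).trans ((abs_real_inner_le_norm _ _).trans
        (mul_le_mul_of_nonneg_left (hz1 hzS) (norm_nonneg _)))
    have t3 : inner ℝ Hx (P.Bt z p - P.Bt x p) ≤ M ^ 4 * ε := by
      refine (real_inner_le_norm _ _).trans ?_
      have h1 : ‖Hx‖ ≤ M * M := hb.norm_Bt_gradw_le hx hxx
      have h2 : ‖P.Bt z p - P.Bt x p‖ ≤ M * ε * M := by
        rw [Bt_sub_Bt]
        refine (ContinuousLinearMap.le_opNorm _ _).trans ?_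
        rw [LinearIsometryEquiv.norm_map]
        refine mul_le_mul ((hb.B_lip x hx z hzD).trans ?_) (hgV z hz) (norm_nonneg _)
          (mul_nonneg hM hε.1.le)
        exact mul_le_mul_of_nonneg_left (Metric.mem_ball.1 hz).le hM
      calc ‖Hx‖ * ‖P.Bt z p - P.Bt x p‖ ≤ (M * M) * (M * ε * M) :=
            mul_le_mul h1 h2 (norm_nonneg _) (by positivity)
        _ = _ := by ring
    have t4 : P.β⁻¹ * (inner ℝ Hz (P.Bt z p) - inner ℝ Hx (P.Bt x p)) ≤
        P.β⁻¹ * (‖Hx - Hz‖ * b + M ^ 4 * ε) :=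
      mul_le_mul_of_nonneg_left (by linarith) hβ
    have t5 := le_abs_self (inner ℝ (gradient w x) (P.f x) - inner ℝ (gradient w z) (P.f z))
    nlinarith
  linarith

/-- The feedback laws `u_ε` are Lipschitz near `S`, with a constant of polynomial growth in
`ε⁻¹`. -/
lemma Standing.exists_uEps_lipschitz (h : Standing P Ω ω δ w C ρ) (hb : Bounds P Ω SS w D M) :
    ∃ c ≥ 0, ∀ ε ∈ Ioc (0 : ℝ) (min 1 (D / 2)), ∀ x ∈ SS, ∀ z ∈ SS, dist z x ≤ D →
      ‖uEps P ρ ε x - uEps P ρ ε z‖ ≤ c * (ε⁻¹) ^ (d + 1) * dist z x := by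
  obtain ⟨c, hc0, hc⟩ := h.mollifier.exists_norm_mavg_sub_mavg_le hb.M_nonneg
  have hM := hb.M_nonneg
  have hβ := inv_nonneg.2 P.β_pos.le
  refine ⟨P.β⁻¹ * (M * M + M * c), by positivity, fun ε hε x hx z hz hzx => ?_⟩
  have hε1 : ε ∈ Ioc 0 (D / 2) := ⟨hε.1, hε.2.trans (min_le_right _ _)⟩
  have hε2 : ε ∈ Ioc (0 : ℝ) 1 := ⟨hε.1, hε.2.trans (min_le_left _ _)⟩
  have hself : ∀ x : E d, dist x x ≤ D / 2 := fun x => by rw [dist_self]; linarith [hb.D_pos]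
  have hselfD : ∀ x : E d, dist x x ≤ D := fun x => by rw [dist_self]; linarith [hb.D_pos]
  have hgV : ∀ x ∈ SS, ∀ z ∈ Metric.ball x ε, ‖gradient P.V z‖ ≤ M := fun x hx z hz =>
    hb.gradV x hx z (dist_le_of_mem_closedBall (hself x) hε1.2 (Metric.ball_subset_closedBall hz))
  have h1 := hc ε hε2 _ (measurable_gradient P.V) x z (hgV x hx) (hgV z hz)
  rw [← h.gradient_mollify hb hx (hself x) hε1, ← h.gradient_mollify hb hz (hself z) hε1] at h1
  set g := gradient (mollify ρ ε P.V)
  have e1 : uEps P ρ ε x - uEps P ρ ε z =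
      -(P.β⁻¹ • ((P.Bt x (g x) - P.Bt z (g x)) + P.Bt z (g x - g z))) := by
    have : P.Bt z (g x - g z) = P.Bt z (g x) - P.Bt z (g z) := map_sub _ _ _
    rw [this]
    simp only [uEps, ControlProblem.feedback]
    rw [sub_add_sub_cancel, smul_sub]
    abel
  have hpow : 1 ≤ (ε⁻¹) ^ (d + 1) := one_le_pow₀ ((one_le_inv₀ hε2.1).2 hε2.2)
  have t1 : ‖P.Bt x (g x) - P.Bt z (g x)‖ ≤ M * dist z x * M := by
    rw [Bt_sub_Bt]
    refine (ContinuousLinearMap.le_opNorm _ _).trans ?_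
    rw [LinearIsometryEquiv.norm_map, norm_sub_rev]
    exact mul_le_mul (hb.B_lip x hx z hzx) (h.norm_gradient_mollify_le hb hx (hself x) hε1)
      (norm_nonneg _) (mul_nonneg hM dist_nonneg)
  have t2 : ‖P.Bt z (g x - g z)‖ ≤ M * (c * (ε⁻¹) ^ (d + 1) * dist z x) := by
    rw [dist_comm, dist_eq_norm]
    exact (P.norm_Bt_le _ _).trans
      (mul_le_mul (hb.B_le z hz z (hselfD z)) h1 (norm_nonneg _) hM)
  rw [e1, norm_neg, norm_smul, Real.norm_of_nonneg hβ]
  have t3 : M * dist z x * M ≤ (ε⁻¹) ^ (d + 1) * (M * dist z x * M) :=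
    le_mul_of_one_le_left (by have := dist_nonneg (x := z) (y := x); positivity) hpow
  calc _ ≤ P.β⁻¹ * ((ε⁻¹) ^ (d + 1) * (M * dist z x * M) +
        M * (c * (ε⁻¹) ^ (d + 1) * dist z x)) := by
        gcongr
        exact (norm_add_le _ _).trans (add_le_add (t1.trans t3) t2)
    _ = _ := by ring

/-- Second bound for the drift of `w`: by comparison with a nearby point where `u_ε` and `u_V`
are close. -/
lemma Standing.exists_drift_le (h : Standing P Ω ω δ w C ρ) (hb : Bounds P Ω SS w D M) :
    ∃ c ≥ 0, ∀ b : ℝ, ∀ ε ∈ Ioc (0 : ℝ) (min 1 (D / 2)), ∀ x ∈ SS, ∀ z ∈ SS, ∀ r : ℝ,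
      dist z x ≤ r → r ≤ D → DifferentiableAt ℝ P.V z → ‖P.Bt z (gradient P.V z)‖ ≤ b →
      ‖uEps P ρ ε z - P.feedback P.V z‖ ≤ r →
      inner ℝ (gradient w x) (P.f x + P.B x (uEps P ρ ε x)) ≤
        osc P w b x z + c * r * (ε⁻¹) ^ (d + 1) := by
  obtain ⟨c, hc0, hc⟩ := h.exists_uEps_lipschitz hb
  have hM := hb.M_nonneg
  have hβ := inv_nonneg.2 P.β_pos.le
  refine ⟨M * M * (1 + c), by positivity, fun b ε hε x hx z hz r hzr hrD hd hbz hu => ?_⟩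
  have hε2 : ε ∈ Ioc (0 : ℝ) 1 := ⟨hε.1, hε.2.trans (min_le_left _ _)⟩
  have hpow : 1 ≤ (ε⁻¹) ^ (d + 1) := one_le_pow₀ ((one_le_inv₀ hε2.1).2 hε2.2)
  have hr0 : 0 ≤ r := dist_nonneg.trans hzr
  have hselfD : dist x x ≤ D := by rw [dist_self]; linarith [hb.D_pos]
  have hlip := hc ε hε x hx z hz (hzr.trans hrD)
  have hvis := h.lyap.inner_le h.isOpen hz hd
  rw [inner_add_right, ← P.inner_Bt] at hvis ⊢
  set Hx := P.Bt x (gradient w x)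
  set Hz := P.Bt z (gradient w z)
  set ux := uEps P ρ ε x
  set uz := uEps P ρ ε z
  set uV := P.feedback P.V z with huV
  -- The term at z is governed by the viscosity inequality. The other three measure the oscillation
  -- of Bᵀ∇w, the closeness of u_ε and u_V at z, and the Lipschitz variation of u_ε from z to x.
  have e1 : inner ℝ Hx ux = inner ℝ Hz uV + inner ℝ (Hx - Hz) uV + inner ℝ Hx (uz - uV) +
      inner ℝ Hx (ux - uz) := by
    simp only [inner_sub_left, inner_sub_right]; ring
  have hHx : ‖Hx‖ ≤ M * M := hb.norm_Bt_gradw_le hx hselfD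
  have t1 : inner ℝ (Hx - Hz) uV ≤ P.β⁻¹ * b * ‖Hx - Hz‖ := by
    refine (real_inner_le_norm _ _).trans ?_
    have : ‖uV‖ ≤ P.β⁻¹ * b := by
      rw [huV, ControlProblem.feedback, norm_neg, norm_smul, Real.norm_of_nonneg hβ]
      exact mul_le_mul_of_nonneg_left hbz hβ
    rw [mul_comm]
    exact mul_le_mul_of_nonneg_right this (norm_nonneg _)
  have t2 : inner ℝ Hx (uz - uV) ≤ M * M * r :=
    (real_inner_le_norm _ _).trans (mul_le_mul hHx hu (norm_nonneg _) (by positivity))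
  have t3 : inner ℝ Hx (ux - uz) ≤ M * M * (c * (ε⁻¹) ^ (d + 1) * r) :=
    (real_inner_le_norm _ _).trans (mul_le_mul hHx (hlip.trans (by gcongr)) (norm_nonneg _)
      (by positivity))
  have t4 : M * M * r ≤ M * M * r * (ε⁻¹) ^ (d + 1) := le_mul_of_one_le_right (by positivity) hpow
  have t5 := le_abs_self (inner ℝ (gradient w x) (P.f x) - inner ℝ (gradient w z) (P.f z))
  rw [osc, e1]
  calc _ ≤ |inner ℝ (gradient w x) (P.f x) - inner ℝ (gradient w z) (P.f z)| +
        P.β⁻¹ * b * ‖Hx - Hz‖ + (M * M * r * (ε⁻¹) ^ (d + 1) +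
          M * M * (c * (ε⁻¹) ^ (d + 1) * r)) := by linarith
    _ = _ := by ring

end

/-! ### The oscillation σ_ε and the feedback error. -/

lemma eLpNorm_top_lt_top_and_ae_le {d n : ℕ} {S : Set (E d)} (hS : MeasurableSet S)
    {g : E d → E n} {M : ℝ} (hg : ∀ x ∈ S, ‖g x‖ ≤ M) :
    eLpNorm g ∞ (volume.restrict S) < ⊤ ∧
      ∀ᵐ z : E d, z ∈ S → ‖g z‖ ≤ (eLpNorm g ∞ (volume.restrict S)).toReal := by
  have hlt : eLpNorm g ∞ (volume.restrict S) < ⊤ := by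
    rw [eLpNorm_exponent_top]
    refine eLpNormEssSup_lt_top_of_ae_bound (C := M) ?_
    rw [ae_restrict_iff' hS]
    exact Eventually.of_forall hg
  refine ⟨hlt, ?_⟩
  rw [← ae_restrict_iff' hS]
  filter_upwards [ae_le_eLpNormEssSup (f := g) (μ := volume.restrict S)] with z hz
  rw [eLpNorm_exponent_top] at hlt ⊢
  rw [← toReal_enorm]
  exact ENNReal.toReal_mono hlt.ne hz

section

variable {d m : ℕ} {P : ControlProblem d m} {Ω ω : Set (E d)} {δ : ℝ} {w : E d → ℝ}
  {C : ℝ} {ρ : E d → ℝ} {D M : ℝ}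

local notation "SS" => omegaDelta Ω ω w δ

/-- `‖Bᵀ∇V‖_{L^∞(S)}`. -/
noncomputable def supBt (P : ControlProblem d m) (S : Set (E d)) : ℝ :=
  (eLpNorm (fun y => P.Bt y (gradient P.V y)) ∞ (volume.restrict S)).toReal

/-- `σ¹_ε + β⁻¹ σ²_ε ‖Bᵀ∇V‖_{L^∞(S)}`. -/
noncomputable def sigmaSum (P : ControlProblem d m) (w : E d → ℝ) (S : Set (E d)) (ε : ℝ) : ℝ≥0∞ :=
  sigma1 P w 0 S ε + sigma2 P w S ε / ENNReal.ofReal P.β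
        * eLpNorm (fun y => P.Bt y (gradient P.V y)) ∞ (volume.restrict S)

lemma supBt_nonneg (P : ControlProblem d m) (S : Set (E d)) : 0 ≤ supBt P S :=
  ENNReal.toReal_nonneg

lemma osc_triangle (P : ControlProblem d m) (w : E d → ℝ) {b : ℝ} (hb : 0 ≤ b) (x y z : E d) :
    osc P w b x z ≤ osc P w b x y + osc P w b y z := by
  have h1 := abs_sub_le (inner ℝ (gradient w x) (P.f x)) (inner ℝ (gradient w y) (P.f y))
    (inner ℝ (gradient w z) (P.f z))
  have h2 := norm_sub_le_norm_sub_add_norm_sub (P.Bt x (gradient w x)) (P.Bt y (gradient w y))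
    (P.Bt z (gradient w z))
  have h3 : 0 ≤ P.β⁻¹ * b := mul_nonneg (inv_nonneg.2 P.β_pos.le) hb
  have h4 := mul_le_mul_of_nonneg_left h2 h3
  rw [osc, osc, osc]
  linarith

lemma Bounds.norm_Bt_gradV_le {S : Set (E d)} (hb : Bounds P Ω S w D M) {x : E d} (hx : x ∈ S) :
    ‖P.Bt x (gradient P.V x)‖ ≤ M * M := by
  have hxx : dist x x ≤ D := by rw [dist_self]; exact hb.D_pos.le
  exact (P.norm_Bt_le _ _).trans (mul_le_mul (hb.B_le x hx x hxx) (hb.gradV x hx x hxx)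
    (norm_nonneg _) hb.M_nonneg)

lemma Standing.eLpNorm_Bt_lt_top (h : Standing P Ω ω δ w C ρ) (hb : Bounds P Ω SS w D M) :
    eLpNorm (fun y => P.Bt y (gradient P.V y)) ∞ (volume.restrict SS) < ⊤ :=
  (eLpNorm_top_lt_top_and_ae_le h.isOpen_S.measurableSet fun _ hx => hb.norm_Bt_gradV_le hx).1

lemma Standing.ae_norm_Bt_le (h : Standing P Ω ω δ w C ρ) (hb : Bounds P Ω SS w D M) :
    ∀ᵐ z : E d, z ∈ SS → ‖P.Bt z (gradient P.V z)‖ ≤ supBt P SS :=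
  (eLpNorm_top_lt_top_and_ae_le h.isOpen_S.measurableSet fun _ hx => hb.norm_Bt_gradV_le hx).2

/-- If the two oscillations are bounded by `s₁` and `s₂`, so is `sigmaSum`. -/
lemma sigmaSum_le_of_le (P : ControlProblem d m) {S : Set (E d)}
    (hfin : eLpNorm (fun y => P.Bt y (gradient P.V y)) ∞ (volume.restrict S) < ⊤)
    {ε s : ℝ} (hs : 0 ≤ s)
    (h1 : ∀ x ∈ S, ∀ y ∈ Metric.ball x ε,
      |inner ℝ (gradient w x) (P.f x) - inner ℝ (gradient w y) (P.f y)| ≤ s)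
    (h2 : ∀ x ∈ S, ∀ y ∈ Metric.ball x ε,
      ‖P.Bt x (gradient w x) - P.Bt y (gradient w y)‖ ≤ s) :
    sigmaSum P w S ε ≤ ENNReal.ofReal (s * (1 + P.β⁻¹ * supBt P S)) := by
  have e1 : sigma1 P w 0 S ε ≤ ENNReal.ofReal s := by
    refine iSup₂_le fun x hx => iSup₂_le fun y hy => ENNReal.ofReal_le_ofReal ?_
    have := h1 x hx y hy
    rwa [Pi.zero_apply, zero_sub, neg_add_eq_sub]
  have e2 : sigma2 P w S ε ≤ ENNReal.ofReal s :=
    iSup₂_le fun x hx => iSup₂_le fun y hy => ENNReal.ofReal_le_ofReal (h2 x hx y hy)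
  have hβ := P.β_pos
  have hb := supBt_nonneg P S
  rw [sigmaSum, ← ENNReal.ofReal_toReal hfin.ne]
  calc _ ≤ ENNReal.ofReal s + ENNReal.ofReal s / ENNReal.ofReal P.β * ENNReal.ofReal (supBt P S) := by
        rw [supBt]; gcongr
    _ = _ := by
      rw [← ENNReal.ofReal_div_of_pos hβ, ← ENNReal.ofReal_mul (by positivity),
        ← ENNReal.ofReal_add hs (by positivity)]
      congr 1
      ring

lemma Standing.sigmaSum_lt_top (h : Standing P Ω ω δ w C ρ) (hb : Bounds P Ω SS w D M) {ε : ℝ}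
    (hε : ε ≤ D) : sigmaSum P w SS ε < ⊤ := by
  have hM := hb.M_nonneg
  have hself : ∀ x : E d, dist x x ≤ D := fun x => by rw [dist_self]; exact hb.D_pos.le
  refine (sigmaSum_le_of_le P (h.eLpNorm_Bt_lt_top hb) (s := M * M + M * M) (by positivity)
    ?_ ?_).trans_lt ENNReal.ofReal_lt_top
  · intro x hx y hy
    have key : ∀ z, dist z x ≤ D → |inner ℝ (gradient w z) (P.f z)| ≤ M * M := fun z hz =>
      (abs_real_inner_le_norm _ _).trans (mul_le_mul (hb.gradw x hx z hz) (hb.f_le x hx z hz)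
        (norm_nonneg _) hM)
    exact (abs_sub _ _).trans (add_le_add (key x (hself x)) (key y (hy.le.trans hε)))
  · intro x hx y hy
    exact (norm_sub_le _ _).trans (add_le_add (hb.norm_Bt_gradw_le hx (hself x))
      (hb.norm_Bt_gradw_le hx (hy.le.trans hε)))

lemma Standing.osc_le_sigmaSum (h : Standing P Ω ω δ w C ρ) (hb : Bounds P Ω SS w D M) {ε : ℝ}
    (hε : ε ≤ D) {x z : E d} (hx : x ∈ SS) (hz : z ∈ Metric.ball x ε) :
    osc P w (supBt P SS) x z ≤ (sigmaSum P w SS ε).toReal := by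
  have hβ := P.β_pos
  have hs := supBt_nonneg P SS
  rw [← ENNReal.ofReal_le_iff_le_toReal (h.sigmaSum_lt_top hb hε).ne, osc,
    ENNReal.ofReal_add (abs_nonneg _) (by positivity), sigmaSum]
  refine add_le_add ?_ ?_
  · refine le_trans ?_ (le_iSup₂_of_le x hx (le_iSup₂_of_le z hz le_rfl))
    rw [Pi.zero_apply, zero_sub, neg_add_eq_sub]
  · have e2 : ENNReal.ofReal ‖P.Bt x (gradient w x) - P.Bt z (gradient w z)‖ ≤ sigma2 P w SS ε :=
      le_iSup₂_of_le x hx (le_iSup₂_of_le z hz le_rfl)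
    rw [← ENNReal.ofReal_toReal (h.eLpNorm_Bt_lt_top hb).ne]
    calc _ = ENNReal.ofReal ‖P.Bt x (gradient w x) - P.Bt z (gradient w z)‖ / ENNReal.ofReal P.β *
          ENNReal.ofReal (supBt P SS) := by
          rw [← ENNReal.ofReal_div_of_pos hβ, ← ENNReal.ofReal_mul (by positivity)]
          congr 1
          field_simp
      _ ≤ _ := by rw [supBt]; gcongr

/-- ∇wᵀf and Bᵀ∇w are continuous at each point of the compact closure of ω_δ, hence uniformly so
with the second point free in a neighbourhood. -/
lemma Standing.tendsto_sigmaSum (h : Standing P Ω ω δ w C ρ) (hb : Bounds P Ω SS w D M) :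
    Tendsto (sigmaSum P w SS) (𝓝[>] 0) (𝓝 0) := by
  have hcomp : IsCompact (closure SS) :=
    Metric.isCompact_of_isClosed_isBounded isClosed_closure
      (h.bounded.subset omegaDelta_subset).closure
  have hgw : ContinuousOn (gradient w) Ω := continuousOn_gradient h.isOpen h.lyap.w_C1
  have hG : ∀ x ∈ closure SS, ContinuousAt (fun x => inner ℝ (gradient w x) (P.f x)) x :=
    fun x hx => ((hgw.continuousAt (h.isOpen.mem_nhds (h.lyap.subset' hx))).inner
      P.f_lip.continuous.continuousAt)
  have hH : ∀ x ∈ closure SS, ContinuousAt (fun x => P.Bt x (gradient w x)) x := by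
    intro x hx
    have h1 := hgw.continuousAt (h.isOpen.mem_nhds (h.lyap.subset' hx))
    have h2 : ContinuousAt (fun x => ContinuousLinearMap.adjoint (P.B x)) x :=
      (ContinuousLinearMap.adjoint.continuous.comp P.B_lip.continuous).continuousAt
    exact h2.clm_apply h1
  have key : ∀ η > 0, ∀ᶠ ε in 𝓝[>] (0 : ℝ), sigmaSum P w SS ε ≤
      ENNReal.ofReal (η * (1 + P.β⁻¹ * supBt P SS)) := by
    intro η hη
    have u1 := hcomp.uniformContinuousAt_of_continuousAt _ hG (Metric.dist_mem_uniformity hη)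
    have u2 := hcomp.uniformContinuousAt_of_continuousAt _ hH (Metric.dist_mem_uniformity hη)
    obtain ⟨r, hr, hr'⟩ := Metric.mem_uniformity_dist.1 (inter_mem u1 u2)
    filter_upwards [Ioo_mem_nhdsGT hr] with ε hε
    refine sigmaSum_le_of_le P (h.eLpNorm_Bt_lt_top hb) hη.le ?_ ?_
    · intro x hx y hy
      rw [← Real.dist_eq]
      exact ((hr' ((Metric.mem_ball'.1 hy).trans hε.2)).1 (subset_closure hx)).le
    · intro x hx y hy
      rw [← dist_eq_norm]
      exact ((hr' ((Metric.mem_ball'.1 hy).trans hε.2)).2 (subset_closure hx)).le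
  have hpos : 0 < 1 + P.β⁻¹ * supBt P SS := by
    have := P.β_pos
    have := supBt_nonneg P SS
    positivity
  rw [ENNReal.tendsto_nhds_zero]
  intro a ha
  rcases eq_or_ne a ⊤ with rfl | hatop
  · exact Eventually.of_forall fun _ => le_top
  have ha' := ENNReal.toReal_pos ha.ne' hatop
  filter_upwards [key _ (div_pos ha' hpos)] with ε hε
  rwa [div_mul_cancel₀ _ hpos.ne', ENNReal.ofReal_toReal hatop] at hε

lemma tauEps_eq (P : ControlProblem d m) (S : Set (E d)) (p : ℝ) (κ : ℝ → ℝ) (ε : ℝ) :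
    tauEps P ρ w S δ p κ ε =
      min (ENNReal.ofReal δ / sigmaSum P w S ε) (kappaExt κ (uErr P ρ S (2 * p) ε)) := rfl

/-- What the first entry of the minimum defining τ_ε is for: a drift of size σ_ε raises w by at most
δ up to time T. -/
lemma Standing.mul_sigmaSum_le (h : Standing P Ω ω δ w C ρ) (hb : Bounds P Ω SS w D M) {ε : ℝ}
    (hε : ε ≤ D) {p T : ℝ} {κ : ℝ → ℝ} (hT : 0 < T)
    (hTτ : ENNReal.ofReal T ≤ tauEps P ρ w SS δ p κ ε) :
    T * (sigmaSum P w SS ε).toReal ≤ δ := by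
  rw [tauEps_eq] at hTτ
  have h1 := ENNReal.mul_le_of_le_div (hTτ.trans (min_le_left _ _))
  rw [← ENNReal.ofReal_toReal (h.sigmaSum_lt_top hb hε).ne, ← ENNReal.ofReal_mul hT.le,
    ENNReal.ofReal_le_ofReal_iff h.lyap.δ_pos.le] at h1
  exact h1

/-- The oscillation is Lipschitz when `sigmaSum` is frequently of the order of `ε`. -/
lemma Standing.osc_le_of_frequently (h : Standing P Ω ω δ w C ρ) (hb : Bounds P Ω SS w D M)
    {Λ : ℝ} (hΛ : ∃ᶠ ε in 𝓝[>] (0 : ℝ), (sigmaSum P w SS ε).toReal ≤ Λ * ε) {x : E d} {r : ℝ}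
    (hball : Metric.ball x r ⊆ SS) {z : E d} (hz : z ∈ Metric.ball x r) :
    osc P w (supBt P SS) x z ≤ Λ * dist z x := by
  have hs := supBt_nonneg P SS
  set L := dist z x
  have hL : 0 ≤ L := dist_nonneg
  have hr : 0 < r := hL.trans_lt hz
  have key : ∀ ε > 0, ε ≤ D → (sigmaSum P w SS ε).toReal ≤ Λ * ε →
      osc P w (supBt P SS) x z ≤ Λ * (L + ε) := by
    intro ε hε hεD hle
    have hΛ0 : 0 ≤ Λ * ε := ENNReal.toReal_nonneg.trans hle
    have hΛ0' : 0 ≤ Λ := nonneg_of_mul_nonneg_left hΛ0 hε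
    -- Chaining along the segment: N > L/ε makes consecutive points closer than ε, as the open balls
    -- in σ_ε require. The N ≤ L/ε + 1 steps cost at most Λε each, in total Λ(L + ε); then ε → 0
    -- along the good values.
    set N := ⌊L / ε⌋₊ + 1 with hN
    have hN0 : (0 : ℝ) < N := by rw [hN]; positivity
    have hNlt : L / ε < N := by rw [hN]; exact_mod_cast Nat.lt_floor_add_one (L / ε)
    have hNle : (N : ℝ) ≤ L / ε + 1 := by
      rw [hN]; push_cast
      linarith [Nat.floor_le (div_nonneg hL hε.le)]
    set q : ℕ → E d := fun k => x + ((k : ℝ) / N) • (z - x) with hq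
    have hqS : ∀ k ≤ N, q k ∈ SS := by
      intro k hk
      refine hball ?_
      rw [Metric.mem_ball, dist_eq_norm, hq]
      simp only [add_sub_cancel_left]
      rw [norm_smul, Real.norm_of_nonneg (by positivity), ← dist_eq_norm]
      have hk1 : (k : ℝ) / N ≤ 1 := by
        rw [div_le_one hN0]; exact_mod_cast hk
      exact (mul_le_of_le_one_left hL hk1).trans_lt hz
    have hstep : ∀ k, q (k + 1) ∈ Metric.ball (q k) ε := by
      intro k
      have : q (k + 1) - q k = ((1 : ℝ) / N) • (z - x) := by
        simp only [hq]
        push_cast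
        rw [add_sub_add_left_eq_sub, ← sub_smul]
        congr 1
        field_simp
        ring
      rw [Metric.mem_ball, dist_eq_norm, this, norm_smul, Real.norm_of_nonneg (by positivity),
        ← dist_eq_norm]
      change 1 / (N : ℝ) * L < ε
      rw [div_lt_iff₀ hε] at hNlt
      rw [one_div, inv_mul_lt_iff₀ hN0]
      linarith
    have hind : ∀ k ≤ N, osc P w (supBt P SS) x (q k) ≤ k * (Λ * ε) := by
      intro k
      induction k with
      | zero =>
        intro _
        have : q 0 = x := by simp [hq]
        rw [this, osc]
        simp
      | succ k ih =>
        intro hk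
        have h1 := osc_triangle P w hs x (q k) (q (k + 1))
        have h2 := h.osc_le_sigmaSum hb hεD (hqS k (by omega)) (hstep k)
        have h3 := ih (by omega)
        push_cast
        linarith
    have hqN : q N = z := by
      simp only [hq]
      rw [div_self hN0.ne', one_smul, add_sub_cancel]
    have h1 := hind N le_rfl
    rw [hqN] at h1
    refine h1.trans ?_
    calc (N : ℝ) * (Λ * ε) ≤ (L / ε + 1) * (Λ * ε) := by gcongr
      _ = _ := by field_simp
  by_contra! hcon
  have hcont : Tendsto (fun ε : ℝ => Λ * (L + ε)) (𝓝[>] 0) (𝓝 (Λ * L)) := by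
    have : Continuous fun ε : ℝ => Λ * (L + ε) := by fun_prop
    have h2 := this.tendsto 0
    rw [add_zero] at h2
    exact h2.mono_left nhdsWithin_le_nhds
  obtain ⟨ε, h1, h2, h3⟩ := (hΛ.and_eventually ((hcont.eventually_lt_const hcon).and
    (Ioo_mem_nhdsGT hb.D_pos))).exists
  exact absurd (key ε h3.1 h3.2.le h1) (not_le.2 h2)

lemma Standing.norm_uEps_sub_le (h : Standing P Ω ω δ w C ρ) (hb : Bounds P Ω SS w D M)
    {ε : ℝ} (hε : ε ∈ Ioc 0 (D / 2)) {x : E d} (hx : x ∈ SS) :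
    ‖uEps P ρ ε x - P.feedback P.V x‖ ≤ P.β⁻¹ * (M * M) + P.β⁻¹ * (M * M) := by
  have hself : ∀ r : ℝ, 0 < r → dist x x ≤ r := fun r hr => by rw [dist_self]; exact hr.le
  exact (norm_sub_le _ _).trans (add_le_add
    (h.norm_uEps_le hb hx (hself _ (half_pos hb.D_pos)) hε)
    (hb.norm_feedback_le hx (hself _ hb.D_pos)))

lemma measurable_uEps_sub (P : ControlProblem d m) (ε : ℝ) :
    Measurable fun y => uEps P ρ ε y - P.feedback P.V y := by
  have key : ∀ v : E d → ℝ, Measurable (P.feedback v) := by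
    intro v
    have h0 : Measurable fun y => (y, gradient v y) := measurable_id.prodMk (measurable_gradient v)
    have h1 : Measurable fun y => P.Bt y (gradient v y) :=
      Measurable.comp (g := fun z : E d × E d => P.Bt z.1 z.2)
        (f := fun y => (y, gradient v y)) P.continuous_Bt.measurable h0
    have h2 : Continuous fun q : E m => -(P.β⁻¹ • q) := by fun_prop
    exact h2.measurable.comp h1
  have h1 : Measurable (uEps P ρ ε) := key _
  exact h1.sub (key _)

lemma Standing.eLpNorm_uEps_sub_lt_top (h : Standing P Ω ω δ w C ρ) (hb : Bounds P Ω SS w D M)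
    {ε : ℝ} (hε : ε ∈ Ioc 0 (D / 2)) (q : ℝ≥0∞) :
    eLpNorm (fun y => uEps P ρ ε y - P.feedback P.V y) q (volume.restrict SS) < ⊤ := by
  have : IsFiniteMeasure (volume.restrict SS) :=
    ⟨by rw [Measure.restrict_apply_univ]; exact h.volume_S_lt_top⟩
  refine (MemLp.of_bound (measurable_uEps_sub P ε).aestronglyMeasurable
    (P.β⁻¹ * (M * M) + P.β⁻¹ * (M * M)) ?_).2
  rw [ae_restrict_iff' h.isOpen_S.measurableSet]
  exact Eventually.of_forall fun x hx => h.norm_uEps_sub_le hb hε hx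

/-- Balls of not too small radius contain points where `u_ε` and `u_V` are close. -/
lemma Standing.exists_mem_ball_norm_sub_le (h : Standing P Ω ω δ w C ρ)
    (hb : Bounds P Ω SS w D M) {ε : ℝ} (hε : ε ∈ Ioc 0 (D / 2)) {p : ℝ} (hp : 1 ≤ p) {x : E d}
    {r : ℝ} (hr : 0 < r) (hball : Metric.ball x r ⊆ SS)
    (herr : uErr P ρ SS (2 * p) ε ^ (2 * p) <
      r ^ (2 * p) * (r ^ d * (volume (Metric.ball (0 : E d) 1)).toReal)) :
    ∃ z ∈ Metric.ball x r, DifferentiableAt ℝ P.V z ∧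
      ‖P.Bt z (gradient P.V z)‖ ≤ supBt P SS ∧
      ‖uEps P ρ ε z - P.feedback P.V z‖ ≤ r := by
  by_contra! hcon
  have hp0 : 0 < 2 * p := by linarith
  set g := fun y => uEps P ρ ε y - P.feedback P.V y with hg
  have hae : ∀ᵐ z : E d, z ∈ Metric.ball x r → r ≤ ‖g z‖ := by
    filter_upwards [h.ae_norm_Bt_le hb, h.semiConcave.ae_differentiableAt h.isOpen] with z h1 h2 hz
    have hzS := hball hz
    exact (hcon z hz (h2 hzS.1) (h1 hzS)).le
  -- Markov: if the error were at least r almost everywhere in the ball, its 2p-th moment would be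
  -- at least r^{2p} times the volume of the ball.
  have hmark := mul_meas_ge_le_pow_eLpNorm' (volume.restrict SS) (f := g)
    (p := ENNReal.ofReal (2 * p)) (by simpa using hp0) ENNReal.ofReal_ne_top
    (measurable_uEps_sub P ε).aestronglyMeasurable (ENNReal.ofReal r)
  rw [ENNReal.toReal_ofReal hp0.le] at hmark
  have hle : volume (Metric.ball x r) ≤
      volume.restrict SS {y | ENNReal.ofReal r ≤ ‖g y‖ₑ} := by
    have : volume (Metric.ball x r) = volume.restrict SS (Metric.ball x r) := by
      rw [Measure.restrict_apply measurableSet_ball, inter_eq_self_of_subset_left hball]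
    rw [this]
    refine measure_mono_ae (ae_restrict_of_ae ?_)
    filter_upwards [hae] with z hz hzb
    change ENNReal.ofReal r ≤ ‖g z‖ₑ
    rw [← ofReal_norm]
    exact ENNReal.ofReal_le_ofReal (hz hzb)
  have hfin := h.eLpNorm_uEps_sub_lt_top hb hε (ENNReal.ofReal (2 * p))
  have hfinb : volume (Metric.ball (0 : E d) 1) ≠ ⊤ := Metric.isBounded_ball.measure_lt_top.ne
  have h3 : ENNReal.ofReal (r ^ (2 * p) * (r ^ d * (volume (Metric.ball (0 : E d) 1)).toReal)) ≤
      ENNReal.ofReal (uErr P ρ SS (2 * p) ε ^ (2 * p)) := by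
    rw [uErr, ← ENNReal.ofReal_rpow_of_nonneg ENNReal.toReal_nonneg hp0.le,
      ENNReal.ofReal_toReal hfin.ne, ENNReal.ofReal_mul (by positivity),
      ENNReal.ofReal_mul (by positivity), ENNReal.ofReal_toReal hfinb,
      ← ENNReal.ofReal_rpow_of_nonneg hr.le hp0.le]
    refine le_trans ?_ hmark
    have hvol : volume (Metric.ball x r) = ENNReal.ofReal (r ^ d) * volume (Metric.ball (0 : E d) 1) := by
      rw [Measure.addHaar_ball_of_pos _ _ hr, finrank_euclideanSpace_fin]
    rw [← hvol]
    gcongr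
  have hnn : 0 ≤ uErr P ρ SS (2 * p) ε := ENNReal.toReal_nonneg
  exact absurd herr (not_lt.2 ((ENNReal.ofReal_le_ofReal_iff (Real.rpow_nonneg hnn _)).1 h3))

lemma Standing.ae_tendsto_uEps (h : Standing P Ω ω δ w C ρ) :
    ∀ᵐ x : E d, x ∈ Ω → Tendsto (fun ε => uEps P ρ ε x) (𝓝[>] 0) (𝓝 (P.feedback P.V x)) := by
  filter_upwards [h.semiConcave.ae_differentiableAt h.isOpen] with x hx hxΩ
  have h1 := h.semiConcave.tendsto_gradient_mollify h.mollifier h.isOpen h.cont hxΩ (hx hxΩ)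
  have h2 : Continuous fun q : E d => -(P.β⁻¹ • P.Bt x q) :=
    continuous_neg.comp
      ((ContinuousLinearMap.adjoint (P.B x)).continuous.const_smul P.β⁻¹)
  exact (h2.tendsto _).comp h1

/-- Dominated convergence: the gradients converge wherever V is differentiable, and both feedback
laws are bounded on ω_δ uniformly in ε. -/
lemma Standing.tendsto_uErr (h : Standing P Ω ω δ w C ρ) (hb : Bounds P Ω SS w D M) {q : ℝ}
    (hq : 0 < q) : Tendsto (uErr P ρ SS q) (𝓝[>] 0) (𝓝 0) := by
  have : IsFiniteMeasure (volume.restrict SS) :=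
    ⟨by rw [Measure.restrict_apply_univ]; exact h.volume_S_lt_top⟩
  have hM := hb.M_nonneg
  set c := P.β⁻¹ * (M * M) + P.β⁻¹ * (M * M)
  have key : Tendsto (fun ε => ∫⁻ y in SS, ‖uEps P ρ ε y - P.feedback P.V y‖ₑ ^ q) (𝓝[>] 0)
      (𝓝 (∫⁻ _ in SS, 0)) := by
    refine tendsto_lintegral_filter_of_dominated_convergence (fun _ => ENNReal.ofReal c ^ q)
      (Eventually.of_forall fun ε => ((measurable_uEps_sub P ε).enorm.pow_const q)) ?_ ?_ ?_
    · filter_upwards [Ioc_mem_nhdsGT (half_pos hb.D_pos)] with ε hε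
      rw [ae_restrict_iff' h.isOpen_S.measurableSet]
      refine Eventually.of_forall fun x hx => ?_
      rw [← ofReal_norm]
      gcongr
      exact h.norm_uEps_sub_le hb hε hx
    · rw [lintegral_const]
      exact ENNReal.mul_ne_top (ENNReal.rpow_ne_top_of_nonneg hq.le ENNReal.ofReal_ne_top)
        (measure_ne_top _ _)
    · rw [ae_restrict_iff' h.isOpen_S.measurableSet]
      filter_upwards [h.ae_tendsto_uEps] with x hx hxS
      have h1 : Tendsto (fun ε => uEps P ρ ε x - P.feedback P.V x) (𝓝[>] 0) (𝓝 0) := by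
        simpa using (hx hxS.1).sub_const (P.feedback P.V x)
      have h2 := (ENNReal.continuous_rpow_const (y := q)).tendsto _ |>.comp
        ((continuous_enorm.tendsto _).comp h1)
      rwa [enorm_zero, ENNReal.zero_rpow_of_pos hq] at h2
  rw [lintegral_zero] at key
  have h2 := ((ENNReal.continuous_rpow_const (y := 1 / q)).tendsto _).comp key
  rw [ENNReal.zero_rpow_of_pos (by positivity)] at h2
  have h3 := (ENNReal.tendsto_toReal ENNReal.zero_ne_top).comp h2
  refine h3.congr fun ε => ?_
  simp only [Function.comp_apply, uErr]
  rw [eLpNorm_eq_lintegral_rpow_enorm_toReal (by simpa using hq) ENNReal.ofReal_ne_top,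
    ENNReal.toReal_ofReal hq.le]

end

/-! ### Exponential decay of the feedback error, and trapping by sublevels of w. -/

/-- The growth condition on `κ` makes `s ^ (2p)` exponentially small in `κ s`. -/
lemma eventually_rpow_le_exp {κ : ℝ → ℝ} {p K : ℝ} (hp : 1 ≤ p) (hK : 0 < K)
    (hκtop : Tendsto κ (𝓝[>] 0) atTop)
    (hκ : Tendsto (fun s => κ s ^ ((p - 1) / p) * (Real.exp (K * κ s) - 1) ^ (1 / p) * s ^ 2)
      (𝓝[>] 0) (𝓝 0)) :
    ∀ᶠ s in 𝓝[>] (0 : ℝ), ∀ T ≤ κ s, s ^ (2 * p) ≤ 2 * Real.exp (-(K * T)) := by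
  have hp0 : 0 < p := by linarith
  filter_upwards [hκtop.eventually_ge_atTop 1, hκtop.eventually_ge_atTop (Real.log 2 / K),
    hκ.eventually_le_const zero_lt_one, self_mem_nhdsWithin] with s h1 h2 h3 hs T hT
  have hs0 : (0 : ℝ) < s := hs
  -- Once e^{Kκ} ≥ 2 one has e^{Kκ} ≤ 2(e^{Kκ} − 1), the source of the factor 2.
  have hexp2 : 2 ≤ Real.exp (K * κ s) := by
    rw [← Real.log_le_iff_le_exp two_pos]
    rw [div_le_iff₀ hK] at h2
    linarith
  set a := Real.exp (K * κ s) - 1 with ha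
  have ha0 : 0 < a := by linarith
  have hk : 1 ≤ κ s ^ ((p - 1) / p) := Real.one_le_rpow h1 (div_nonneg (by linarith) hp0.le)
  have h4 : a ^ (1 / p) * s ^ 2 ≤ 1 := by
    refine le_trans ?_ h3
    rw [mul_assoc]
    exact le_mul_of_one_le_left (by positivity) hk
  have h5 : (a ^ (1 / p) * s ^ 2) ^ p ≤ 1 := Real.rpow_le_one (by positivity) h4 hp0.le
  rw [Real.mul_rpow (by positivity) (by positivity), ← Real.rpow_mul ha0.le, one_div,
    inv_mul_cancel₀ hp0.ne', Real.rpow_one, ← Real.rpow_natCast s 2, ← Real.rpow_mul hs0.le] at h5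
  push_cast at h5
  have h6 : Real.exp (K * T) ≤ Real.exp (K * κ s) := Real.exp_le_exp.2 (by gcongr)
  have h7 : 0 < s ^ (2 * p) := by positivity
  rw [Real.exp_neg, ← div_eq_mul_inv, le_div_iff₀ (Real.exp_pos _)]
  calc s ^ (2 * p) * Real.exp (K * T) ≤ s ^ (2 * p) * (2 * a) := by
        gcongr; linarith
    _ ≤ 2 := by linarith

section

variable {d m : ℕ} {P : ControlProblem d m} {Ω ω : Set (E d)} {δ : ℝ} {w : E d → ℝ}
  {C : ℝ} {ρ : E d → ℝ} {D M : ℝ}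

local notation "SS" => omegaDelta Ω ω w δ

lemma lipNorm_nonneg {ι : Type} (A : Set (E d)) (F : E d → ι → ℝ) : 0 ≤ lipNorm A F :=
  add_nonneg (Real.sSup_nonneg (by rintro _ ⟨x, _, y, _, k, rfl⟩; positivity))
    (supNorm_nonneg A F)

lemma constK_nonneg (P : ControlProblem d m) (Ω S : Set (E d)) (hC : 0 ≤ C) :
    0 ≤ constK P Ω S C := by
  have := P.β_pos
  have := lipNorm_nonneg S P.entry
  have := lipNorm_nonneg (closure Ω) fun x i => P.f x i
  rw [constK]
  positivity

lemma abs_entry_le (P : ControlProblem d m) (x : E d) (k : Fin d × Fin m) :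
    |P.entry x k| ≤ ‖P.B x‖ := by
  refine (abs_apply_le_norm _ _).trans ((ContinuousLinearMap.le_opNorm _ _).trans ?_)
  simp

/-- K is a sum of nonnegative terms, one of which is a multiple of C‖B‖² with C > 0. When K = 0 the
growth condition on κ carries no information, but then the feedbacks vanish on ω_δ and there is no
error to control. -/
lemma Standing.B_eq_zero (h : Standing P Ω ω δ w C ρ) (hb : Bounds P Ω SS w D M)
    (hK : constK P Ω SS C = 0) {x : E d} (hx : x ∈ SS) : P.B x = 0 := by
  have hβ := P.β_pos
  have hC := h.C_pos
  have h1 := lipNorm_nonneg SS P.entry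
  have h2 := lipNorm_nonneg (closure Ω) fun x i => P.f x i
  have hs := supNorm_nonneg SS P.entry
  have hle : ∀ k, |P.entry x k| ≤ supNorm SS P.entry := fun k =>
    abs_le_supNorm (fun y hy k => (abs_entry_le P y k).trans
      (hb.B_le y hy y (by rw [dist_self]; exact hb.D_pos.le))) hx k
  have h3 : (m : ℝ) * d * C * supNorm SS P.entry ^ 2 = 0 := by
    have t1 : 0 ≤ (m : ℝ) * d * C * supNorm SS P.entry ^ 2 := by positivity
    have t2 : 0 ≤ (m : ℝ) * d ^ 2 * lipNorm SS P.entry ^ 2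
        * (eLpNorm (gradient P.V) ∞ (volume.restrict SS)).toReal := by positivity
    have t3 : 0 ≤ (d : ℝ) * lipNorm (closure Ω) fun x i => P.f x i := by positivity
    have hβ1 : 0 < 1 / P.β := by positivity
    rw [constK] at hK
    have t4 : 1 / P.β * ((m : ℝ) * d * C * supNorm SS P.entry ^ 2 + m * d ^ 2 *
        lipNorm SS P.entry ^ 2 * (eLpNorm (gradient P.V) ∞ (volume.restrict SS)).toReal) = 0 :=
      le_antisymm (by linarith) (by positivity)
    have t5 := (mul_eq_zero.1 t4).resolve_left hβ1.ne'
    linarith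
  have hz : ∀ k, P.entry x k = 0 := by
    intro k
    have hm : (m : ℝ) ≠ 0 := by
      have := k.2.pos
      positivity
    have hd : (d : ℝ) ≠ 0 := by
      have := k.1.pos
      positivity
    have hs0 : supNorm SS P.entry = 0 := by
      simpa [hm, hd, hC.ne'] using h3
    have := hle k
    rw [hs0] at this
    exact abs_nonpos_iff.1 this
  have hlin : (P.B x).toLinearMap = 0 := by
    refine (EuclideanSpace.basisFun (Fin m) ℝ).toBasis.ext fun j => ?_
    ext i
    simpa [ControlProblem.entry] using hz (i, j)
  ext1 u
  exact LinearMap.congr_fun hlin u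

lemma Standing.uErr_eq_zero (h : Standing P Ω ω δ w C ρ) (hb : Bounds P Ω SS w D M)
    (hK : constK P Ω SS C = 0) (q ε : ℝ) : uErr P ρ SS q ε = 0 := by
  have : ∀ v : E d → ℝ, ∀ x ∈ SS, P.feedback v x = 0 := by
    intro v x hx
    rw [ControlProblem.feedback, ControlProblem.Bt, h.B_eq_zero hb hK hx, map_zero]
    simp
  have h1 : (fun y => uEps P ρ ε y - P.feedback P.V y) =ᵐ[volume.restrict SS] 0 := by
    filter_upwards [ae_restrict_mem h.isOpen_S.measurableSet] with x hx
    rw [uEps, this _ x hx, this _ x hx, sub_zero, Pi.zero_apply]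
  rw [uErr, eLpNorm_congr_ae h1, eLpNorm_zero, ENNReal.toReal_zero]

lemma uErr_nonneg (P : ControlProblem d m) (S : Set (E d)) (q ε : ℝ) : 0 ≤ uErr P ρ S q ε :=
  ENNReal.toReal_nonneg

/-- Up to the horizon `τ_ε`, the error of the feedback law is exponentially small in time. -/
lemma Standing.exists_uErr_le_exp (h : Standing P Ω ω δ w C ρ) (hb : Bounds P Ω SS w D M)
    {κ : ℝ → ℝ} {p : ℝ} (hp : 1 ≤ p) (hκtop : Tendsto κ (𝓝[>] 0) atTop)
    (hκ : Tendsto (fun s => κ s ^ ((p - 1) / p)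
        * (Real.exp (constK P Ω SS C * κ s) - 1) ^ (1 / p) * s ^ 2) (𝓝[>] 0) (𝓝 0)) :
    ∃ K₁ > 0, ∀ᶠ ε in 𝓝[>] (0 : ℝ), ∀ T, ENNReal.ofReal T ≤ tauEps P ρ w SS δ p κ ε →
      uErr P ρ SS (2 * p) ε ^ (2 * p) ≤ 2 * Real.exp (-(K₁ * T)) := by
  have hp0 : 0 < 2 * p := by linarith
  rcases (constK_nonneg P Ω SS h.C_pos.le).eq_or_lt with hK | hK
  · refine ⟨1, one_pos, Eventually.of_forall fun ε T _ => ?_⟩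
    rw [h.uErr_eq_zero hb hK.symm, Real.zero_rpow hp0.ne']
    positivity
  refine ⟨_, hK, ?_⟩
  have h1 := (eventually_rpow_le_exp hp hK hκtop hκ).and (hκtop.eventually_ge_atTop 0)
  rw [eventually_nhdsWithin_iff] at h1
  filter_upwards [(h.tendsto_uErr hb hp0).eventually h1] with ε hε T hT
  rcases (uErr_nonneg (ρ := ρ) P SS (2 * p) ε).eq_or_lt with h0 | h0
  · rw [← h0, Real.zero_rpow hp0.ne']
    positivity
  · have h2 := hε h0
    refine h2.1 T ?_
    have h3 := hT.trans (min_le_right _ _)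
    rw [kappaExt, if_neg h0.ne', ENNReal.ofReal_le_ofReal_iff h2.2] at h3
    exact h3

/-- The set of points whose `ε`-balls are contained in `ω_δ` because of the value of `w`. -/
def innerSet (Ω ω : Set (E d)) (w : E d → ℝ) (δ M ε : ℝ) : Set (E d) :=
  {x | x ∈ Ω ∧ w x < sSup (w '' ω) + δ - M * ε}

lemma Standing.isOpen_innerSet (h : Standing P Ω ω δ w C ρ) (ε : ℝ) :
    IsOpen (innerSet Ω ω w δ M ε) :=
  h.lyap.w_C1.continuousOn.isOpen_inter_preimage h.isOpen isOpen_Iio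

lemma Bounds.innerSet_subset {S : Set (E d)} (hb : Bounds P Ω S w D M) {ε : ℝ} (hε : 0 ≤ ε) :
    innerSet Ω ω w δ M ε ⊆ SS := fun x hx =>
  ⟨hx.1, hx.2.trans_le (by have := mul_nonneg hb.M_nonneg hε; linarith)⟩

lemma Bounds.ball_subset (hb : Bounds P Ω SS w D M) {ε : ℝ} (hε : ε ∈ Ioc 0 D) {x : E d}
    (hx : x ∈ innerSet Ω ω w δ M ε) : Metric.ball x ε ⊆ SS := by
  intro y hy
  have hxS := hb.innerSet_subset hε.1.le hx
  have hyD : dist y x ≤ D := (Metric.mem_ball.1 hy).le.trans hε.2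
  refine ⟨hb.mem x hxS y hyD, ?_⟩
  have h1 := (le_abs_self _).trans (hb.w_lip x hxS y hyD)
  have h2 : M * dist y x ≤ M * ε :=
    mul_le_mul_of_nonneg_left (Metric.mem_ball.1 hy).le hb.M_nonneg
  have h3 := hx.2
  linarith

/-- The supremum is a genuine one because ω ⊆ ω_δ bounds w on ω. -/
lemma Standing.le_sSup (h : Standing P Ω ω δ w C ρ) {x : E d} (hx : x ∈ ω) :
    w x ≤ sSup (w '' ω) :=
  _root_.le_csSup ⟨sSup (w '' ω) + δ, by
    rintro _ ⟨y, hy, rfl⟩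
    exact (h.lyap.subset (subset_closure hy)).2.le⟩ ⟨x, hx, rfl⟩

/-- Trajectories along which the drift of `w` is small stay in `innerSet`. -/
lemma Standing.mem_innerSet (h : Standing P Ω ω δ w C ρ) (hb : Bounds P Ω SS w D M)
    {ε : ℝ} (hε : ε ∈ Ioc 0 D) {F : E d → E d} {r T : ℝ} (hr : 0 ≤ r)
    (hdrift : ∀ x ∈ innerSet Ω ω w δ M ε, inner ℝ (gradient w x) (F x) ≤ r)
    (hrT : r * T < δ - M * ε) {y : ℝ → E d} (hy : ContinuousOn y (Icc 0 T)) (hy0 : y 0 ∈ ω)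
    (hderiv : ∀ t ∈ Icc 0 T, y t ∈ Ω → HasDerivWithinAt y (F (y t)) (Icc 0 T) t) :
    ∀ t ∈ Icc (0 : ℝ) T, y t ∈ innerSet Ω ω w δ M ε := by
  refine forall_mem_of_first_exit hy (h.isOpen_innerSet ε) fun s hs hlt => ?_
  have hy0Ω : y 0 ∈ Ω := h.closure_ω (subset_closure hy0)
  have hbound : w (y 0) + r * s < sSup (w '' ω) + δ - M * ε := by
    have := mul_le_mul_of_nonneg_left hs.2 hr
    linarith [h.le_sSup hy0]
  -- The sublevel condition does not by itself prevent reaching the boundary of Ω. A limit of points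
  -- of ω_δ lies in its closure, which is contained in Ω.
  have hys : y s ∈ Ω := by
    rcases hs.1.eq_or_lt with h0 | h0
    · rwa [← h0]
    refine h.lyap.subset' (closure_mono (hb.innerSet_subset (Ω := Ω) (ω := ω) (δ := δ) hε.1.le) ?_)
    have hcw : ContinuousWithinAt y (Ico 0 s) s :=
      (hy s hs).mono fun t ht => ⟨ht.1, ht.2.le.trans hs.2⟩
    refine hcw.mem_closure ?_ fun t ht => hlt t ht
    rw [closure_Ico h0.ne]
    exact right_mem_Icc.2 h0.le
  have hmem : ∀ t ∈ Icc 0 s, y t ∈ Ω := by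
    intro t ht
    rcases ht.2.eq_or_lt with h1 | h1
    · rwa [h1]
    · exact (hlt t ⟨ht.1, h1⟩).1
  have hcont : ContinuousOn (fun t => w (y t)) (Icc 0 s) :=
    h.lyap.w_C1.continuousOn.comp (hy.mono (Icc_subset_Icc_right hs.2)) hmem
  have hder : ∀ t ∈ Ioo 0 s, HasDerivAt (fun t => w (y t)) (inner ℝ (gradient w (y t)) (F (y t))) t := by
    intro t ht
    have h1 : HasDerivAt y (F (y t)) t := (hderiv t ⟨ht.1.le, ht.2.le.trans hs.2⟩
      (hmem t ⟨ht.1.le, ht.2.le⟩)).hasDerivAt (Icc_mem_nhds ht.1 (ht.2.trans_le hs.2))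
    have h2 : DifferentiableAt ℝ w (y t) := (h.lyap.w_C1.differentiableOn one_ne_zero).differentiableAt
      (h.isOpen.mem_nhds (hmem t ⟨ht.1.le, ht.2.le⟩))
    rw [inner_gradient]
    exact h2.hasFDerivAt.comp_hasDerivAt t h1
  have h3 := (convex_Icc 0 s).image_sub_le_mul_sub_of_deriv_le hcont
    (by rw [interior_Icc]; exact fun t ht => (hder t ht).differentiableAt.differentiableWithinAt)
    (C := r) (by
      rw [interior_Icc]
      intro t ht
      rw [(hder t ht).deriv]
      exact hdrift _ (hlt t ⟨ht.1.le, ht.2⟩)) 0 (left_mem_Icc.2 hs.1) s (right_mem_Icc.2 hs.1) hs.1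
  refine ⟨hys, ?_⟩
  linarith

end

/-! ### The drift of w up to the horizon. -/

lemma tendsto_pow_mul_exp_neg {c : ℝ} (hc : 0 < c) (n : ℕ) :
    Tendsto (fun T : ℝ => T ^ n * Real.exp (-(c * T))) atTop (𝓝 0) := by
  refine (isLittleO_pow_exp_pos_mul_atTop n hc).tendsto_div_nhds_zero.congr fun T => ?_
  rw [Real.exp_neg, div_eq_mul_inv]

/-- Stopping η early gains δη/T against the critical drift δ/T; after multiplication by T the gain
is δη, to be compared with eT² + aT. -/
lemma div_add_mul_sub_lt {δ η T e a : ℝ} (hη : 0 < η) (hT : η < T) (he : 0 ≤ e)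
    (h : e * T ^ 2 + a * T < δ * η) : (δ / T + e) * (T - η) < δ - a := by
  have hT0 : 0 < T := hη.trans hT
  rw [← mul_lt_mul_iff_left₀ hT0]
  have e1 : (δ / T + e) * (T - η) * T = (δ + e * T) * (T - η) := by field_simp
  have e2 : 0 ≤ e * T * η := by positivity
  rw [e1]
  nlinarith

section

variable {d m : ℕ} {P : ControlProblem d m} {Ω ω : Set (E d)} {δ : ℝ} {w : E d → ℝ}
  {C : ℝ} {ρ : E d → ℝ} {D M : ℝ}

local notation "SS" => omegaDelta Ω ω w δ

/-- The drift of `w` along the closed loop system in `innerSet` is small enough for trajectories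
to stay there on `[0, T - η]`, for all `T ≤ τ_ε`. -/
lemma Standing.eventually_exists_drift_bound (h : Standing P Ω ω δ w C ρ)
    (hb : Bounds P Ω SS w D M) {κ : ℝ → ℝ} {p : ℝ} (hp : 1 ≤ p)
    (hκtop : Tendsto κ (𝓝[>] 0) atTop)
    (hκ : Tendsto (fun s => κ s ^ ((p - 1) / p)
        * (Real.exp (constK P Ω SS C * κ s) - 1) ^ (1 / p) * s ^ 2) (𝓝[>] 0) (𝓝 0))
    {η : ℝ} (hη : 0 < η) :
    ∀ᶠ ε in 𝓝[>] (0 : ℝ), ∀ T, η < T → ENNReal.ofReal T ≤ tauEps P ρ w SS δ p κ ε →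
      ∃ r ≥ 0, (∀ x ∈ innerSet Ω ω w δ M ε,
        inner ℝ (gradient w x) (P.f x + P.B x (uEps P ρ ε x)) ≤ r) ∧
        r * (T - η) < δ - M * ε := by
  have hδ := h.lyap.δ_pos
  have hD := hb.D_pos
  have hM : 0 < M := zero_lt_one.trans_le hb.one_le
  have hβ := inv_pos.2 P.β_pos
  obtain ⟨K₁, hK₁, hdecay⟩ := h.exists_uErr_le_exp hb hp hκtop hκ
  obtain ⟨c₂, hc₂, hdrift⟩ := h.exists_drift_le hb
  set c₀ := P.β⁻¹ * M ^ 4 with hc₀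
  have hc₀p : 0 < c₀ := by positivity
  -- Threshold for εT² between short and long horizons, chosen so that c₀ν + (M/η)ν = δη/2: below it
  -- both losses fit into the gain.
  set ν := δ * η / (2 * (c₀ + M / η)) with hν
  have hν0 : 0 < ν := by positivity
  have hνlt : c₀ * ν + M / η * ν < δ * η := by
    have : ν * (2 * (c₀ + M / η)) = δ * η := by rw [hν]; field_simp
    nlinarith [mul_pos hδ hη]
  set q := 2 * p + d with hq
  have hq0 : 0 < q := by rw [hq]; positivity
  -- With r = e^{−cT} one has r^q = e^{−K₁T/2}, where q collects 2p from Markov's inequality and d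
  -- from the volume of the ball. This dominates the error e^{−K₁T} for large T.
  set c := K₁ / (2 * q) with hc
  have hc0 : 0 < c := by positivity
  have hcq : c * q = K₁ / 2 := by rw [hc]; field_simp
  -- Normalised so that MεT = (η/2)ΛεT: the bound ΛεT < δ then leaves half of the gain δη for the
  -- other loss.
  set Λ := 2 * M / η with hΛ
  have hΛ0 : 0 < Λ := by positivity
  set cd := (volume (Metric.ball (0 : E d) 1)).toReal with hcd
  have hcd0 : 0 < cd := ENNReal.toReal_pos (Metric.measure_ball_pos _ _ one_pos).ne'
    Metric.isBounded_ball.measure_lt_top.ne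
  -- conditions on large times
  have L1 : ∀ᶠ T : ℝ in atTop, 1 / ν * (T ^ 2 * Real.exp (-(c * T))) < 1 := by
    have := (tendsto_pow_mul_exp_neg hc0 2).const_mul (1 / ν)
    rw [mul_zero] at this
    exact this.eventually_lt_const one_pos
  have L2 : ∀ᶠ T : ℝ in atTop, Real.exp (-(K₁ / 2 * T)) < cd / 2 := by
    have := tendsto_pow_mul_exp_neg (half_pos hK₁) 0
    simp only [pow_zero, one_mul] at this
    exact this.eventually_lt_const (half_pos hcd0)
  have L3 : ∀ᶠ T : ℝ in atTop, Λ * (T ^ 1 * Real.exp (-(c * T))) +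
      c₂ / ν ^ (d + 1) * (T ^ (2 * d + 3) * Real.exp (-(c * T))) < δ / 2 := by
    have := ((tendsto_pow_mul_exp_neg hc0 1).const_mul Λ).add
      ((tendsto_pow_mul_exp_neg hc0 (2 * d + 3)).const_mul (c₂ / ν ^ (d + 1)))
    rw [mul_zero, mul_zero, add_zero] at this
    exact this.eventually_lt_const (half_pos hδ)
  have L4 : ∀ᶠ T : ℝ in atTop,
      c₂ / ν ^ (d + 1) * (T ^ (2 * d + 4) * Real.exp (-(c * T))) < δ * η / 2 := by
    have := (tendsto_pow_mul_exp_neg hc0 (2 * d + 4)).const_mul (c₂ / ν ^ (d + 1))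
    rw [mul_zero] at this
    exact this.eventually_lt_const (by positivity)
  obtain ⟨T₀, hT₀⟩ := eventually_atTop.1 (L1.and (L2.and (L3.and L4)))
  -- Either σ_ε has order ε along a sequence, so the oscillation is Lipschitz, or σ_ε eventually
  -- exceeds Λε and Tσ_ε ≤ δ bounds εT.
  have hsplit : (∃ᶠ ε in 𝓝[>] (0 : ℝ), (sigmaSum P w SS ε).toReal ≤ Λ * ε) ∨
      ∀ᶠ ε in 𝓝[>] (0 : ℝ), ¬ (sigmaSum P w SS ε).toReal ≤ Λ * ε := by
    rw [← not_frequently]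
    exact em _
  -- smallness of `ε`
  have hpos1 : 0 < min (min 1 (D / 2)) (min (ν / (T₀ ^ 2 + 1)) (δ / (2 * M))) := by positivity
  have hsplit' : ∀ᶠ ε in 𝓝[>] (0 : ℝ), (∃ᶠ ε in 𝓝[>] (0 : ℝ), (sigmaSum P w SS ε).toReal ≤ Λ * ε) ∨
      ¬ (sigmaSum P w SS ε).toReal ≤ Λ * ε := by
    rcases hsplit with h1 | h1
    · exact Eventually.of_forall fun _ => Or.inl h1
    · exact h1.mono fun _ h2 => Or.inr h2
  filter_upwards [hdecay, hsplit', Ioo_mem_nhdsGT hpos1] with ε hdec hspl hε T hηT hTτ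
  have hε0 : 0 < ε := hε.1
  obtain ⟨⟨hε1, hεD⟩, hεT₀, hεM⟩ : (ε < 1 ∧ ε < D / 2) ∧ ε < ν / (T₀ ^ 2 + 1) ∧ ε < δ / (2 * M) := by
    simpa only [lt_min_iff] using hε.2
  have hT : 0 < T := hη.trans hηT
  have hεIoc : ε ∈ Ioc 0 (D / 2) := ⟨hε0, hεD.le⟩
  have hεIoc' : ε ∈ Ioc 0 D := ⟨hε0, by linarith⟩
  have hεmin : ε ∈ Ioc 0 (min 1 (D / 2)) := ⟨hε0, le_min hε1.le hεD.le⟩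
  set Sg := (sigmaSum P w SS ε).toReal with hSg
  have hSgδ : Sg ≤ δ / T := by
    rw [le_div_iff₀ hT, mul_comm]
    exact h.mul_sigmaSum_le hb hεIoc'.2 hT hTτ
  have hMε : M * ε < δ / 2 := by
    rw [lt_div_iff₀ (by positivity)] at hεM
    linarith
  rcases le_or_gt (ε * T ^ 2) ν with hcase | hcase
  · -- short horizons
    refine ⟨δ / T + c₀ * ε, by positivity, fun x hx => ?_, ?_⟩
    · have hxS := hb.innerSet_subset hε0.le hx
      have := h.drift_le_of_ball_subset hb (h.ae_norm_Bt_le hb) hεIoc (hb.ball_subset hεIoc' hx)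
        (s := Sg) fun z hz => h.osc_le_sigmaSum hb hεIoc'.2 hxS hz
      linarith
    · refine div_add_mul_sub_lt hη hηT (by positivity) ?_
      have h1 : ε * T ≤ ν / η := by
        rw [le_div_iff₀ hη]
        have : ε * T * η ≤ ε * T * T := by gcongr
        linarith [sq T]
      calc c₀ * ε * T ^ 2 + M * ε * T = c₀ * (ε * T ^ 2) + M * (ε * T) := by ring
        _ ≤ c₀ * ν + M * (ν / η) := by gcongr
        _ = c₀ * ν + M / η * ν := by ring
        _ < δ * η := hνlt
  -- long horizons
  have hTT₀ : T₀ ≤ T := by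
    by_contra! hlt
    rw [lt_div_iff₀ (by positivity)] at hεT₀
    have : T ^ 2 ≤ T₀ ^ 2 := pow_le_pow_left₀ hT.le hlt.le 2
    have := mul_le_mul_of_nonneg_left this hε0.le
    nlinarith
  obtain ⟨l1, l2, l3, l4⟩ := hT₀ T hTT₀
  set r := Real.exp (-(c * T)) with hr
  have hr0 : 0 < r := Real.exp_pos _
  have hinv : ε⁻¹ < T ^ 2 / ν := by
    rw [inv_lt_comm₀ hε0 (by positivity), inv_div, div_lt_iff₀ (by positivity)]
    exact hcase
  -- The exponentially small radius lies below ε ≥ ν/T², so the comparison ball fits into ω_δ.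
  have hrε : r ≤ ε := by
    have h1 : r * ε⁻¹ ≤ r * (T ^ 2 / ν) := by gcongr
    have h2 : r * (T ^ 2 / ν) = 1 / ν * (T ^ 2 * r) := by ring
    have h3 : r * ε⁻¹ ≤ 1 := by linarith
    rwa [← div_eq_mul_inv, div_le_one hε0] at h3
  set e := c₂ * r * (ε⁻¹) ^ (d + 1) with he
  have he0 : 0 ≤ e := by positivity
  have hele : e ≤ c₂ / ν ^ (d + 1) * (T ^ (2 * d + 2) * r) := by
    have h1 : (ε⁻¹) ^ (d + 1) ≤ (T ^ 2 / ν) ^ (d + 1) :=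
      pow_le_pow_left₀ (inv_nonneg.2 hε0.le) hinv.le _
    calc e ≤ c₂ * r * (T ^ 2 / ν) ^ (d + 1) := by rw [he]; gcongr
      _ = _ := by rw [div_pow, ← pow_mul]; ring
  have hpt : ∀ x ∈ innerSet Ω ω w δ M ε, ∃ z ∈ Metric.ball x r,
      inner ℝ (gradient w x) (P.f x + P.B x (uEps P ρ ε x)) ≤ osc P w (supBt P SS) x z + e := by
    intro x hx
    have hxS := hb.innerSet_subset hε0.le hx
    have hball : Metric.ball x r ⊆ SS :=
      (Metric.ball_subset_ball hrε).trans (hb.ball_subset hεIoc' hx)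
    obtain ⟨z, hz, hz1, hz2, hz3⟩ := h.exists_mem_ball_norm_sub_le hb hεIoc hp hr0 hball (by
      refine (hdec T hTτ).trans_lt ?_
      have h1 : r ^ (2 * p) * (r ^ d * cd) = Real.exp (-(K₁ / 2 * T)) * cd := by
        rw [← mul_assoc, ← Real.rpow_natCast r d, ← Real.rpow_add hr0, ← hq, hr, ← Real.exp_mul,
          ← hcq]
        congr 2
        ring
      have h2 : Real.exp (-(K₁ * T)) = Real.exp (-(K₁ / 2 * T)) * Real.exp (-(K₁ / 2 * T)) := by
        rw [← Real.exp_add]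
        congr 1
        ring
      rw [h1, h2]
      have := mul_lt_mul_of_pos_left l2 (Real.exp_pos (-(K₁ / 2 * T)))
      linarith)
    exact ⟨z, hz, hdrift _ ε hεmin x hxS z (hball hz) r (Metric.mem_ball.1 hz).le
      (by linarith) hz1 hz2 hz3⟩
  rcases hspl with hfreq | hnot
  · refine ⟨Λ * r + e, by positivity, fun x hx => ?_, ?_⟩
    · obtain ⟨z, hz, hle⟩ := hpt x hx
      have h1 := h.osc_le_of_frequently hb hfreq
        ((Metric.ball_subset_ball hrε).trans (hb.ball_subset hεIoc' hx)) hz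
      have h2 : Λ * dist z x ≤ Λ * r := mul_le_mul_of_nonneg_left (Metric.mem_ball.1 hz).le hΛ0.le
      linarith
    · have h1 : (Λ * r + e) * (T - η) ≤ (Λ * r + e) * T :=
        mul_le_mul_of_nonneg_left (by linarith) (by positivity)
      have h2 : e * T ≤ c₂ / ν ^ (d + 1) * (T ^ (2 * d + 2) * r) * T := by gcongr
      have h3 : c₂ / ν ^ (d + 1) * (T ^ (2 * d + 2) * r) * T =
        c₂ / ν ^ (d + 1) * (T ^ (2 * d + 3) * r) := by ring
      rw [pow_one] at l3
      linarith
  · refine ⟨δ / T + e, by positivity, fun x hx => ?_, ?_⟩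
    · obtain ⟨z, hz, hle⟩ := hpt x hx
      have h1 := h.osc_le_sigmaSum hb hεIoc'.2 (hb.innerSet_subset hε0.le hx)
        (Metric.ball_subset_ball hrε hz)
      linarith
    · refine div_add_mul_sub_lt hη hηT he0 ?_
      have h2 : e * T ^ 2 ≤ c₂ / ν ^ (d + 1) * (T ^ (2 * d + 2) * r) * T ^ 2 := by gcongr
      have h3 : c₂ / ν ^ (d + 1) * (T ^ (2 * d + 2) * r) * T ^ 2 =
        c₂ / ν ^ (d + 1) * (T ^ (2 * d + 4) * r) := by ring
      have h4 : Λ * ε * T < δ := by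
        rw [← lt_div_iff₀ hT]
        exact (not_le.1 hnot).trans_le hSgδ
      have h5 : M * ε * T = η / 2 * (Λ * ε * T) := by rw [hΛ]; field_simp
      have h6 : η / 2 * (Λ * ε * T) < η / 2 * δ := by gcongr
      linarith

end

/-! ### The bound −K for the divergence under `uEps`. -/

lemma LocallyLipschitz.ae_differentiableAt {d : ℕ} {Y : Type*} [NormedAddCommGroup Y]
    [NormedSpace ℝ Y] [FiniteDimensional ℝ Y] {g : E d → Y} (hg : LocallyLipschitz g) :
    ∀ᵐ x, DifferentiableAt ℝ g x := by
  filter_upwards [LocallyLipschitzOn.ae_differentiableAt volume isOpen_univ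
    (hg.locallyLipschitzOn (s := univ))] with x hx using hx (mem_univ x)

lemma abs_fderiv_single_le {d : ℕ} {φ : E d → ℝ} {x : E d} {S : Set (E d)} (hS : S ∈ 𝓝 x) {l : ℝ}
    (hl : 0 ≤ l) (hφ : ∀ y ∈ S, ∀ z ∈ S, |φ y - φ z| ≤ l * ‖y - z‖) (i : Fin d) :
    |fderiv ℝ φ x (EuclideanSpace.single i 1)| ≤ l := by
  have h1 : LipschitzOnWith ⟨l, hl⟩ φ S :=
    LipschitzOnWith.of_dist_le_mul fun y hy z hz => by
      rw [Real.dist_eq, dist_eq_norm]; exact hφ y hy z hz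
  have h2 := norm_fderiv_le_of_lipschitzOn ℝ hS h1
  rw [← Real.norm_eq_abs]
  refine (ContinuousLinearMap.le_opNorm _ _).trans ?_
  rw [PiLp.norm_single, norm_one, mul_one]
  exact h2

/-- Put x' = x + tb and divide by t²: the one-sided Lipschitz bound passes to the derivative. -/
lemma inner_fderiv_le {d : ℕ} {g : E d → E d} {x : E d} (hg : DifferentiableAt ℝ g x) {C : ℝ}
    (h : ∀ᶠ x' in 𝓝 x, inner ℝ (g x' - g x) (x' - x) ≤ C * ‖x' - x‖ ^ 2) (b : E d) :
    inner ℝ (fderiv ℝ g x b) b ≤ C * ‖b‖ ^ 2 := by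
  have h0 : HasDerivAt (fun t : ℝ => x + t • b) b 0 := by
    simpa using ((hasDerivAt_id (0 : ℝ)).smul_const b).const_add x
  have h1 : HasDerivAt (fun t : ℝ => g (x + t • b)) (fderiv ℝ g x b) 0 := by
    have : HasFDerivAt g (fderiv ℝ g x) ((fun t : ℝ => x + t • b) 0) := by
      simpa using hg.hasFDerivAt
    exact this.comp_hasDerivAt _ h0
  have h2 := h1.tendsto_slope_zero_right
  simp only [zero_add, zero_smul, add_zero] at h2
  have h3 : Tendsto (fun t : ℝ => inner ℝ (t⁻¹ • (g (x + t • b) - g x)) b) (𝓝[>] 0)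
      (𝓝 (inner ℝ (fderiv ℝ g x b) b)) := h2.inner tendsto_const_nhds
  have h4 : Tendsto (fun t : ℝ => x + t • b) (𝓝[>] 0) (𝓝 x) :=
    (Continuous.tendsto' (by fun_prop) _ _ (by simp)).mono_left nhdsWithin_le_nhds
  refine le_of_tendsto h3 ?_
  filter_upwards [h4.eventually h, self_mem_nhdsWithin] with t ht ht0
  have ht0' : (0 : ℝ) < t := ht0
  rw [add_sub_cancel_left, inner_smul_right, norm_smul, mul_pow, Real.norm_of_nonneg ht0'.le] at ht
  rw [real_inner_smul_left, inv_mul_le_iff₀ ht0']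
  have : t * inner ℝ (g (x + t • b) - g x) b ≤ t * (t * (C * ‖b‖ ^ 2)) := by linarith
  exact le_of_mul_le_mul_left this ht0'

section

variable {d m : ℕ} {P : ControlProblem d m} {Ω ω : Set (E d)} {δ : ℝ} {w : E d → ℝ}
  {C : ℝ} {ρ : E d → ℝ} {D M : ℝ}

local notation "SS" => omegaDelta Ω ω w δ

/-- The divergence of the closed loop vector field is at least `-K`. -/
lemma Standing.neg_constK_le_trace (h : Standing P Ω ω δ w C ρ) (hb : Bounds P Ω SS w D M)
    {ε : ℝ} (hε : ε ∈ Ioc 0 (D / 2)) :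
    ∀ᵐ x : E d, x ∈ innerSet Ω ω w δ M ε → -constK P Ω SS C ≤ LinearMap.trace ℝ (E d)
      (fderiv ℝ (fun y => P.f y + P.B y (uEps P ρ ε y)) x) := by
  have hD := hb.D_pos
  have hself : ∀ x : E d, ∀ r, 0 < r → dist x x ≤ r := fun x r hr => by rw [dist_self]; exact hr.le
  have hcompS : IsCompact (closure SS) :=
    Metric.isCompact_of_isClosed_isBounded isClosed_closure
      (h.bounded.subset omegaDelta_subset).closure
  have hcompΩ : IsCompact (closure Ω) :=
    Metric.isCompact_of_isClosed_isBounded isClosed_closure h.bounded.closure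
  obtain ⟨LB, hLB⟩ := (P.B_lip.locallyLipschitzOn
    (s := closure SS)).exists_lipschitzOnWith_of_compact hcompS
  obtain ⟨Lf, hLf⟩ := (P.f_lip.locallyLipschitzOn
    (s := closure Ω)).exists_lipschitzOnWith_of_compact hcompΩ
  obtain ⟨l, hl0, hleq, hl⟩ := exists_lipNorm_eq (A := SS) (F := P.entry) LB.2
    fun x hx y hy k => by
      have h1 := hLB.norm_sub_le (subset_closure hx) (subset_closure hy)
      have h2 : P.entry x k - P.entry y k = (P.B x - P.B y) (EuclideanSpace.single k.2 1) k.1 := by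
        simp [ControlProblem.entry]
      rw [h2]
      refine (abs_apply_le_norm _ _).trans (le_trans ?_ h1)
      refine (ContinuousLinearMap.le_opNorm _ _).trans ?_
      simp
  obtain ⟨lf, hlf0, hlfeq, hlf⟩ := exists_lipNorm_eq (A := closure Ω) (F := fun x i => P.f x i) Lf.2
    fun x hx y hy i => by
      rw [← PiLp.sub_apply]
      exact (abs_apply_le_norm _ _).trans (hLf.norm_sub_le hx hy)
  have hgV := eLpNorm_top_lt_top_and_ae_le h.isOpen_S.measurableSet (g := gradient P.V) (M := M)
    fun x hx => hb.gradV x hx x (hself x D hD)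
  set G := (eLpNorm (gradient P.V) ∞ (volume.restrict SS)).toReal with hG
  filter_upwards [LocallyLipschitz.ae_differentiableAt P.f_lip,
    LocallyLipschitz.ae_differentiableAt P.B_lip] with x hfx hBx hx
  have hball := hb.ball_subset ⟨hε.1, hε.2.trans (by linarith)⟩ hx
  have hxS : x ∈ SS := hball (Metric.mem_ball_self hε.1)
  have hSx : SS ∈ 𝓝 x := h.isOpen_S.mem_nhds hxS
  set g := gradient (mollify ρ ε P.V) with hg
  have hgd : DifferentiableAt ℝ g x := by
    have h1 : ContDiff ℝ 2 (mollify ρ ε P.V) :=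
      mod_cast contDiff_infty.1 (mollify_contDiff h.mollifier hε.1 h.cont) 2
    have h2 : Differentiable ℝ (fderiv ℝ (mollify ρ ε P.V)) :=
      (h1.fderiv_right (m := 1) (by norm_num)).differentiable one_ne_zero
    exact (InnerProductSpace.toDual ℝ (E d)).symm.toContinuousLinearEquiv.differentiableAt.comp x
      (h2 x)
  have hgG : ‖g x‖ ≤ G := by
    rw [hg, h.gradient_mollify hb hxS (hself x _ (half_pos hD)) hε]
    have := h.mollifier.norm_mavg_sub_le hε.1 (x := x) (measurable_gradient P.V) (c := 0) (η := G)
      (by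
        filter_upwards [hgV.2] with z hz hzb
        rw [sub_zero]
        exact hz (hball hzb))
    rwa [sub_zero] at this
  have hcb : ∀ x' ∈ SS, Metric.closedBall x' ε ⊆ Ω := fun x' hx' z hz =>
    hb.mem x' hx' z (dist_le_of_mem_closedBall (hself x' _ (half_pos hD)) hε.2 hz)
  have hone : ∀ᶠ x' in 𝓝 x, inner ℝ (g x' - g x) (x' - x) ≤ C * ‖x' - x‖ ^ 2 := by
    filter_upwards [hSx] with x' hx'
    exact h.semiConcave.inner_gradient_mollify_sub_le h.mollifier h.isOpen h.cont hε.1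
      (hcb x' hx') (hcb x hxS)
  have hsup : ∀ k, |P.entry x k| ≤ supNorm SS P.entry := fun k =>
    abs_le_supNorm (fun y hy k => (abs_entry_le P y k).trans
      (hb.B_le y hy y (hself y D hD))) hxS k
  have key := P.neg_le_trace hfx hBx hgd hsup (supNorm_nonneg _ _) hl0 h.C_pos.le
    (fun k i => abs_fderiv_single_le hSx hl0 (fun y hy z hz => hl y hy z hz k) i)
    (fun i => (abs_fderiv_single_le (mem_of_superset (h.isOpen.mem_nhds hxS.1) subset_closure) hlf0
      (fun y hy z hz => hlf y hy z hz i) i).trans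
        (show lf ≤ lipNorm (closure Ω) fun x i => P.f x i by
          rw [hlfeq]; linarith [supNorm_nonneg (closure Ω) fun x i => P.f x i]))
    hgG (inner_fderiv_le hgd hone)
  rw [← hleq] at key
  exact key

end

/-! ### The closed loop flow and the cost gap along it. -/

/-- A locally Lipschitz vector field coincides on a bounded set with a bounded Lipschitz one. -/
lemma exists_lipschitz_bounded_extension {d : ℕ} {F : E d → E d} (hF : LocallyLipschitz F)
    {Ω : Set (E d)} (hΩ : Bornology.IsBounded Ω) :
    ∃ (F' : E d → E d) (L M : ℝ≥0), LipschitzWith L F' ∧ (∀ x, ‖F' x‖ ≤ M) ∧ EqOn F' F Ω := by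
  obtain ⟨R, hR⟩ := hΩ.exists_norm_le
  -- Clamping each coordinate to [−R,R] is a 1-Lipschitz map into a compact cube and fixes every
  -- point of Ω.
  set c : E d → E d := fun x => WithLp.toLp 2 fun i => max (-R) (min R (x i)) with hc
  set N : Set (E d) := WithLp.toLp 2 '' Set.pi univ fun _ : Fin d => Icc (-|R|) |R| with hN
  have hNc : IsCompact N :=
    (isCompact_univ_pi fun _ => isCompact_Icc).image (PiLp.continuous_toLp 2 _)
  have hcN : ∀ x, c x ∈ N := by
    intro x
    refine ⟨_, fun i _ => ?_, rfl⟩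
    refine ⟨(neg_le_neg (le_abs_self R)).trans (le_max_left _ _), max_le (neg_le_abs R) ?_⟩
    exact (min_le_left _ _).trans (le_abs_self R)
  have hcl : LipschitzWith 1 c := by
    refine LipschitzWith.of_dist_le_mul fun x y => ?_
    rw [NNReal.coe_one, one_mul, EuclideanSpace.dist_eq, EuclideanSpace.dist_eq]
    refine Real.sqrt_le_sqrt (Finset.sum_le_sum fun i _ => ?_)
    refine pow_le_pow_left₀ dist_nonneg ?_ 2
    rw [Real.dist_eq, Real.dist_eq]
    have h1 := abs_max_sub_max_le_max (-R) (min R (x i)) (-R) (min R (y i))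
    have h2 := abs_min_sub_min_le_max R (x i) R (y i)
    simp only [sub_self, abs_zero] at h1 h2
    rw [max_eq_right (abs_nonneg (min R (x i) - min R (y i)))] at h1
    rw [max_eq_right (abs_nonneg (x i - y i))] at h2
    exact h1.trans h2
  obtain ⟨L, hL⟩ := (hF.locallyLipschitzOn (s := N)).exists_lipschitzOnWith_of_compact hNc
  obtain ⟨M, hM⟩ := (hNc.image hF.continuous).isBounded.exists_norm_le
  refine ⟨F ∘ c, L * 1, M.toNNReal, ?_, fun x => ?_, fun x hx => ?_⟩
  · rw [← lipschitzOnWith_univ] at hcl ⊢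
    exact hL.comp hcl fun x _ => hcN x
  · exact (hM _ ⟨c x, hcN x, rfl⟩).trans (Real.le_coe_toNNReal M)
  · have hcx : c x = x := by
      ext i
      have h1 := abs_le.1 ((abs_apply_le_norm x i).trans (hR x hx))
      change max (-R) (min R (x i)) = x i
      rw [min_eq_right h1.2, max_eq_right h1.1]
    rw [Function.comp_apply, hcx]

lemma locallyLipschitz_clm_apply {α X Y : Type*} [PseudoEMetricSpace α] [NormedAddCommGroup X]
    [NormedSpace ℝ X] [NormedAddCommGroup Y] [NormedSpace ℝ Y] {A : α → X →L[ℝ] Y} {v : α → X}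
    (hA : LocallyLipschitz A) (hv : LocallyLipschitz v) : LocallyLipschitz fun y => A y (v y) :=
  LocallyLipschitz.comp (f := fun z : (X →L[ℝ] Y) × X => z.1 z.2) (g := fun y => (A y, v y))
    (isBoundedBilinearMap_apply.contDiff (n := 1)).locallyLipschitz (hA.prodMk hv)

section

variable {d m : ℕ} {P : ControlProblem d m} {Ω ω : Set (E d)} {δ : ℝ} {w : E d → ℝ}
  {C : ℝ} {ρ : E d → ℝ} {D M : ℝ}

local notation "SS" => omegaDelta Ω ω w δ

lemma locallyLipschitz_uEps (hρ : IsMollifier ρ) (hV : Continuous P.V) {ε : ℝ} (hε : 0 < ε) :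
    LocallyLipschitz (uEps P ρ ε) := by
  have h1 : ContDiff ℝ 2 (mollify ρ ε P.V) := mod_cast contDiff_infty.1 (mollify_contDiff hρ hε hV) 2
  have h2 : ContDiff ℝ 1 (gradient (mollify ρ ε P.V)) :=
    (InnerProductSpace.toDual ℝ (E d)).symm.toContinuousLinearEquiv.contDiff.comp
      (h1.fderiv_right (m := 1) (by norm_num))
  have h3 : LocallyLipschitz fun y => ContinuousLinearMap.adjoint (P.B y) :=
    (LinearIsometryEquiv.lipschitz _).locallyLipschitz.comp P.B_lip
  have h4 : LocallyLipschitz fun q : E m => -(P.β⁻¹ • q) :=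
    (show ContDiff ℝ 1 fun q : E m => -(P.β⁻¹ • q) by fun_prop).locallyLipschitz
  exact h4.comp (locallyLipschitz_clm_apply h3 h2.locallyLipschitz)

lemma locallyLipschitz_field {u : E d → E m} (hu : LocallyLipschitz u) :
    LocallyLipschitz fun y => P.f y + P.B y (u y) := by
  have h1 : LocallyLipschitz fun y => P.B y (u y) := locallyLipschitz_clm_apply P.B_lip hu
  have h4 : LocallyLipschitz fun z : E d × E d => z.1 + z.2 :=
    (show ContDiff ℝ 1 fun z : E d × E d => z.1 + z.2 by fun_prop).locallyLipschitz
  exact LocallyLipschitz.comp (f := fun z : E d × E d => z.1 + z.2)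
    (g := fun y => (P.f y, P.B y (u y))) h4 (P.f_lip.prodMk h1)

/-- `Φ` is, on `[0,T]`, the flow of a bounded Lipschitz vector field `F'` which coincides on `Ω`
with the closed loop field of `u`. -/
structure IsFlow (P : ControlProblem d m) (Ω : Set (E d)) (u : E d → E m) (T : ℝ)
    (F' : E d → E d) (L N : ℝ≥0) (Φ : E d → ℝ → E d) : Prop where
  nonneg : 0 ≤ T
  lip : LipschitzWith L F'
  bound : ∀ x, ‖F' x‖ ≤ N
  eqOn : EqOn F' (fun y => P.f y + P.B y (u y)) Ω
  cont : Continuous (Function.uncurry Φ)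
  init : ∀ x, Φ x 0 = x
  curve : ∀ x, IsCurve F' T (Φ x)

/-- With the extended field the flow is defined for all initial values, including those that leave
Ω, and is jointly continuous. Measurability in the initial value is then automatic. -/
lemma exists_isFlow {u : E d → E m} (hu : LocallyLipschitz u) (hΩ : Bornology.IsBounded Ω) {T : ℝ}
    (hT : 0 ≤ T) : ∃ F' L N Φ, IsFlow P Ω u T F' L N Φ := by
  obtain ⟨F', L, N, h1, h2, h3⟩ :=
    exists_lipschitz_bounded_extension (locallyLipschitz_field (P := P) hu) hΩ
  obtain ⟨Φ, h4, h5⟩ := exists_flow h1 h2 hT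
  exact ⟨F', L, N, Φ, hT, h1, h2, h3, h4, fun x => (h5 x).1, fun x => (h5 x).2⟩

variable {u : E d → E m} {T : ℝ} {F' : E d → E d} {L N : ℝ≥0} {Φ : E d → ℝ → E d}

lemma IsFlow.continuous_apply (hΦ : IsFlow P Ω u T F' L N Φ) (x : E d) : Continuous (Φ x) :=
  hΦ.cont.comp (f := fun t => (x, t)) (by fun_prop)

lemma IsFlow.hasDerivWithinAt (hΦ : IsFlow P Ω u T F' L N Φ) {x : E d} {t : ℝ} (ht : t ∈ Icc 0 T)
    (hmem : Φ x t ∈ Ω) :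
    HasDerivWithinAt (Φ x) (P.f (Φ x t) + P.B (Φ x t) (u (Φ x t))) (Icc 0 T) t := by
  have := hΦ.curve x t ht
  rwa [hΦ.eqOn hmem] at this

lemma IsFlow.isClosedLoop (hΦ : IsFlow P Ω u T F' L N Φ) {U : Set (E d)} (hU : U ⊆ Ω) {x : E d}
    (hmem : ∀ t ∈ Icc 0 T, Φ x t ∈ U) : IsClosedLoop P U u T x (Φ x) where
  init := hΦ.init x
  mem := hmem
  deriv := fun t ht => hΦ.hasDerivWithinAt ht (hU (hmem t ht))

/-- A closed loop trajectory in Ω is also a curve of the extended field, so uniqueness identifies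
the chosen trajectory with the flow. -/
lemma IsFlow.eqOn_traj (hΦ : IsFlow P Ω u T F' L N Φ) {x : E d}
    (hmem : ∀ t ∈ Icc 0 T, Φ x t ∈ Ω) : EqOn (traj P Ω u T x) (Φ x) (Icc 0 T) := by
  have hex : ∃ y, IsClosedLoop P Ω u T x y := ⟨_, hΦ.isClosedLoop subset_rfl hmem⟩
  have hch : IsClosedLoop P Ω u T x (traj P Ω u T x) := by
    rw [traj, dif_pos hex]
    exact hex.choose_spec
  have hcurve : IsCurve F' T (traj P Ω u T x) := fun t ht => by
    rw [hΦ.eqOn (hch.mem t ht)]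
    exact hch.deriv t ht
  exact hcurve.eqOn hΦ.lip (hΦ.curve x) (by rw [hch.init, hΦ.init])

/-- The cost gap along a flow. -/
noncomputable def flowGap (P : ControlProblem d m) (u : E d → E m) (T : ℝ) (Φ : E d → ℝ → E d)
    (x : E d) : ℝ :=
  (∫ t in (0 : ℝ)..T, (P.ℓ (Φ x t) + P.β / 2 * ‖u (Φ x t)‖ ^ 2)) + P.V (Φ x T) - P.V x

lemma IsFlow.costGap_eq (hΦ : IsFlow P Ω u T F' L N Φ) {x : E d}
    (hmem : ∀ t ∈ Icc 0 T, Φ x t ∈ Ω) : costGap P Ω u T x = flowGap P u T Φ x := by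
  have h1 := hΦ.eqOn_traj hmem
  rw [costGap, flowGap, finiteCost, h1 (right_mem_Icc.2 hΦ.nonneg)]
  congr 2
  refine intervalIntegral.integral_congr fun t ht => ?_
  rw [uIcc_of_le hΦ.nonneg] at ht
  simp only [h1 ht]

lemma IsFlow.continuous_running (hΦ : IsFlow P Ω u T F' L N Φ) (hu : Continuous u) :
    Continuous (Function.uncurry fun x t => P.ℓ (Φ x t) + P.β / 2 * ‖u (Φ x t)‖ ^ 2) :=
  (P.ℓ_lip.continuous.comp hΦ.cont).add
    (((hu.comp hΦ.cont).norm.pow 2).const_mul (P.β / 2))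

lemma IsFlow.continuous_flowGap (hΦ : IsFlow P Ω u T F' L N Φ) (hu : Continuous u)
    (hV : Continuous P.V) : Continuous (flowGap P u T Φ) := by
  refine ((intervalIntegral.continuous_parametric_intervalIntegral_of_continuous'
    (hΦ.continuous_running hu) 0 T).add (hV.comp ?_)).sub hV
  exact hΦ.cont.comp (f := fun x => (x, T)) (by fun_prop)

lemma IsFlow.intervalIntegrable_running (hΦ : IsFlow P Ω u T F' L N Φ) (hu : Continuous u)
    (x : E d) (a b : ℝ) :
    IntervalIntegrable (fun t => P.ℓ (Φ x t) + P.β / 2 * ‖u (Φ x t)‖ ^ 2) volume a b :=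
  ((hΦ.continuous_running hu).comp (f := fun t => (x, t)) (by fun_prop)).intervalIntegrable a b

/-- The feedback law is not better than the optimal controls. -/
lemma IsFlow.flowGap_nonneg (hΦ : IsFlow P Ω u T F' L N Φ) (hu : Continuous u)
    (hVfin : ∀ y, P.eValue y ≠ ⊤) {x : E d} (hmem : ∀ t ∈ Icc 0 T, Φ x t ∈ Ω) :
    0 ≤ flowGap P u T Φ x := by
  have hx := hΦ.continuous_apply x
  have hfield : Continuous fun s => P.f (Φ x s) + P.B (Φ x s) (u (Φ x s)) :=
    (P.f_lip.continuous.comp hx).add ((P.B_lip.continuous.comp hx).clm_apply (hu.comp hx))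
  have key := P.eValue_le_lintegral_add hΦ.nonneg (x := x) (u₁ := fun t => u (Φ x t)) (y₁ := Φ x)
    (hu.comp hx).continuousOn hx.continuousOn fun t ht => by
      rw [intervalIntegral.integral_eq_sub_of_hasDerivAt_of_le ht.1 hx.continuousOn (f := Φ x)
        (fun s hs => ?_) (hfield.intervalIntegrable _ _), hΦ.init]
      · abel
      · have hs' : s ∈ Icc 0 T := ⟨hs.1.le, hs.2.le.trans ht.2⟩
        exact (hΦ.hasDerivWithinAt hs' (hmem s hs')).hasDerivAt
          (Icc_mem_nhds hs.1 (hs.2.trans_le ht.2))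
  have hi := hΦ.intervalIntegrable_running hu x 0 T
  rw [intervalIntegrable_iff_integrableOn_Ioc_of_le hΦ.nonneg] at hi
  have hint : 0 ≤ ∫ t in Ioc 0 T, (P.ℓ (Φ x t) + P.β / 2 * ‖u (Φ x t)‖ ^ 2) :=
    integral_nonneg fun t => P.running_nonneg _ _
  rw [← ofReal_integral_eq_lintegral_ofReal hi (Eventually.of_forall fun t => P.running_nonneg _ _),
    ← ENNReal.ofReal_toReal (hVfin x), ← ENNReal.ofReal_toReal (hVfin (Φ x T)),
    ← ENNReal.ofReal_add hint ENNReal.toReal_nonneg,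
    ENNReal.ofReal_le_ofReal_iff (add_nonneg hint ENNReal.toReal_nonneg)] at key
  rw [flowGap, intervalIntegral.integral_of_le hΦ.nonneg]
  change P.V x ≤ _ + P.V (Φ x T) at key
  linarith

/-- A crude global bound. It serves only to show that preimages of null sets under the flow are
null, where the rate is irrelevant. -/
lemma neg_le_trace_fderiv {F : E d → E d} {L : ℝ≥0} (hF : LipschitzWith L F) (x : E d) :
    -(d * L : ℝ) ≤ LinearMap.trace ℝ (E d) (fderiv ℝ F x) := by
  rw [trace_eq_sum_apply]
  have h1 : ∀ i ∈ (Finset.univ : Finset (Fin d)),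
      -(L : ℝ) ≤ fderiv ℝ F x (EuclideanSpace.single i 1) i := by
    intro i _
    refine (abs_le.1 ((abs_apply_le_norm _ _).trans ((ContinuousLinearMap.le_opNorm _ _).trans ?_))).1
    rw [PiLp.norm_single, norm_one, mul_one]
    exact norm_fderiv_le_of_lipschitz ℝ hF
  have := Finset.sum_le_sum h1
  simpa using this

/-- Flows of Lipschitz fields see null sets only at negligible times, for almost every initial
value. -/
lemma IsFlow.ae_ae_notMem (hΦ : IsFlow P Ω u T F' L N Φ) {A : Set (E d)} (hA : MeasurableSet A)
    (hA0 : volume A = 0) :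
    ∀ᵐ x : E d, ∀ᵐ t ∂(volume.restrict (Ioc (0 : ℝ) T)), Φ x t ∉ A := by
  rw [Measure.ae_ae_comm (p := fun x t => Φ x t ∉ A) (hΦ.cont.measurable hA.compl)]
  filter_upwards [ae_restrict_mem measurableSet_Ioc] with t ht
  have h1 := volume_transport_le hΦ.lip isOpen_univ
    (Eventually.of_forall fun x _ => neg_le_trace_fderiv hΦ.lip x) ht.1.le Φ (S := univ)
    (fun x _ => hΦ.init x) (fun x _ => (hΦ.curve x).mono ht.2) (fun _ _ _ _ => mem_univ _) A
  rw [hA0, mul_zero, nonpos_iff_eq_zero] at h1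
  rw [ae_iff]
  simpa using h1

lemma ofReal_integral_le_lintegral {α : Type*} [MeasurableSpace α] {μ : Measure α} {f : α → ℝ}
    (hf : Integrable f μ) : ENNReal.ofReal (∫ a, f a ∂μ) ≤ ∫⁻ a, ENNReal.ofReal (f a) ∂μ := by
  rw [integral_eq_lintegral_pos_part_sub_lintegral_neg_part hf]
  exact (ENNReal.ofReal_le_ofReal (sub_le_self _ ENNReal.toReal_nonneg)).trans
    ENNReal.ofReal_toReal_le

/-- The cost gap is controlled by the distance of `u` to the optimal feedback along the flow. -/
lemma IsFlow.ae_flowGap_le (hΦ : IsFlow P Ω u T F' L N Φ) (hu : Continuous u)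
    (hVfin : ∀ y, P.eValue y ≠ ⊤) (hΩ : IsOpen Ω) (hV : LocallyLipschitzOn Ω P.V) :
    ∀ᵐ x : E d, (∀ t ∈ Icc 0 T, Φ x t ∈ Ω) → ENNReal.ofReal (flowGap P u T Φ x) ≤
      ENNReal.ofReal (P.β / 2) *
        ∫⁻ t in Ioc 0 T, ‖u (Φ x t) - P.feedback P.V (Φ x t)‖ₑ ^ (2 : ℝ) := by
  -- The value function need not be differentiable along a given trajectory. The bad set is null, so
  -- almost every trajectory meets it only at negligible times.
  set A : Set (E d) := Ω ∩ {z | DifferentiableAt ℝ P.V z}ᶜ with hAdef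
  have hA : MeasurableSet A :=
    hΩ.measurableSet.inter (measurableSet_of_differentiableAt ℝ P.V).compl
  have hA0 : volume A = 0 := by
    have h1 := LocallyLipschitzOn.ae_differentiableAt volume hΩ hV
    rw [ae_iff] at h1
    refine measure_mono_null (fun z hz => ?_) h1
    exact fun hcon => hz.2 (hcon hz.1)
  filter_upwards [hΦ.ae_ae_notMem hA hA0] with x hx hmem
  have hT := hΦ.nonneg
  have hβ := P.β_pos
  have hxc := hΦ.continuous_apply x
  set v : ℝ → ℝ := fun t => P.V (Φ x t) with hv
  -- V is Lipschitz on the compact orbit and the orbit is Lipschitz in time, so V along the orbit is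
  -- the integral of its almost everywhere derivative.
  have hac : AbsolutelyContinuousOnInterval v 0 T := by
    have himg : IsCompact (Φ x '' Icc 0 T) := isCompact_Icc.image hxc
    obtain ⟨LV, hLV⟩ := (hV.mono (by rintro _ ⟨t, ht, rfl⟩; exact hmem t ht :
      Φ x '' Icc 0 T ⊆ Ω)).exists_lipschitzOnWith_of_compact himg
    have hlip : LipschitzOnWith N (Φ x) (Icc 0 T) :=
      (convex_Icc 0 T).lipschitzOnWith_of_nnnorm_hasDerivWithin_le (hΦ.curve x)
        fun t _ => hΦ.bound _
    refine LipschitzOnWith.absolutelyContinuousOnInterval (K := LV * N) ?_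
    rw [uIcc_of_le hT]
    exact hLV.comp hlip (mapsTo_image _ _)
  have hder : ∀ᵐ t ∂(volume.restrict (Ioc (0 : ℝ) T)),
      (P.ℓ (Φ x t) + P.β / 2 * ‖u (Φ x t)‖ ^ 2) + deriv v t ≤
        P.β / 2 * ‖u (Φ x t) - P.feedback P.V (Φ x t)‖ ^ 2 := by
    rw [← restrict_Ioo_eq_restrict_Ioc] at hx ⊢
    filter_upwards [hx, ae_restrict_mem measurableSet_Ioo] with t ht htI
    have htc : t ∈ Icc 0 T := Ioo_subset_Icc_self htI
    have hd : DifferentiableAt ℝ P.V (Φ x t) := by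
      by_contra hcon
      exact ht ⟨hmem t htc, hcon⟩
    have h1 := (hΦ.hasDerivWithinAt htc (hmem t htc)).hasDerivAt (Icc_mem_nhds htI.1 htI.2)
    have h2 : HasDerivAt v _ t := hd.hasFDerivAt.comp_hasDerivAt t h1
    rw [h2.deriv, ← inner_gradient]
    exact P.running_add_inner_le hVfin hd _
  have hi1 := hΦ.intervalIntegrable_running hu x 0 T
  have hi2 := hac.intervalIntegrable_deriv
  have hgap : flowGap P u T Φ x = ∫ t in Ioc 0 T,
      ((P.ℓ (Φ x t) + P.β / 2 * ‖u (Φ x t)‖ ^ 2) + deriv v t) := by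
    rw [← intervalIntegral.integral_of_le hT, intervalIntegral.integral_add hi1 hi2,
      hac.integral_deriv_eq_sub, flowGap, hv]
    simp only [hΦ.init]
    ring
  rw [intervalIntegrable_iff_integrableOn_Ioc_of_le hT] at hi1 hi2
  rw [hgap, ← lintegral_const_mul' _ _ ENNReal.ofReal_ne_top]
  refine (ofReal_integral_le_lintegral (hi1.add hi2)).trans (lintegral_mono_ae ?_)
  filter_upwards [hder] with t ht
  refine (ENNReal.ofReal_le_ofReal ht).trans_eq ?_
  rw [ENNReal.ofReal_mul (by positivity), ← ofReal_norm, ENNReal.ofReal_rpow_of_nonneg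
    (norm_nonneg _) two_pos.le, Real.rpow_two]

end

/-! ### The L^p estimate for the cost gap. -/

lemma lintegral_rpow_le {α : Type*} [MeasurableSpace α] {μ : Measure α} {g : α → ℝ≥0∞}
    (hg : Measurable g) {p : ℝ} (hp : 1 ≤ p) :
    (∫⁻ a, g a ∂μ) ^ p ≤ (∫⁻ a, g a ^ p ∂μ) * μ univ ^ (p - 1) := by
  have hp0 : 0 < p := by linarith
  have h1 := eLpNorm_le_eLpNorm_mul_rpow_measure_univ (μ := μ) (f := g) (p := 1)
    (q := ENNReal.ofReal p) (by simpa using hp) hg.aestronglyMeasurable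
  rw [eLpNorm_one_eq_lintegral_enorm, eLpNorm_eq_lintegral_rpow_enorm_toReal (by simpa using hp0)
    ENNReal.ofReal_ne_top, ENNReal.toReal_ofReal hp0.le] at h1
  simp only [enorm_eq_self, ENNReal.toReal_one] at h1
  refine (ENNReal.rpow_le_rpow h1 hp0.le).trans_eq ?_
  rw [ENNReal.mul_rpow_of_nonneg _ _ hp0.le, ← ENNReal.rpow_mul, ← ENNReal.rpow_mul, one_div,
    inv_mul_cancel₀ hp0.ne', ENNReal.rpow_one]
  congr 2
  field_simp

section

variable {d m : ℕ} {P : ControlProblem d m} {Ω ω : Set (E d)} {δ : ℝ} {w : E d → ℝ}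
  {C : ℝ} {ρ : E d → ℝ} {D M : ℝ}

local notation "SS" => omegaDelta Ω ω w δ

variable {T T₁ ε : ℝ} {F' : E d → E d} {L N : ℝ≥0} {Φ : E d → ℝ → E d}

/-- Transport estimate: as long as they stay in `innerSet`, trajectories from `ω` do not
concentrate faster than `exp (K t)`. -/
lemma Standing.lintegral_flow_le (h : Standing P Ω ω δ w C ρ) (hb : Bounds P Ω SS w D M)
    (hε : ε ∈ Ioc 0 (D / 2)) (hΦ : IsFlow P Ω (uEps P ρ ε) T F' L N Φ) {t : ℝ} (ht : t ∈ Icc 0 T)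
    (hin : ∀ x ∈ ω, ∀ s ∈ Icc 0 t, Φ x s ∈ innerSet Ω ω w δ M ε) {g : E d → ℝ≥0∞}
    (hg : Measurable g) :
    ∫⁻ x in ω, g (Φ x t) ≤
      ENNReal.ofReal (Real.exp (constK P Ω SS C * t)) * ∫⁻ x in SS, g x := by
  have hΦt : Measurable fun x => Φ x t :=
    (hΦ.cont.comp (f := fun x => (x, t)) (by fun_prop)).measurable
  have hK : ∀ᵐ x : E d, x ∈ innerSet Ω ω w δ M ε →
      -constK P Ω SS C ≤ LinearMap.trace ℝ (E d) (fderiv ℝ F' x) := by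
    filter_upwards [h.neg_constK_le_trace hb hε] with x hx hxI
    have heq : F' =ᶠ[𝓝 x] fun y => P.f y + P.B y (uEps P ρ ε y) :=
      mem_of_superset (h.isOpen.mem_nhds hxI.1) hΦ.eqOn
    rw [heq.fderiv_eq]
    exact hx hxI
  -- The transport estimate read as domination of measures, so that any measurable nonnegative g can
  -- be integrated. Intersecting the target with ω_δ is harmless, since the trajectories are there
  -- at time t.
  have hle : (volume.restrict ω).map (fun x => Φ x t) ≤
      ENNReal.ofReal (Real.exp (constK P Ω SS C * t)) • volume.restrict SS := by
    refine Measure.le_iff.2 fun A hA => ?_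
    rw [Measure.map_apply hΦt hA, Measure.restrict_apply (hΦt hA), Measure.smul_apply,
      Measure.restrict_apply hA, smul_eq_mul]
    refine le_trans (measure_mono ?_) (volume_transport_le hΦ.lip (h.isOpen_innerSet ε) hK ht.1 Φ
      (S := ω) (fun x _ => hΦ.init x) (fun x _ => (hΦ.curve x).mono ht.2) hin (A ∩ SS))
    exact fun x hx => ⟨hx.2, hx.1, hb.innerSet_subset hε.1.le (hin x hx.2 t ⟨ht.1, le_rfl⟩)⟩
  calc ∫⁻ x in ω, g (Φ x t) = ∫⁻ z, g z ∂((volume.restrict ω).map fun x => Φ x t) :=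
        (lintegral_map hg hΦt).symm
    _ ≤ ∫⁻ z, g z ∂(ENNReal.ofReal (Real.exp (constK P Ω SS C * t)) • volume.restrict SS) :=
        lintegral_mono' hle le_rfl
    _ = _ := lintegral_smul_measure _ _

lemma Standing.lintegral_uErr (h : Standing P Ω ω δ w C ρ) (hb : Bounds P Ω SS w D M)
    (hε : ε ∈ Ioc 0 (D / 2)) {q : ℝ} (hq : 0 < q) :
    ∫⁻ x in SS, ‖uEps P ρ ε x - P.feedback P.V x‖ₑ ^ q =
      ENNReal.ofReal (uErr P ρ SS q ε ^ q) := by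
  have hfin := h.eLpNorm_uEps_sub_lt_top hb hε (ENNReal.ofReal q)
  rw [uErr, ← ENNReal.ofReal_rpow_of_nonneg ENNReal.toReal_nonneg hq.le,
    ENNReal.ofReal_toReal hfin.ne, eLpNorm_eq_lintegral_rpow_enorm_toReal (by simpa using hq)
    ENNReal.ofReal_ne_top, ENNReal.toReal_ofReal hq.le, ← ENNReal.rpow_mul, one_div,
    inv_mul_cancel₀ hq.ne', ENNReal.rpow_one]

/-- The `L^p` norm of the integral of the squared error along the flow. -/
lemma Standing.lintegral_error_le (h : Standing P Ω ω δ w C ρ) (hb : Bounds P Ω SS w D M)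
    (hε : ε ∈ Ioc 0 (D / 2)) (hΦ : IsFlow P Ω (uEps P ρ ε) T F' L N Φ) (hT₁ : T₁ ∈ Icc 0 T)
    (hin : ∀ x ∈ ω, ∀ t ∈ Icc 0 T₁, Φ x t ∈ innerSet Ω ω w δ M ε) {p : ℝ} (hp : 1 ≤ p) :
    ∫⁻ x in ω, (∫⁻ t in Ioc 0 T₁,
        ‖uEps P ρ ε (Φ x t) - P.feedback P.V (Φ x t)‖ₑ ^ (2 : ℝ)) ^ p ≤
      (∫⁻ t in Ioc 0 T₁, ENNReal.ofReal (Real.exp (constK P Ω SS C * t))) *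
        ENNReal.ofReal (uErr P ρ SS (2 * p) ε ^ (2 * p)) * ENNReal.ofReal T₁ ^ (p - 1) := by
  have hp0 : 0 < 2 * p := by linarith
  set e : E d → ℝ≥0∞ := fun z => ‖uEps P ρ ε z - P.feedback P.V z‖ₑ with he
  have hem : Measurable e := (measurable_uEps_sub P ε).enorm
  have heΦ : Measurable fun z : E d × ℝ => e (Φ z.1 z.2) := hem.comp hΦ.cont.measurable
  have h1 : ∀ x, (∫⁻ t in Ioc 0 T₁, e (Φ x t) ^ (2 : ℝ)) ^ p ≤
      (∫⁻ t in Ioc 0 T₁, e (Φ x t) ^ (2 * p)) * ENNReal.ofReal T₁ ^ (p - 1) := by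
    intro x
    have hm : Measurable fun t => e (Φ x t) ^ (2 : ℝ) :=
      (hem.comp (hΦ.continuous_apply x).measurable).pow_const _
    have := lintegral_rpow_le (μ := volume.restrict (Ioc 0 T₁)) hm hp
    simp only [← ENNReal.rpow_mul, Measure.restrict_apply_univ, Real.volume_Ioc, sub_zero] at this
    exact this
  have h2 : ∫⁻ x in ω, ∫⁻ t in Ioc 0 T₁, e (Φ x t) ^ (2 * p) =
      ∫⁻ t in Ioc 0 T₁, ∫⁻ x in ω, e (Φ x t) ^ (2 * p) :=
    lintegral_lintegral_swap (heΦ.pow_const _).aemeasurable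
  have h3 : ∫⁻ t in Ioc 0 T₁, ∫⁻ x in ω, e (Φ x t) ^ (2 * p) ≤
      ∫⁻ t in Ioc 0 T₁, ENNReal.ofReal (Real.exp (constK P Ω SS C * t)) *
        ENNReal.ofReal (uErr P ρ SS (2 * p) ε ^ (2 * p)) := by
    refine setLIntegral_mono' measurableSet_Ioc fun t ht => ?_
    rw [← h.lintegral_uErr hb hε hp0]
    exact h.lintegral_flow_le hb hε hΦ ⟨ht.1.le, ht.2.trans hT₁.2⟩
      (fun x hx s hs => hin x hx s ⟨hs.1, hs.2.trans ht.2⟩) (hem.pow_const _)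
  calc _ ≤ ∫⁻ x in ω, (∫⁻ t in Ioc 0 T₁, e (Φ x t) ^ (2 * p)) * ENNReal.ofReal T₁ ^ (p - 1) :=
        lintegral_mono h1
    _ = (∫⁻ x in ω, ∫⁻ t in Ioc 0 T₁, e (Φ x t) ^ (2 * p)) * ENNReal.ofReal T₁ ^ (p - 1) :=
        lintegral_mul_const' _ _ (ENNReal.rpow_ne_top_of_nonneg (by linarith) ENNReal.ofReal_ne_top)
    _ ≤ _ := by
      rw [h2]
      gcongr
      refine h3.trans_eq ?_
      exact lintegral_mul_const' _ _ ENNReal.ofReal_ne_top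

/-- The `L^p` estimate for the cost gap. -/
lemma Standing.eLpNorm_costGap_le (h : Standing P Ω ω δ w C ρ) (hb : Bounds P Ω SS w D M)
    (hε : ε ∈ Ioc 0 (D / 2)) (hΦ : IsFlow P Ω (uEps P ρ ε) T F' L N Φ) (hT₁ : T₁ ∈ Icc 0 T)
    (hin : ∀ x ∈ ω, ∀ t ∈ Icc 0 T₁, Φ x t ∈ innerSet Ω ω w δ M ε)
    (hnear : ∀ x ∈ ω, ∀ t ∈ Icc 0 T, ∃ z ∈ SS, dist (Φ x t) z ≤ D / 2) {p : ℝ} (hp : 1 ≤ p) :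
    eLpNorm (costGap P Ω (uEps P ρ ε) T) (ENNReal.ofReal p) (volume.restrict ω) ≤
      ENNReal.ofReal (P.β / 2) *
        (((∫⁻ t in Ioc 0 T₁, ENNReal.ofReal (Real.exp (constK P Ω SS C * t))) *
          ENNReal.ofReal (uErr P ρ SS (2 * p) ε ^ (2 * p)) *
            ENNReal.ofReal T₁ ^ (p - 1)) ^ (1 / p) +
        ENNReal.ofReal ((P.β⁻¹ * (M * M) + P.β⁻¹ * (M * M)) ^ 2) * ENNReal.ofReal (T - T₁) *
          volume ω ^ (1 / p)) := by
  have hp0 : 0 < p := by linarith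
  have hD := hb.D_pos
  have huL := locallyLipschitz_uEps h.mollifier h.cont hε.1
  set e : E d → ℝ≥0∞ := fun z => ‖uEps P ρ ε z - P.feedback P.V z‖ₑ with he
  have hem : Measurable e := (measurable_uEps_sub P ε).enorm
  have heΦ : Measurable fun z : E d × ℝ => e (Φ z.1 z.2) := hem.comp hΦ.cont.measurable
  set c := P.β⁻¹ * (M * M) + P.β⁻¹ * (M * M) with hc
  have hc0 : 0 ≤ c := by
    have := hb.M_nonneg
    have := P.β_pos
    positivity
  set g : E d → ℝ≥0∞ := fun x => ∫⁻ t in Ioc 0 T₁, e (Φ x t) ^ (2 : ℝ) with hg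
  have hgm : Measurable g := (heΦ.pow_const 2).lintegral_prod_right'
  set a : ℝ≥0∞ := ENNReal.ofReal (c ^ 2) * ENNReal.ofReal (T - T₁) with ha
  set k : E d → ℝ≥0∞ := fun _ => a with hk
  have hpt : ∀ᵐ x ∂(volume.restrict ω), ‖costGap P Ω (uEps P ρ ε) T x‖ₑ ≤
      ENNReal.ofReal (P.β / 2) * (g + k) x := by
    filter_upwards [ae_restrict_mem h.isOpen_ω.measurableSet, ae_restrict_of_ae
      (hΦ.ae_flowGap_le huL.continuous h.finite h.isOpen
        (h.semiConcave.locallyLipschitzOn h.isOpen))] with x hx hgap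
    have hmem : ∀ t ∈ Icc 0 T, Φ x t ∈ Ω := by
      intro t ht
      obtain ⟨z, hz, hd⟩ := hnear x hx t ht
      exact hb.mem z hz _ (hd.trans (by linarith))
    rw [hΦ.costGap_eq hmem, Real.enorm_of_nonneg (hΦ.flowGap_nonneg huL.continuous h.finite hmem)]
    refine (hgap hmem).trans ?_
    gcongr
    -- Transport is available only up to T₁, while trajectories are inside `innerSet`. On the
    -- remaining short interval the squared error is bounded pointwise by c².
    rw [← Ioc_union_Ioc_eq_Ioc hT₁.1 hT₁.2]
    refine (lintegral_union_le _ _ _).trans ?_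
    refine add_le_add le_rfl ?_
    calc ∫⁻ t in Ioc T₁ T, e (Φ x t) ^ (2 : ℝ) ≤ ∫⁻ _ in Ioc T₁ T, ENNReal.ofReal (c ^ 2) := by
          refine setLIntegral_mono' measurableSet_Ioc fun t ht => ?_
          obtain ⟨z, hz, hd⟩ := hnear x hx t ⟨hT₁.1.trans ht.1.le, ht.2⟩
          have h1 : ‖uEps P ρ ε (Φ x t) - P.feedback P.V (Φ x t)‖ ≤ c :=
            (norm_sub_le _ _).trans (add_le_add (h.norm_uEps_le hb hz hd hε)
              (hb.norm_feedback_le hz (hd.trans (by linarith))))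
          simp only [he]
          rw [← ofReal_norm, ENNReal.ofReal_rpow_of_nonneg (norm_nonneg _) two_pos.le, Real.rpow_two]
          exact ENNReal.ofReal_le_ofReal (pow_le_pow_left₀ (norm_nonneg _) h1 2)
      _ = a := by rw [setLIntegral_const, Real.volume_Ioc]
  rw [eLpNorm_eq_lintegral_rpow_enorm_toReal (by simpa using hp0) ENNReal.ofReal_ne_top,
    ENNReal.toReal_ofReal hp0.le]
  have hinv : 0 ≤ 1 / p := by positivity
  calc _ ≤ (∫⁻ x in ω, (ENNReal.ofReal (P.β / 2) * (g + k) x) ^ p) ^ (1 / p) := by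
        refine ENNReal.rpow_le_rpow (lintegral_mono_ae ?_) hinv
        filter_upwards [hpt] with x hx using ENNReal.rpow_le_rpow hx hp0.le
    _ = ENNReal.ofReal (P.β / 2) * (∫⁻ x in ω, (g + k) x ^ p) ^ (1 / p) := by
        simp only [ENNReal.mul_rpow_of_nonneg _ _ hp0.le]
        rw [lintegral_const_mul' _ _ (ENNReal.rpow_ne_top_of_nonneg hp0.le ENNReal.ofReal_ne_top),
          ENNReal.mul_rpow_of_nonneg _ _ hinv, ← ENNReal.rpow_mul, mul_one_div_cancel hp0.ne',
          ENNReal.rpow_one]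
    _ ≤ ENNReal.ofReal (P.β / 2) * ((∫⁻ x in ω, g x ^ p) ^ (1 / p) +
          (∫⁻ _ in ω, a ^ p) ^ (1 / p)) := by
        gcongr
        exact ENNReal.lintegral_Lp_add_le hgm.aemeasurable aemeasurable_const hp
    _ ≤ _ := by
        gcongr
        · exact h.lintegral_error_le hb hε hΦ hT₁ hin hp
        · rw [setLIntegral_const, ENNReal.mul_rpow_of_nonneg _ _ hinv, ← ENNReal.rpow_mul,
            mul_one_div_cancel hp0.ne', ENNReal.rpow_one]

end

/-! ### Asymptotics of the horizon, and trajectories up to it. -/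

lemma lintegral_exp_mul {K T : ℝ} (hK : 0 < K) (hT : 0 ≤ T) :
    ∫⁻ t in Ioc 0 T, ENNReal.ofReal (Real.exp (K * t)) =
      ENNReal.ofReal ((Real.exp (K * T) - 1) / K) := by
  have hc : Continuous fun t : ℝ => Real.exp (K * t) := by fun_prop
  have hi : IntervalIntegrable (fun t : ℝ => Real.exp (K * t)) volume 0 T :=
    hc.intervalIntegrable _ _
  have h1 : ∫ t in (0 : ℝ)..T, Real.exp (K * t) = (Real.exp (K * T) - 1) / K := by
    rw [intervalIntegral.integral_eq_sub_of_hasDerivAt (f := fun t => Real.exp (K * t) / K)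
      (fun t _ => ?_) hi]
    · rw [mul_zero, Real.exp_zero, sub_div]
    · have := (((hasDerivAt_id t).const_mul K).exp).div_const K
      simpa [hK.ne'] using this
  rw [intervalIntegrable_iff_integrableOn_Ioc_of_le hT] at hi
  rw [← ofReal_integral_eq_lintegral_ofReal hi (Eventually.of_forall fun t => (Real.exp_pos _).le),
    ← intervalIntegral.integral_of_le hT, h1]

section

variable {d m : ℕ} {P : ControlProblem d m} {Ω ω : Set (E d)} {δ : ℝ} {w : E d → ℝ}
  {C : ℝ} {ρ : E d → ℝ} {D M : ℝ}

local notation "SS" => omegaDelta Ω ω w δ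

/-- Both entries of the minimum diverge: σ_ε and the feedback error tend to zero, and the values at
zero are infinite by convention. -/
lemma Standing.tendsto_tauEps (h : Standing P Ω ω δ w C ρ) (hb : Bounds P Ω SS w D M)
    {κ : ℝ → ℝ} {p : ℝ} (hp : 1 ≤ p) (hκtop : Tendsto κ (𝓝[>] 0) atTop) :
    Tendsto (tauEps P ρ w SS δ p κ) (𝓝[>] 0) (𝓝 ⊤) := by
  have h1 : Tendsto (fun ε => ENNReal.ofReal δ / sigmaSum P w SS ε) (𝓝[>] 0) (𝓝 ⊤) := by
    have := ENNReal.Tendsto.const_div (a := ENNReal.ofReal δ) (h.tendsto_sigmaSum hb)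
      (Or.inl ENNReal.zero_ne_top)
    rwa [ENNReal.div_zero (by simpa using h.lyap.δ_pos)] at this
  have h2 : Tendsto (fun ε => kappaExt κ (uErr P ρ SS (2 * p) ε)) (𝓝[>] 0) (𝓝 ⊤) := by
    rw [ENNReal.tendsto_nhds_top_iff_nnreal]
    intro x
    have h3 := hκtop.eventually_gt_atTop (x : ℝ)
    rw [eventually_nhdsWithin_iff] at h3
    filter_upwards [(h.tendsto_uErr hb (show 0 < 2 * p by linarith)).eventually h3] with ε hε
    rw [kappaExt]
    split_ifs with h0
    · exact ENNReal.coe_lt_top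
    · rw [← ENNReal.ofReal_coe_nnreal]
      have := hε ((uErr_nonneg P SS (2 * p) ε).lt_of_ne' h0)
      exact (ENNReal.ofReal_lt_ofReal_iff (x.2.trans_lt this)).2 this
  have h3 := h1.min h2
  rw [min_self] at h3
  exact h3

lemma Standing.eventually_le_tauEps (h : Standing P Ω ω δ w C ρ) (hb : Bounds P Ω SS w D M)
    {κ : ℝ → ℝ} {p : ℝ} (hp : 1 ≤ p) (hκtop : Tendsto κ (𝓝[>] 0) atTop) (T : ℝ) :
    ∀ᶠ ε in 𝓝[>] 0, ENNReal.ofReal T ≤ tauEps P ρ w SS δ p κ ε :=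
  ((h.tendsto_tauEps hb hp hκtop).eventually_const_lt ENNReal.ofReal_lt_top).mono fun _ => le_of_lt

/-- Behaviour of the trajectories from `ω` up to the horizon `τ_ε`: they stay in `innerSet` up to
a short final time interval, and close to `ω_δ` all the time. -/
lemma Standing.eventually_flow_mem (h : Standing P Ω ω δ w C ρ)
    (hb : Bounds P Ω SS w D M) {κ : ℝ → ℝ} {p : ℝ} (hp : 1 ≤ p)
    (hκtop : Tendsto κ (𝓝[>] 0) atTop)
    (hκ : Tendsto (fun s => κ s ^ ((p - 1) / p)
        * (Real.exp (constK P Ω SS C * κ s) - 1) ^ (1 / p) * s ^ 2) (𝓝[>] 0) (𝓝 0))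
    {η : ℝ} (hη : 0 < η) (hηD : (M + M * (P.β⁻¹ * (M * M))) * η < D / 2) :
    ∀ᶠ ε in 𝓝[>] (0 : ℝ), ε ∈ Ioc 0 (D / 2) ∧ ∀ T > 0,
      ENNReal.ofReal T ≤ tauEps P ρ w SS δ p κ ε → ∀ F' L N Φ,
        IsFlow P Ω (uEps P ρ ε) T F' L N Φ → ∃ T₁ ∈ Icc 0 T, T - T₁ ≤ η ∧
          (∀ x ∈ ω, ∀ t ∈ Icc 0 T₁, Φ x t ∈ innerSet Ω ω w δ M ε) ∧
          ∀ x ∈ ω, ∀ t ∈ Icc 0 T, ∃ z ∈ SS, dist (Φ x t) z ≤ D / 2 := by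
  have hD := hb.D_pos
  filter_upwards [h.eventually_exists_drift_bound hb hp hκtop hκ hη,
    h.eventually_le_tauEps hb hp hκtop (2 * η), Ioc_mem_nhdsGT (half_pos hD)]
    with ε hdrift hτ hε
  refine ⟨hε, fun T hT hTτ F' L N Φ hΦ => ?_⟩
  have hεD : ε ∈ Ioc 0 D := ⟨hε.1, hε.2.trans (by linarith)⟩
  obtain ⟨T₁, hT₁, hTη, r, hr, hr1, hr2⟩ : ∃ T₁ ∈ Icc 0 T, T - T₁ ≤ η ∧ ∃ r ≥ 0,
      (∀ x ∈ innerSet Ω ω w δ M ε,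
        inner ℝ (gradient w x) (P.f x + P.B x (uEps P ρ ε x)) ≤ r) ∧ r * T₁ < δ - M * ε := by
    -- A horizon T ≤ η leaves nothing after removing η. The drift bound for 2η, which τ_ε eventually
    -- exceeds, covers it entirely with T₁ = T.
    rcases le_or_gt T η with hle | hlt
    · obtain ⟨r, hr, hr1, hr2⟩ := hdrift (2 * η) (by linarith) hτ
      refine ⟨T, right_mem_Icc.2 hT.le, by linarith, r, hr, hr1, ?_⟩
      have : r * T ≤ r * (2 * η - η) := mul_le_mul_of_nonneg_left (by linarith) hr
      linarith
    · obtain ⟨r, hr, hr1, hr2⟩ := hdrift T hlt hTτ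
      exact ⟨T - η, ⟨by linarith, by linarith⟩, by linarith, r, hr, hr1, hr2⟩
  have hin : ∀ x ∈ ω, ∀ t ∈ Icc 0 T₁, Φ x t ∈ innerSet Ω ω w δ M ε := fun x hx =>
    h.mem_innerSet hb hεD hr hr1 hr2 (hΦ.continuous_apply x).continuousOn (by rwa [hΦ.init])
      fun t ht hmem => (hΦ.hasDerivWithinAt ⟨ht.1, ht.2.trans hT₁.2⟩ hmem).mono
        (Icc_subset_Icc_right hT₁.2)
  refine ⟨T₁, hT₁, hTη, hin, fun x hx t ht => ?_⟩
  rcases le_total t T₁ with hle | hle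
  · exact ⟨Φ x t, hb.innerSet_subset hε.1.le (hin x hx t ⟨ht.1, hle⟩), by
      rw [dist_self]; linarith⟩
  have hz : Φ x T₁ ∈ SS :=
    hb.innerSet_subset hε.1.le (hin x hx T₁ ⟨hT₁.1, le_rfl⟩)
  -- The velocity bound is valid only within D/2 of ω_δ, whence a first exit argument; `hηD` says
  -- that the interval is too short to travel that far.
  have hstay : ∀ s ∈ Icc 0 (T - T₁), Φ x (T₁ + s) ∈ Metric.ball (Φ x T₁) (D / 2) := by
    refine forall_mem_of_first_exit
      ((hΦ.continuous_apply x).comp (by fun_prop)).continuousOn Metric.isOpen_ball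
      fun s hs hlt => ?_
    rw [Metric.mem_ball, dist_eq_norm]
    have hv := (hΦ.curve x).norm_sub_le (s := T₁) (t := T₁ + s)
      (M := M + M * (P.β⁻¹ * (M * M))) hT₁.1 (by linarith [hs.1]) (by linarith [hs.2])
      fun r hr => by
        have hd := Metric.mem_ball.1 (hlt (r - T₁) ⟨by linarith [hr.1], by linarith [hr.2]⟩)
        rw [Function.comp_apply, add_sub_cancel] at hd
        rw [hΦ.eqOn (hb.mem _ hz _ (by linarith))]
        exact h.norm_field_le hb hz hd.le hε
    refine hv.trans_lt (lt_of_le_of_lt ?_ hηD)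
    have hM := hb.M_nonneg
    have := P.β_pos
    refine mul_le_mul_of_nonneg_left (by linarith [hs.2]) (by positivity)
  have := hstay (t - T₁) ⟨by linarith, by linarith [ht.2]⟩
  rw [add_sub_cancel] at this
  exact ⟨Φ x T₁, hz, (Metric.mem_ball.1 this).le⟩

lemma exists_pos_of_eventually {p : ℝ → Prop} (hp : ∀ᶠ ε in 𝓝[>] (0 : ℝ), p ε) :
    ∃ ε₀ > 0, ∀ ε ∈ Ioo 0 ε₀, p ε := by
  obtain ⟨u, hu, hsub⟩ := mem_nhdsGT_iff_exists_Ioo_subset.1 hp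
  exact ⟨u, hu, hsub⟩

lemma Standing.isCompact_closure_ω (h : Standing P Ω ω δ w C ρ) : IsCompact (closure ω) :=
  Metric.isCompact_of_isClosed_isBounded isClosed_closure (h.bounded.subset h.closure_ω)

lemma Standing.staysIn (h : Standing P Ω ω δ w C ρ) {ε T : ℝ} (hε : 0 < ε) {F' : E d → E d}
    {L N : ℝ≥0} {Φ : E d → ℝ → E d} (hΦ : IsFlow P Ω (uEps P ρ ε) T F' L N Φ) {U : Set (E d)}
    (hU : U ⊆ Ω) (hωU : closure ω ⊆ U) (hT : 0 < T)
    (hmem : ∀ x ∈ ω, ∀ t ∈ Icc 0 T, Φ x t ∈ U) : StaysIn P U (uEps P ρ ε) ω T where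
  lip := (locallyLipschitz_uEps h.mollifier h.cont hε).locallyLipschitzOn
  isOpen := h.isOpen_ω
  compact := h.isCompact_closure_ω
  subset := hωU
  pos := hT
  exists_sol := fun x hx => ⟨Φ x, hΦ.isClosedLoop hU (hmem x hx)⟩

/-- On ω the gap, defined through a choice of trajectories, agrees with the continuous `flowGap`,
which is bounded on the compact closure of ω. -/
lemma Standing.memLp_costGap (h : Standing P Ω ω δ w C ρ) {ε T : ℝ} (hε : 0 < ε)
    {F' : E d → E d} {L N : ℝ≥0} {Φ : E d → ℝ → E d} (hΦ : IsFlow P Ω (uEps P ρ ε) T F' L N Φ)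
    (hmem : ∀ x ∈ ω, ∀ t ∈ Icc 0 T, Φ x t ∈ Ω) (q : ℝ≥0∞) :
    MemLp (costGap P Ω (uEps P ρ ε) T) q (volume.restrict ω) := by
  have : IsFiniteMeasure (volume.restrict ω) := ⟨by
    rw [Measure.restrict_apply_univ]
    exact (h.bounded.subset (subset_closure.trans h.closure_ω)).measure_lt_top⟩
  have hc := hΦ.continuous_flowGap (locallyLipschitz_uEps h.mollifier h.cont hε).continuous h.cont
  obtain ⟨B, hB⟩ := (h.isCompact_closure_ω.image hc).isBounded.exists_norm_le
  have h1 : MemLp (flowGap P (uEps P ρ ε) T Φ) q (volume.restrict ω) := by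
    refine MemLp.of_bound hc.aestronglyMeasurable B ?_
    filter_upwards [ae_restrict_mem h.isOpen_ω.measurableSet] with x hx
    exact hB _ ⟨x, subset_closure hx, rfl⟩
  refine h1.ae_eq ?_
  filter_upwards [ae_restrict_mem h.isOpen_ω.measurableSet] with x hx
  exact (hΦ.costGap_eq (hmem x hx)).symm

/-- The transported error tends to zero. -/
lemma Standing.eventually_error_le (h : Standing P Ω ω δ w C ρ) (hb : Bounds P Ω SS w D M)
    {κ : ℝ → ℝ} {p : ℝ} (hp : 1 ≤ p) (hκtop : Tendsto κ (𝓝[>] 0) atTop)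
    (hκ : Tendsto (fun s => κ s ^ ((p - 1) / p)
        * (Real.exp (constK P Ω SS C * κ s) - 1) ^ (1 / p) * s ^ 2) (𝓝[>] 0) (𝓝 0))
    {b : ℝ} (hb0 : 0 < b) :
    ∀ᶠ ε in 𝓝[>] (0 : ℝ), ∀ T ≥ 0, ENNReal.ofReal T ≤ tauEps P ρ w SS δ p κ ε →
      ((∫⁻ t in Ioc 0 T, ENNReal.ofReal (Real.exp (constK P Ω SS C * t))) *
        ENNReal.ofReal (uErr P ρ SS (2 * p) ε ^ (2 * p)) *
          ENNReal.ofReal T ^ (p - 1)) ^ (1 / p) ≤ ENNReal.ofReal b := by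
  have hp0 : 0 < p := by linarith
  have hinv : 0 < 1 / p := by positivity
  have hzero : ∀ ε T, uErr P ρ SS (2 * p) ε = 0 →
      ((∫⁻ t in Ioc 0 T, ENNReal.ofReal (Real.exp (constK P Ω SS C * t))) *
        ENNReal.ofReal (uErr P ρ SS (2 * p) ε ^ (2 * p)) *
          ENNReal.ofReal T ^ (p - 1)) ^ (1 / p) ≤ ENNReal.ofReal b := by
    intro ε T h0
    rw [h0, Real.zero_rpow (by positivity), ENNReal.ofReal_zero, mul_zero, zero_mul,
      ENNReal.zero_rpow_of_pos hinv]
    exact zero_le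
  rcases (constK_nonneg P Ω SS h.C_pos.le).eq_or_lt with hK | hK
  · exact Eventually.of_forall fun ε T _ _ => hzero ε T (h.uErr_eq_zero hb hK.symm _ _)
  set K := constK P Ω SS C with hKdef
  -- Taking p-th roots of the transported error produces K^{−1/p} times the expression in the growth
  -- condition, with T replaced by its upper bound κ(s); this explains the normalisation b K^{1/p}.
  have h1 := (hκ.eventually_le_const (show 0 < b * K ^ (1 / p) by positivity)).and
    (hκtop.eventually_gt_atTop 0)
  rw [eventually_nhdsWithin_iff] at h1
  filter_upwards [(h.tendsto_uErr hb (show 0 < 2 * p by positivity)).eventually h1]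
    with ε hε T hT hTτ
  set s := uErr P ρ SS (2 * p) ε with hs
  rcases (uErr_nonneg (ρ := ρ) P SS (2 * p) ε).eq_or_lt with h0 | h0
  · exact hzero ε T h0.symm
  obtain ⟨h2, h3⟩ := hε h0
  have hTκ : T ≤ κ s := by
    have := hTτ.trans (min_le_right _ _)
    rw [kappaExt, if_neg h0.ne', ENNReal.ofReal_le_ofReal_iff h3.le] at this
    exact this
  have hp1 : 0 ≤ p - 1 := by linarith
  have hexp : 0 ≤ (Real.exp (K * T) - 1) / K :=
    div_nonneg (sub_nonneg.2 (Real.one_le_exp (by positivity))) hK.le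
  have hexp' : 0 ≤ Real.exp (K * κ s) - 1 := sub_nonneg.2 (Real.one_le_exp (by positivity))
  have hs2 : 0 ≤ s ^ (2 * p) := Real.rpow_nonneg h0.le _
  rw [lintegral_exp_mul hK hT, ENNReal.ofReal_rpow_of_nonneg hT hp1, ← ENNReal.ofReal_mul hexp,
    ← ENNReal.ofReal_mul (by positivity), ENNReal.ofReal_rpow_of_nonneg
      (mul_nonneg (mul_nonneg hexp hs2) (Real.rpow_nonneg hT _)) hinv.le]
  refine ENNReal.ofReal_le_ofReal ?_
  have hle : (Real.exp (K * T) - 1) / K * s ^ (2 * p) * T ^ (p - 1) ≤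
      (Real.exp (K * κ s) - 1) / K * s ^ (2 * p) * κ s ^ (p - 1) := by gcongr
  refine (Real.rpow_le_rpow (mul_nonneg (mul_nonneg hexp hs2) (Real.rpow_nonneg hT _)) hle
    hinv.le).trans ?_
  rw [Real.mul_rpow (by positivity) (by positivity), Real.mul_rpow (by positivity) (by positivity),
    Real.div_rpow hexp' hK.le, ← Real.rpow_mul h0.le, ← Real.rpow_mul h3.le]
  have e1 : 2 * p * (1 / p) = (2 : ℕ) := by push_cast; field_simp
  have e2 : (p - 1) * (1 / p) = (p - 1) / p := by ring
  rw [e1, e2, Real.rpow_natCast]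
  have hKp : 0 < K ^ (1 / p) := by positivity
  rw [div_mul_eq_mul_div, div_mul_eq_mul_div, div_le_iff₀ hKp]
  refine le_trans (le_of_eq ?_) h2
  ring

end

/-! ### The three conclusions. -/

section

variable {d m : ℕ} {P : ControlProblem d m} {Ω ω : Set (E d)} {δ : ℝ} {w : E d → ℝ}
  {C : ℝ} {ρ : E d → ℝ} {D M : ℝ}

local notation "SS" => omegaDelta Ω ω w δ

lemma exists_eta {c a b : ℝ} (ha : 0 < a) {Q : ℝ≥0∞} (hQ : Q ≠ ⊤) (hb : 0 < b) :
    ∃ η > 0, c * η < a ∧ Q * ENNReal.ofReal η ≤ ENNReal.ofReal b := by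
  have h1 : Tendsto (fun η : ℝ => c * η) (𝓝[>] 0) (𝓝 0) :=
    (Continuous.tendsto' (by fun_prop) _ _ (by simp)).mono_left nhdsWithin_le_nhds
  have h2 : Tendsto (fun η : ℝ => Q * ENNReal.ofReal η) (𝓝[>] 0) (𝓝 0) := by
    have h3 : Tendsto ENNReal.ofReal (𝓝[>] 0) (𝓝 0) :=
      (ENNReal.continuous_ofReal.tendsto' 0 0 ENNReal.ofReal_zero).mono_left nhdsWithin_le_nhds
    simpa using ENNReal.Tendsto.const_mul h3 (Or.inr hQ)
  obtain ⟨η, e1, e2, e3⟩ := ((h1.eventually_lt_const ha).and ((h2.eventually_le_const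
    (ENNReal.ofReal_pos.2 hb)).and self_mem_nhdsWithin)).exists
  exact ⟨η, e3, e1, e2⟩

lemma Standing.eventually_staysIn_memLp (h : Standing P Ω ω δ w C ρ) (hb : Bounds P Ω SS w D M)
    {κ : ℝ → ℝ} {p : ℝ} (hp : 1 ≤ p) (hκtop : Tendsto κ (𝓝[>] 0) atTop)
    (hκ : Tendsto (fun s => κ s ^ ((p - 1) / p)
        * (Real.exp (constK P Ω SS C * κ s) - 1) ^ (1 / p) * s ^ 2) (𝓝[>] 0) (𝓝 0)) :
    ∀ᶠ ε in 𝓝[>] (0 : ℝ), ∀ T > 0, ENNReal.ofReal T ≤ tauEps P ρ w SS δ p κ ε →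
      StaysIn P Ω (uEps P ρ ε) ω T ∧
        MemLp (costGap P Ω (uEps P ρ ε) T) (ENNReal.ofReal p) (volume.restrict ω) := by
  obtain ⟨η, hη, hηD, -⟩ := exists_eta (c := M + M * (P.β⁻¹ * (M * M))) (half_pos hb.D_pos)
    ENNReal.zero_ne_top one_pos
  filter_upwards [h.eventually_flow_mem hb hp hκtop hκ hη hηD] with ε hε T hT hTτ
  obtain ⟨hε, hflow⟩ := hε
  obtain ⟨F', L, N, Φ, hΦ⟩ := exists_isFlow (P := P)
    (locallyLipschitz_uEps h.mollifier h.cont hε.1) h.bounded hT.le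
  obtain ⟨T₁, -, -, -, hnear⟩ := hflow T hT hTτ F' L N Φ hΦ
  have hmem : ∀ x ∈ ω, ∀ t ∈ Icc 0 T, Φ x t ∈ Ω := by
    intro x hx t ht
    obtain ⟨z, hz, hd⟩ := hnear x hx t ht
    exact hb.mem z hz _ (hd.trans (by linarith [hb.D_pos]))
  exact ⟨h.staysIn hε.1 hΦ subset_rfl h.closure_ω hT hmem, h.memLp_costGap hε.1 hΦ hmem _⟩

lemma Standing.eventually_staysIn_omegaDelta (h : Standing P Ω ω δ w C ρ)
    (hb : Bounds P Ω SS w D M) {κ : ℝ → ℝ} {p : ℝ} (hp : 1 ≤ p)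
    (hκtop : Tendsto κ (𝓝[>] 0) atTop)
    (hκ : Tendsto (fun s => κ s ^ ((p - 1) / p)
        * (Real.exp (constK P Ω SS C * κ s) - 1) ^ (1 / p) * s ^ 2) (𝓝[>] 0) (𝓝 0))
    {θ : ℝ} (hθ : θ ∈ Ioo (0 : ℝ) 1) :
    ∀ᶠ ε in 𝓝[>] (0 : ℝ), ∀ T > 0,
      ENNReal.ofReal T ≤ ENNReal.ofReal θ * tauEps P ρ w SS δ p κ ε →
        StaysIn P SS (uEps P ρ ε) ω T := by
  have hD := hb.D_pos
  have hθ1 : 0 < 1 - θ := sub_pos.2 hθ.2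
  filter_upwards [h.eventually_exists_drift_bound hb hp hκtop hκ one_pos,
    h.eventually_le_tauEps hb hp hκtop (1 / (1 - θ)), Ioc_mem_nhdsGT hD] with ε hdrift hτ hε T hT hTτ
  set τ := tauEps P ρ w SS δ p κ ε
  -- As soon as τ_ε ≥ 1/(1 − θ), a time up to θτ_ε can be lengthened by 1 and still be at most τ_ε.
  -- The drift bound with η = 1 then controls all of [0,T], with no uncontrolled final interval.
  have hle : ENNReal.ofReal (T + 1) ≤ τ := by
    have h1 : ENNReal.ofReal 1 ≤ ENNReal.ofReal (1 - θ) * τ := by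
      calc ENNReal.ofReal 1 = ENNReal.ofReal (1 - θ) * ENNReal.ofReal (1 / (1 - θ)) := by
            rw [← ENNReal.ofReal_mul hθ1.le, mul_one_div_cancel hθ1.ne']
        _ ≤ _ := by gcongr
    calc ENNReal.ofReal (T + 1) = ENNReal.ofReal T + ENNReal.ofReal 1 :=
          ENNReal.ofReal_add hT.le zero_le_one
      _ ≤ ENNReal.ofReal θ * τ + ENNReal.ofReal (1 - θ) * τ := add_le_add hTτ h1
      _ = τ := by
        rw [← add_mul, ← ENNReal.ofReal_add hθ.1.le hθ1.le, add_sub_cancel, ENNReal.ofReal_one,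
          one_mul]
  obtain ⟨r, hr, hr1, hr2⟩ := hdrift (T + 1) (by linarith) hle
  rw [add_sub_cancel_right] at hr2
  obtain ⟨F', L, N, Φ, hΦ⟩ := exists_isFlow (P := P)
    (locallyLipschitz_uEps h.mollifier h.cont hε.1) h.bounded hT.le
  refine h.staysIn hε.1 hΦ omegaDelta_subset h.lyap.subset hT fun x hx t ht =>
    hb.innerSet_subset hε.1.le ?_
  exact h.mem_innerSet hb hε hr hr1 hr2 (hΦ.continuous_apply x).continuousOn (by rwa [hΦ.init])
    (fun t ht hmem => hΦ.hasDerivWithinAt ht hmem) t ht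

/-- For a prescribed tolerance η is fixed first, then ε → 0: the transported error falls below η
while the last interval contributes a multiple of η. -/
lemma Standing.tendsto_eLpNorm_costGap (h : Standing P Ω ω δ w C ρ) (hb : Bounds P Ω SS w D M)
    {κ : ℝ → ℝ} {p : ℝ} (hp : 1 ≤ p) (hκtop : Tendsto κ (𝓝[>] 0) atTop)
    (hκ : Tendsto (fun s => κ s ^ ((p - 1) / p)
        * (Real.exp (constK P Ω SS C * κ s) - 1) ^ (1 / p) * s ^ 2) (𝓝[>] 0) (𝓝 0)) :
    Tendsto (fun ε => eLpNorm (costGap P Ω (uEps P ρ ε) (tauEps P ρ w SS δ p κ ε).toReal)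
        (ENNReal.ofReal p) (volume.restrict ω))
      (𝓝[>] 0 ⊓ 𝓟 {ε | tauEps P ρ w SS δ p κ ε ≠ ⊤}) (𝓝 0) := by
  have hp0 : 0 < p := by linarith
  rw [ENNReal.tendsto_nhds_zero]
  intro a ha
  obtain ⟨a', ha'0, ha'⟩ : ∃ a' : ℝ, 0 < a' ∧ ENNReal.ofReal a' ≤ a := by
    rcases eq_or_ne a ⊤ with rfl | hatop
    · exact ⟨1, one_pos, le_top⟩
    · exact ⟨a.toReal, ENNReal.toReal_pos ha.ne' hatop, ENNReal.ofReal_toReal_le⟩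
  set c := P.β⁻¹ * (M * M) + P.β⁻¹ * (M * M)
  set v : ℝ≥0∞ := volume ω ^ (1 / p) with hv
  have hvtop : v ≠ ⊤ := ENNReal.rpow_ne_top_of_nonneg (by positivity)
    (h.bounded.subset (subset_closure.trans h.closure_ω)).measure_lt_top.ne
  have hQ : ENNReal.ofReal (P.β / 2) * (1 + ENNReal.ofReal (c ^ 2) * v) ≠ ⊤ :=
    ENNReal.mul_ne_top ENNReal.ofReal_ne_top (ENNReal.add_ne_top.2
      ⟨ENNReal.one_ne_top, ENNReal.mul_ne_top ENNReal.ofReal_ne_top hvtop⟩)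
  -- One η meets three demands: it is the length of the uncontrolled interval, short enough to stay
  -- within D/2, it is the target for the transported error, and its multiple by the total constant
  -- is within the tolerance.
  obtain ⟨η, hη, hηD, hηa⟩ := exists_eta (c := M + M * (P.β⁻¹ * (M * M))) (half_pos hb.D_pos)
    hQ ha'0
  rw [eventually_inf_principal]
  filter_upwards [h.eventually_flow_mem hb hp hκtop hκ hη hηD,
    h.eventually_error_le hb hp hκtop hκ hη, h.eventually_le_tauEps hb hp hκtop 1]
    with ε hflow herr hone hfin
  obtain ⟨hε, hflow⟩ := hflow
  set T := (tauEps P ρ w SS δ p κ ε).toReal with hT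
  have hTτ : ENNReal.ofReal T = tauEps P ρ w SS δ p κ ε := ENNReal.ofReal_toReal hfin
  have hT0 : 0 < T := by
    have h1 : (1 : ℝ) ≤ T := by
      rw [← hTτ] at hone
      exact (ENNReal.ofReal_le_ofReal_iff ENNReal.toReal_nonneg).1 hone
    linarith
  obtain ⟨F', L, N, Φ, hΦ⟩ := exists_isFlow (P := P)
    (locallyLipschitz_uEps h.mollifier h.cont hε.1) h.bounded hT0.le
  obtain ⟨T₁, hT₁, hTη, hin, hnear⟩ := hflow T hT0 hTτ.le F' L N Φ hΦ
  refine (h.eLpNorm_costGap_le hb hε hΦ hT₁ hin hnear hp).trans (le_trans ?_ (hηa.trans ha'))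
  have h1 := herr T₁ hT₁.1 ((ENNReal.ofReal_le_ofReal hT₁.2).trans hTτ.le)
  calc _ ≤ ENNReal.ofReal (P.β / 2) *
        (ENNReal.ofReal η + ENNReal.ofReal (c ^ 2) * ENNReal.ofReal η * v) := by
        gcongr
    _ = _ := by ring

end

end FeedbackHJB

theorem mainTheorem2 {d m : ℕ} (P : ControlProblem d m)
    (hVfin : ∀ y, P.eValue y ≠ ⊤) (hVcont : Continuous P.V)
    (Ω ω : Set (E d)) (hΩo : IsOpen Ω) (hΩc : Convex ℝ Ω) (hΩb : Bornology.IsBounded Ω)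
    (hωo : IsOpen ω) (hω : closure ω ⊆ Ω)
    (δ : ℝ) (w : E d → ℝ) (hLyap : LyapunovHyp P Ω ω P.V δ w 0)
    (C : ℝ) (hC : 0 < C) (hsc : SemiConcaveOn Ω C P.V)
    (ρ : E d → ℝ) (hρ : IsMollifier ρ)
    (p : ℝ) (hp : 1 ≤ p)
    (κ : ℝ → ℝ) (hκpos : ∀ s ∈ Ioo (0 : ℝ) 1, 0 < κ s)
    (hκtop : Tendsto κ (𝓝[>] 0) atTop)
    (hκ : Tendsto (fun s => κ s ^ ((p - 1) / p)
        * (Real.exp (constK P Ω (omegaDelta Ω ω w δ) C * κ s) - 1) ^ (1 / p) * s ^ 2)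
      (𝓝[>] 0) (𝓝 0)) :
    -- the closed loop trajectories from `ω` exist and stay in `Ω` up to time `τ_ε`
    (∃ ε₀ > 0, ∀ ε ∈ Ioo 0 ε₀, ∀ T > 0,
      ENNReal.ofReal T ≤ tauEps P ρ w (omegaDelta Ω ω w δ) δ p κ ε →
        StaysIn P Ω (uEps P ρ ε) ω T ∧
        MemLp (costGap P Ω (uEps P ρ ε) T) (ENNReal.ofReal p) (volume.restrict ω)) ∧
    -- they stay in `ω_δ` up to any fixed fraction of `τ_ε`
    (∀ θ ∈ Ioo (0 : ℝ) 1, ∃ ε₁ > 0, ∀ ε ∈ Ioo 0 ε₁, ∀ T > 0,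
      ENNReal.ofReal T ≤ ENNReal.ofReal θ * tauEps P ρ w (omegaDelta Ω ω w δ) δ p κ ε →
        StaysIn P (omegaDelta Ω ω w δ) (uEps P ρ ε) ω T) ∧
    Tendsto (tauEps P ρ w (omegaDelta Ω ω w δ) δ p κ) (𝓝[>] 0) (𝓝 ⊤) ∧
    Tendsto (fun ε => eLpNorm
        (costGap P Ω (uEps P ρ ε) (tauEps P ρ w (omegaDelta Ω ω w δ) δ p κ ε).toReal)
        (ENNReal.ofReal p) (volume.restrict ω))
      (𝓝[>] 0 ⊓ 𝓟 {ε | tauEps P ρ w (omegaDelta Ω ω w δ) δ p κ ε ≠ ⊤}) (𝓝 0) := by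
  have h : Standing P Ω ω δ w C ρ :=
    ⟨hVfin, hVcont, hΩo, hΩc, hΩb, hωo, hω, hLyap, hC, hsc, hρ⟩
  obtain ⟨D, M, hb⟩ := h.exists_bounds
  exact ⟨exists_pos_of_eventually (h.eventually_staysIn_memLp hb hp hκtop hκ),
    fun θ hθ => exists_pos_of_eventually (h.eventually_staysIn_omegaDelta hb hp hκtop hκ hθ),
    h.tendsto_tauEps hb hp hκtop, h.tendsto_eLpNorm_costGap hb hp hκtop hκ⟩
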